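/- **Setting.** Let $V$ be a finite-dimensional complex vector space with a nondegenerate symmetric bilinear form $(-,-)$, also transported to $V^*$. A *root system* is a finite set $\Phi\subset V^*$ of vectors with $(\alpha,\alpha)\ne0$ such that $\Phi\cap\mathbb C\alpha=\{\pm\alpha\}$ and $\Phi$ is stable under the orthogonal reflections $s_\alpha$, for all $\alpha\in\Phi$. Let $\Phi$ be a root system and $\Psi\subset\Phi$ a root subsystem with base $\Omega$ (a linearly independent subset $\Omega\subset\Psi$ such that each root in $\Psi$ is, up to sign, a combination of $\Omega$ with nonnegative real coefficients). Let $G$ and $W$ be the groups generated by the reflections in $\Phi$ and in $\Psi$, let $\ell$ be the length function of $W$ with respect to the simple reflections $s_\alpha$, $\alpha\in\Omega$, and let $\omega_0$ be the longest element of $W$. Let $\Lambda=\mathrm{Sym}(V^*)$ be the algebra of polynomial functions on $V$ and $\Gamma=\Lambda^G$; $\Gamma$ acts on $\Gamma^*=\mathrm{Hom}_{\mathbb C}(\Gamma,\mathbb C)$ by $(\gamma\cdot\chi)(f)=\chi(\gamma f)$. For a reduced decomposition $\sigma=s_{\alpha_1}\cdots s_{\alpha_r}$, $\alpha_i\in\Omega$,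 let $\partial_\sigma=\nabla_{\alpha_1}\circ\cdots\circ\nabla_{\alpha_r}$, where $\nabla_\alpha(f)=(f-s_\alpha f)/\alpha$. The Schubert polynomials are $\mathfrak S_\sigma=\frac1{|W|}\partial_{\sigma^{-1}\omega_0}\bigl(\prod_{\alpha\in\Psi^+}\alpha\bigr)$, $\sigma\in W$. Let $I_W\subset\Lambda$ be the ideal generated by the $W$-invariants without constant term. Let $\Theta$ be the algebra morphism from $\Lambda$ to the constant coefficient differential operators on $\Lambda$ that sends $\alpha\in V^*$ to the derivation $\beta\mapsto(\beta,\alpha)$, and set $(f,g)_\Theta=\Theta(f)(g)(0)$. Let $P_\sigma\in\Lambda$ be the unique element with $(f,P_\sigma)_\Theta=0$ for all $f\in I_W$ and $(P_\sigma,\mathfrak S_\tau)_\Theta=\delta_{\sigma,\tau}$ for all $\tau\in W$. For $v\in V$ and $\sigma\in W$ let $\mathcal D_\sigma^v\in\Gamma^*$ be $\gamma\mapsto\bigl(\Theta(P_\sigma)\gamma\bigr)(v)$, let $\mathcal D(\Omega,v)\subset\Gamma^*$ be the span of all $\mathcal D^v_\sigma$, $\sigma\in W$, and let $\mathrm{ev}_v\in\Gamma^*$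 be evaluation at $v$. Let $W_v$ be the stabilizer of $v$ in $W$, $W^v$ the set of minimal length representatives of the left cosets $\sigma W_v$ in $W$, and $\omega_0^v$ the longest element of $W^v$. Call $v$ *$\Omega$-standard* if $\{\alpha\in\Psi\mid\alpha(v)=0\}$ is the root subsystem generated by a subset of $\Omega$. **Proposition.** Let $v\in V$ be $\Omega$-standard. Consider the condition $(*)$ every root $\alpha\in\Phi$ with $\alpha(v)=0$ lies in $\Psi$ or is orthogonal to $\Psi$. (a) The set $\{\mathcal D_\sigma^v\mid\sigma\in W^v\}$ spans $\mathcal D(\Omega,v)$, and $\mathcal D_\sigma^v=0$ for all $\sigma\in W\setminus W^v$. If $(*)$ holds, then $\{\mathcal D_\sigma^v\mid\sigma\in W^v\}$ is linearly independent, hence a basis of $\mathcal D(\Omega,v)$. (b) Assume $(*)$ and let $x=\sum_{\sigma\in W^v}a_\sigma\mathcal D_\sigma^v$ with $a_\sigma\in\mathbb C$. Then $\mathcal D(\Omega,v)=\Gamma\cdot x$ if and only if $a_{\omega_0^v}\ne0$. (c) We have $\mathrm{ev}_v\in\mathcal D(\Omega,v)$, and an element $x\in\mathcal D(\Omega,v)$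 satisfies $(\gamma-\gamma(v))x=0$ for all $\gamma\in\Gamma$ if and only if it is a scalar multiple of $\mathrm{ev}_v$. If $(*)$ holds and $x$ is written as in (b), this is the case if and only if $a_\sigma=0$ for all $\sigma\ne e$. (d) Let $v'\in V$. Then $\mathcal D(\Omega,v)\cap\mathcal D(\Omega,v')\ne0$ if and only if $v'$ is in the $G$-orbit of $v$; and if $v'$ is in the $W$-orbit of $v$, then $\mathcal D(\Omega,v)=\mathcal D(\Omega,v')$. -/

import Mathlib

noncomputable section

namespace BGG

/-- A (complex bilinear) inner product on the complex vector space `V`: a nondegenerate symmetric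
bilinear form. -/
structure InnerForm (V : Type*) [AddCommGroup V] [Module ℂ V] where
  form : LinearMap.BilinForm ℂ V
  symm : ∀ x y : V, form x y = form y x
  nondeg : form.Nondegenerate

variable {V : Type*} [AddCommGroup V] [Module ℂ V]

/-- The algebra `Λ = S(V)` of polynomial functions on `V`: the symmetric algebra of `V^*`. -/
abbrev Poly (V : Type*) [AddCommGroup V] [Module ℂ V] : Type _ :=
  SymmetricAlgebra ℂ (Module.Dual ℂ V)

/-- The inclusion of `V^*` into `Λ`. -/
abbrev lin (α : Module.Dual ℂ V) : Poly V := SymmetricAlgebra.ι ℂ (Module.Dual ℂ V) α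

/-- Evaluation of polynomial functions at `v`. -/
def evalAt (v : V) : Poly V →ₐ[ℂ] ℂ := SymmetricAlgebra.lift (Module.Dual.eval ℂ V v)

/-- The pullback `f ↦ f ∘ φ` of polynomial functions. -/
def pull (φ : V →ₗ[ℂ] V) : Poly V →ₐ[ℂ] Poly V :=
  SymmetricAlgebra.lift (SymmetricAlgebra.ι ℂ (Module.Dual ℂ V) ∘ₗ φ.dualMap)

/-- The action `g · f = f ∘ g⁻¹` of `GL(V)` on `Λ`. -/
def act (g : V ≃ₗ[ℂ] V) : Poly V →ₐ[ℂ] Poly V := pull (g⁻¹ : V ≃ₗ[ℂ] V).toLinearMap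

namespace InnerForm

variable [FiniteDimensional ℂ V] (Q : InnerForm V)

/-- The vector `v_α` with `α (x) = (x, v_α)` for all `x`. -/
def vec (α : Module.Dual ℂ V) : V := (Q.form.toDual Q.nondeg).symm α

theorem form_vec (α : Module.Dual ℂ V) (x : V) : Q.form x (Q.vec α) = α x := by
  rw [Q.symm, ← LinearMap.BilinForm.toDual_def Q.nondeg, vec, LinearEquiv.apply_symm_apply]

/-- The bilinear form on `V^*` transported from `V`: `(α, β) = (v_α, v_β)`. -/
def dualForm (α β : Module.Dual ℂ V) : ℂ := Q.form (Q.vec α) (Q.vec β)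

/-- The orthogonal reflection `s_α` of `V` through `ker α` (for `α` with `(α, α) ≠ 0`). -/
def refl (α : Module.Dual ℂ V) : V →ₗ[ℂ] V :=
  LinearMap.id - (2 / Q.dualForm α α) • α.smulRight (Q.vec α)

/-- A finite root system in `V^*`. -/
structure IsRootSystem (Φ : Finset (Module.Dual ℂ V)) : Prop where
  /-- the reflection `s_α` makes sense for every root `α` -/
  nonisotropic : ∀ α ∈ Φ, Q.dualForm α α ≠ 0
  inter_line : ∀ α ∈ Φ, {β | β ∈ Φ ∧ ∃ c : ℂ, β = c • α} = {α, -α}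
  refl_mem : ∀ α ∈ Φ, ∀ β ∈ Φ, (Q.refl α).dualMap β ∈ Φ

/-- The reflection group `W(Φ) ⊂ GL(V)` generated by the reflections `s_α`, `α ∈ Φ`. -/
def weyl (Φ : Finset (Module.Dual ℂ V)) : Subgroup (V ≃ₗ[ℂ] V) :=
  Subgroup.closure {g | ∃ α ∈ Φ, g.toLinearMap = Q.refl α}

end InnerForm

/-- `β` is a linear combination of elements of `Ω` with nonnegative real coefficients. -/
def IsNonneg (Ω : Finset (Module.Dual ℂ V)) (β : Module.Dual ℂ V) : Prop :=
  ∃ c : Module.Dual ℂ V → ℝ, (∀ α ∈ Ω, 0 ≤ c α) ∧ β = ∑ α ∈ Ω, (c α : ℂ) • α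

/-- `Ω` is a base (simple system) of the root system `Ψ`. -/
structure IsBase (Ψ Ω : Finset (Module.Dual ℂ V)) : Prop where
  subset : Ω ⊆ Ψ
  linearIndependent : LinearIndependent ℂ (fun α : Ω => (α : Module.Dual ℂ V))
  nonneg_or : ∀ β ∈ Ψ, IsNonneg Ω β ∨ IsNonneg Ω (-β)

open Classical in
/-- The set `Ψ⁺` of positive roots with respect to `Ω`. -/
def posRoots (Ψ Ω : Finset (Module.Dual ℂ V)) : Finset (Module.Dual ℂ V) :=
  Ψ.filter (IsNonneg Ω)

namespace InnerForm

variable [FiniteDimensional ℂ V] (Q : InnerForm V)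

/-- Membership in the root subsystem of `Ψ` generated by `θ`. -/
def InGenerated (Ψ θ : Finset (Module.Dual ℂ V)) (β : Module.Dual ℂ V) : Prop :=
  ∀ Ψ' : Finset (Module.Dual ℂ V), Ψ' ⊆ Ψ → Q.IsRootSystem Ψ' → θ ⊆ Ψ' → β ∈ Ψ'

/-- `v` is `Ω`-standard: the roots in `Ψ` vanishing at `v` form the subsystem of `Ψ` generated by
a subset of `Ω`. -/
def IsStandard (Ψ Ω : Finset (Module.Dual ℂ V)) (v : V) : Prop :=
  ∃ θ ⊆ Ω, ∀ β ∈ Ψ, β v = 0 ↔ Q.InGenerated Ψ θ β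

/-- `l = [α₁, …, α_r]` is a word in the simple roots with `s_{α₁} ⋯ s_{α_r} = σ`. -/
def IsWord (Ω : Finset (Module.Dual ℂ V)) (σ : V ≃ₗ[ℂ] V) (l : List (Module.Dual ℂ V)) : Prop :=
  (∀ α ∈ l, α ∈ Ω) ∧ (l.map (fun α => (Q.refl α : Module.End ℂ V))).prod = σ.toLinearMap

/-- The length `ℓ(σ)` with respect to the simple reflections. -/
def length (Ω : Finset (Module.Dual ℂ V)) (σ : V ≃ₗ[ℂ] V) : ℕ :=
  sInf {r | ∃ l, Q.IsWord Ω σ l ∧ l.length = r}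

/-- A reduced decomposition of `σ`. -/
def reducedWord (Ω : Finset (Module.Dual ℂ V)) (σ : V ≃ₗ[ℂ] V) : List (Module.Dual ℂ V) :=
  Classical.epsilon fun l => Q.IsWord Ω σ l ∧ l.length = Q.length Ω σ

/-- The longest element of a set of group elements. -/
def longest (Ω : Finset (Module.Dual ℂ V)) (X : Set (V ≃ₗ[ℂ] V)) : V ≃ₗ[ℂ] V :=
  Classical.epsilon fun ω => ω ∈ X ∧ ∀ τ ∈ X, Q.length Ω τ ≤ Q.length Ω ω

/-- The set `W^v` of minimal length representatives of the left cosets `σ W_v`, where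
`W = W(Ψ)` and `W_v` is the stabilizer of `v` in `W`. -/
def minReps (Ψ Ω : Finset (Module.Dual ℂ V)) (v : V) : Set (V ≃ₗ[ℂ] V) :=
  {σ | σ ∈ Q.weyl Ψ ∧ ∀ τ ∈ Q.weyl Ψ, τ v = v → Q.length Ω σ ≤ Q.length Ω (σ * τ)}

theorem exists_nabla (α : Module.Dual ℂ V) (f : Poly V) :
    ∃ g : Poly V, lin α * g = f - pull (Q.refl α) f := by
  induction f using SymmetricAlgebra.induction with
  | algebraMap r => exact ⟨0, by simp⟩
  | ι β =>
    refine ⟨algebraMap ℂ _ (2 / Q.dualForm α α * β (Q.vec α)), ?_⟩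
    have h : (Q.refl α).dualMap β = β - (2 / Q.dualForm α α * β (Q.vec α)) • α := by
      ext x
      simp [refl]
      ring
    rw [pull, SymmetricAlgebra.lift_ι_apply, LinearMap.comp_apply, h, map_sub, map_smul,
      Algebra.smul_def]
    ring
  | mul a b ha hb =>
    obtain ⟨g, hg⟩ := ha
    obtain ⟨h, hh⟩ := hb
    refine ⟨g * b + pull (Q.refl α) a * h, ?_⟩
    rw [map_mul]
    linear_combination b * hg + pull (Q.refl α) a * hh
  | add a b ha hb =>
    obtain ⟨g, hg⟩ := ha
    obtain ⟨h, hh⟩ := hb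
    refine ⟨g + h, ?_⟩
    rw [map_add]
    linear_combination hg + hh

/-- `∇_s f = (f - s f) / α` for `s = s_α`, as an operator on `Λ`. -/
def nabla (α : Module.Dual ℂ V) (f : Poly V) : Poly V := Classical.choose (Q.exists_nabla α f)

theorem mul_nabla (α : Module.Dual ℂ V) (f : Poly V) :
    lin α * Q.nabla α f = f - pull (Q.refl α) f := Classical.choose_spec (Q.exists_nabla α f)

/-- The divided difference `∂_σ = ∇_{s₁} ∘ ⋯ ∘ ∇_{s_r}`, for a reduced decomposition
`σ = s₁ ⋯ s_r`. -/
def divDiff (Ω : Finset (Module.Dual ℂ V)) (σ : V ≃ₗ[ℂ] V) (f : Poly V) : Poly V :=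
  (Q.reducedWord Ω σ).foldr Q.nabla f

/-- The Schubert polynomial `𝔖_σ = |W|⁻¹ ∂_{σ⁻¹ ω₀} Δ(Ψ)`, where `Δ(Ψ)` is the product of the
positive roots. -/
def schubert (Ψ Ω : Finset (Module.Dual ℂ V)) (σ : V ≃ₗ[ℂ] V) : Poly V :=
  (Nat.card (Q.weyl Ψ) : ℂ)⁻¹ •
    Q.divDiff Ω (σ⁻¹ * Q.longest Ω (Q.weyl Ψ)) (∏ α ∈ posRoots Ψ Ω, lin α)

/-- The subalgebra `Λ^{W(Φ)}` of invariants. -/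
def invariants (Φ : Finset (Module.Dual ℂ V)) : Subalgebra ℂ (Poly V) where
  carrier := {f | ∀ g ∈ Q.weyl Φ, act g f = f}
  mul_mem' ha hb g hg := by rw [map_mul, ha g hg, hb g hg]
  add_mem' ha hb g hg := by rw [map_add, ha g hg, hb g hg]
  algebraMap_mem' r g _ := AlgHom.commutes _ r

/-- The ideal `I_W` of `Λ` generated by the `W(Ψ)`-invariants without constant term. -/
def coinvIdeal (Ψ : Finset (Module.Dual ℂ V)) : Ideal (Poly V) :=
  Ideal.span {f | f ∈ Q.invariants Ψ ∧ evalAt 0 f = 0}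

/-- The algebra morphism `f ↦ f + ε Θ(α)(f)` from `Λ` to the dual numbers over `Λ`. -/
def thetaDual (α : Module.Dual ℂ V) : Poly V →ₐ[ℂ] TrivSqZeroExt (Poly V) (Poly V) :=
  SymmetricAlgebra.lift
    ((TrivSqZeroExt.inlAlgHom ℂ (Poly V) (Poly V)).toLinearMap ∘ₗ
        SymmetricAlgebra.ι ℂ (Module.Dual ℂ V) +
      (TrivSqZeroExt.inrHom (Poly V) (Poly V)).restrictScalars ℂ ∘ₗ
        Algebra.linearMap ℂ (Poly V) ∘ₗ Module.Dual.eval ℂ V (Q.vec α))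

/-- The derivation `Θ(α)` of `Λ` with `Θ(α)(β) = (β, α)` for `β ∈ V^*`. -/
def theta₁ (α : Module.Dual ℂ V) : Module.End ℂ (Poly V) :=
  (TrivSqZeroExt.sndHom (Poly V) (Poly V)).restrictScalars ℂ ∘ₗ (Q.thetaDual α).toLinearMap

theorem fst_thetaDual (α : Module.Dual ℂ V) (f : Poly V) : (Q.thetaDual α f).fst = f := by
  have h : (TrivSqZeroExt.fstHom ℂ (Poly V) (Poly V)).comp (Q.thetaDual α) =
      AlgHom.id ℂ (Poly V) := by
    apply SymmetricAlgebra.algHom_ext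
    ext β
    simp [thetaDual]
  exact congrArg (fun φ => φ f) h

theorem dualForm_eq (α β : Module.Dual ℂ V) : Q.dualForm β α = β (Q.vec α) := by
  rw [dualForm, Q.symm, form_vec]

theorem theta₁_lin (α β : Module.Dual ℂ V) :
    Q.theta₁ α (lin β) = algebraMap ℂ (Poly V) (Q.dualForm β α) := by
  simp [theta₁, thetaDual, dualForm_eq, Algebra.algebraMap_eq_smul_one]

theorem theta₁_algebraMap (α : Module.Dual ℂ V) (r : ℂ) :
    Q.theta₁ α (algebraMap ℂ (Poly V) r) = 0 := by
  simp [theta₁, TrivSqZeroExt.algebraMap_eq_inl']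

theorem theta₁_mul (α : Module.Dual ℂ V) (f g : Poly V) :
    Q.theta₁ α (f * g) = f * Q.theta₁ α g + Q.theta₁ α f * g := by
  simp [theta₁, fst_thetaDual, mul_comm]

theorem theta₁_comm (α β : Module.Dual ℂ V) :
    Q.theta₁ α * Q.theta₁ β = Q.theta₁ β * Q.theta₁ α := by
  ext f
  rw [Module.End.mul_apply, Module.End.mul_apply]
  induction f using SymmetricAlgebra.induction with
  | algebraMap r => simp only [theta₁_algebraMap, map_zero]
  | ι γ => simp only [theta₁_lin, theta₁_algebraMap]
  | mul a b ha hb =>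
    simp only [theta₁_mul, map_add]
    linear_combination a * hb + b * ha
  | add a b ha hb => simp only [map_add, ha, hb]

theorem theta₁_add (α β : Module.Dual ℂ V) :
    Q.theta₁ (α + β) = Q.theta₁ α + Q.theta₁ β := by
  ext f
  rw [LinearMap.add_apply]
  induction f using SymmetricAlgebra.induction with
  | algebraMap r => simp only [theta₁_algebraMap, add_zero]
  | ι γ => simp [theta₁_lin, dualForm_eq, vec]
  | mul a b ha hb =>
    simp only [theta₁_mul]
    linear_combination a * hb + b * ha
  | add a b ha hb =>
    simp only [map_add]
    linear_combination ha + hb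

theorem theta₁_smul (c : ℂ) (α : Module.Dual ℂ V) : Q.theta₁ (c • α) = c • Q.theta₁ α := by
  ext f
  rw [LinearMap.smul_apply]
  induction f using SymmetricAlgebra.induction with
  | algebraMap r => simp only [theta₁_algebraMap, smul_zero]
  | ι γ => simp [theta₁_lin, dualForm_eq, vec, Algebra.smul_def]
  | mul a b ha hb =>
    simp only [theta₁_mul, Algebra.smul_def] at *
    linear_combination a * hb + b * ha
  | add a b ha hb =>
    simp only [map_add, Algebra.smul_def] at *
    linear_combination ha + hb

/-- The (commutative) algebra of constant coefficient differential operators on `Λ`, generated by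
the derivations `Θ(α)`. -/
def diffOps : Subalgebra ℂ (Module.End ℂ (Poly V)) :=
  Algebra.adjoin ℂ (Set.range Q.theta₁)

theorem diffOps_mul_comm (x y : Q.diffOps) : x * y = y * x := by
  have h : IsMulCommutative Q.diffOps :=
    Algebra.isMulCommutative_adjoin ℂ (by
      rintro _ ⟨α, rfl⟩ _ ⟨β, rfl⟩
      exact Q.theta₁_comm α β)
  exact h.is_comm.comm x y

instance : CommRing Q.diffOps where
  __ := Q.diffOps.toRing
  mul_comm := Q.diffOps_mul_comm

/-- The map `α ↦ Θ(α)` as a linear map. -/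
def thetaLin : Module.Dual ℂ V →ₗ[ℂ] Q.diffOps where
  toFun α := ⟨Q.theta₁ α, Algebra.subset_adjoin ⟨α, rfl⟩⟩
  map_add' α β := Subtype.ext (Q.theta₁_add α β)
  map_smul' c α := Subtype.ext (Q.theta₁_smul c α)

/-- The algebra morphism `Θ` from `Λ` to the differential operators on `Λ` that extends
`α ↦ Θ(α)`. -/
def theta : Poly V →ₐ[ℂ] Module.End ℂ (Poly V) :=
  Q.diffOps.val.comp (SymmetricAlgebra.lift Q.thetaLin)

theorem theta_lin (α : Module.Dual ℂ V) : Q.theta (lin α) = Q.theta₁ α := by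
  simp [theta, thetaLin]

/-- The bilinear form `(f, g)_Θ = Θ(f)(g)(0)` on `Λ`. -/
def pairing (f g : Poly V) : ℂ := evalAt 0 (Q.theta f g)

/-- The polynomial `P_σ`: the element orthogonal to `I_W` which pairs with the Schubert
polynomials as `(P_σ, 𝔖_τ)_Θ = δ_{σ,τ}` for `σ, τ ∈ W(Ψ)`. -/
def dualSchubert (Ψ Ω : Finset (Module.Dual ℂ V)) (σ : V ≃ₗ[ℂ] V) : Poly V :=
  open Classical in
  Classical.epsilon fun P =>
    (∀ f ∈ Q.coinvIdeal Ψ, Q.pairing f P = 0) ∧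
      ∀ τ ∈ Q.weyl Ψ, Q.pairing P (Q.schubert Ψ Ω τ) = if σ = τ then 1 else 0

/-- Evaluation at `v` as a functional on `Γ = Λ^{W(Φ)}`. -/
def ev (Φ : Finset (Module.Dual ℂ V)) (v : V) : Module.Dual ℂ (Q.invariants Φ) :=
  (evalAt v).toLinearMap ∘ₗ (Q.invariants Φ).val.toLinearMap

/-- The functional `𝒟_σ^v` on `Γ = Λ^{W(Φ)}`: apply the differential operator `Θ(P_σ)`, then
evaluate at `v`. -/
def bgg (Φ Ψ Ω : Finset (Module.Dual ℂ V)) (v : V) (σ : V ≃ₗ[ℂ] V) :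
    Module.Dual ℂ (Q.invariants Φ) :=
  (evalAt v).toLinearMap ∘ₗ Q.theta (Q.dualSchubert Ψ Ω σ) ∘ₗ (Q.invariants Φ).val.toLinearMap

/-- The space `𝒟(Ω, v) ⊂ Γ^*` spanned by all `𝒟_σ^v`, `σ ∈ W = W(Ψ)`. -/
def bggSpace (Φ Ψ Ω : Finset (Module.Dual ℂ V)) (v : V) :
    Submodule ℂ (Module.Dual ℂ (Q.invariants Φ)) :=
  Submodule.span ℂ (Q.bgg Φ Ψ Ω v '' (Q.weyl Ψ : Set (V ≃ₗ[ℂ] V)))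

/-- The action of `Γ` on `Γ^*`: `(γ · χ)(f) = χ (γ f)`. -/
def dualAct {Φ : Finset (Module.Dual ℂ V)} (γ : Q.invariants Φ)
    (χ : Module.Dual ℂ (Q.invariants Φ)) : Module.Dual ℂ (Q.invariants Φ) :=
  χ ∘ₗ LinearMap.mulLeft ℂ γ

end InnerForm

end BGG

end

noncomputable section

set_option linter.unusedSectionVars false

/-! ### Reflections, the orthogonal group and words in reflections. -/

namespace BGG

variable {V : Type*} [AddCommGroup V] [Module ℂ V]

/-! The proof rests on the coefficient functionals `coef`: f ↦ (∂_σ f)(0). They kill I_W, they are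
dual to the Schubert polynomials, and a polynomial killed by all of them lies in I_W. So they form a
basis of the dual of Λ/I_W, and pairing with P_σ is the functional `coef` at σ
(`pairing_dualSchubert`). As Θ commutes with translations, 𝒟_σ^v(γ) = (∂_σ T_v γ)(0) with (T_v γ)(x)
= γ(x + v) (`bgg_apply`). Hence 𝒟(Ω, v) consists of the functionals γ ↦ L(T_v γ) with L vanishing on
I_W. It is a Γ-submodule, and invariants vanishing to high order at v annihilate it.

For (a): T_v γ is W_v-invariant, and if σ is not a minimal representative then ∂_σ ends in some ∇_δ
that kills W_v-invariants. If σ ∈ W^v, then 𝔖_σ is itself W_v-invariant, and under (*) every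
reflection in a root of Φ vanishing at v fixes it. By Steinberg's theorem these reflections generate
the stabilizer of v in G, so interpolating on the orbit and averaging over G gives an invariant
whose jet at v is 𝔖_σ (`exists_schubert_lift`). These invariants are dual to the 𝒟_σ^v.

For (b): the form (f, g) ↦ ∂_{ω₀}(fg)(0) is nondegenerate on Λ/I_W, because each ∇_δ is self-adjoint
for it. Writing ω₀ as ω₀^v times the longest element of W_v turns this into a duality for
W_v-invariants, whence 𝒟(Ω, v) = Γ · 𝒟_{ω₀^v} (`exists_eq_dualAct_longest`). An element x = u ·
𝒟_{ω₀^v} has leading coefficient u(v), and u acts invertibly exactly when u(v) ≠ 0, since u - u(v)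
is nilpotent on 𝒟(Ω, v).

Part (c) follows by evaluating functionals at 1. For (d), invariants separate G-orbits, so powers of
coprime invariants annihilate the two spaces; on one G-orbit the evaluation is a common element, and
T_{wv} γ = w(T_v γ) for w ∈ W.

Steinberg's theorem is needed for Φ, which comes without a base and with complex inner products.
Rescaling the roots to length one makes the inner products real, because some power of a product of
two reflections fixes a given root; a positive system then exists (`exists_rescaled`). -/

/-- The contragredient action `g · β = β ∘ g⁻¹` of `GL(V)` on `V^*`. -/
def cact : (V ≃ₗ[ℂ] V) →* (Module.Dual ℂ V ≃ₗ[ℂ] Module.Dual ℂ V) where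
  toFun g := g.symm.dualMap
  map_one' := by ext; rfl
  map_mul' g h := by ext; rfl

theorem cact_apply (g : V ≃ₗ[ℂ] V) (β : Module.Dual ℂ V) (x : V) : cact g β x = β (g⁻¹ x) := rfl

theorem cact_apply_apply (g : V ≃ₗ[ℂ] V) (β : Module.Dual ℂ V) (x : V) :
    cact g β (g x) = β x := by
  rw [cact_apply, ← LinearEquiv.mul_apply, inv_mul_cancel]
  rfl

theorem cact_mul (g h : V ≃ₗ[ℂ] V) (β : Module.Dual ℂ V) : cact (g * h) β = cact g (cact h β) := by
  rw [map_mul, LinearEquiv.mul_apply]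

theorem cact_one (β : Module.Dual ℂ V) : cact (1 : V ≃ₗ[ℂ] V) β = β := by
  rw [map_one]
  rfl

theorem cact_inv_cact (g : V ≃ₗ[ℂ] V) (β : Module.Dual ℂ V) : cact g⁻¹ (cact g β) = β := by
  rw [← cact_mul, inv_mul_cancel, cact_one]

theorem cact_cact_inv (g : V ≃ₗ[ℂ] V) (β : Module.Dual ℂ V) : cact g (cact g⁻¹ β) = β := by
  rw [← cact_mul, mul_inv_cancel, cact_one]

theorem exists_dual_ne {v w : V} (h : v ≠ w) : ∃ β : Module.Dual ℂ V, β v ≠ β w := by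
  by_contra! H
  exact h (sub_eq_zero.1 ((Module.forall_dual_apply_eq_zero_iff ℂ (v - w)).1 fun β => by
    rw [map_sub, H, sub_self]))

namespace InnerForm

variable [FiniteDimensional ℂ V] (Q : InnerForm V)

theorem dualForm_comm (α β : Module.Dual ℂ V) : Q.dualForm α β = Q.dualForm β α := Q.symm _ _

theorem dualForm_smul_left (c : ℂ) (α γ : Module.Dual ℂ V) :
    Q.dualForm (c • α) γ = c * Q.dualForm α γ := by simp [dualForm_eq]

theorem dualForm_neg_left (α γ : Module.Dual ℂ V) :
    Q.dualForm (-α) γ = -Q.dualForm α γ := by simp [dualForm_eq]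

theorem vec_smul (c : ℂ) (α : Module.Dual ℂ V) : Q.vec (c • α) = c • Q.vec α := by simp [vec]

/-- The pairing `⟨β, α^∨⟩ = 2 (β, α) / (α, α)`. -/
def copair (α β : Module.Dual ℂ V) : ℂ := 2 / Q.dualForm α α * Q.dualForm β α

theorem refl_apply (α : Module.Dual ℂ V) (x : V) :
    Q.refl α x = x - (2 / Q.dualForm α α * α x) • Q.vec α := by
  simp [refl, mul_smul]

theorem refl_involutive (α : Module.Dual ℂ V) : Function.Involutive (Q.refl α) := by
  intro x
  by_cases h : Q.dualForm α α = 0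
  · simp [refl_apply, h]
  · have h' : α (Q.vec α) ≠ 0 := by rwa [← dualForm_eq]
    rw [refl_apply, refl_apply, map_sub, map_smul, sub_sub, ← add_smul, sub_eq_self]
    rw [dualForm_eq, smul_eq_mul]
    convert zero_smul ℂ _
    field_simp
    ring

/-- The reflection `s_α` as an element of `GL(V)`. -/
def s (α : Module.Dual ℂ V) : V ≃ₗ[ℂ] V := LinearEquiv.ofInvolutive (Q.refl α) (Q.refl_involutive α)

theorem s_apply (α : Module.Dual ℂ V) (x : V) :
    Q.s α x = x - (2 / Q.dualForm α α * α x) • Q.vec α := Q.refl_apply α x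

theorem s_inv (α : Module.Dual ℂ V) : (Q.s α)⁻¹ = Q.s α := rfl

theorem s_mul_self (α : Module.Dual ℂ V) : Q.s α * Q.s α = 1 := by
  nth_rw 1 [← Q.s_inv α]
  exact inv_mul_cancel _

theorem mul_s_mul_s (g : V ≃ₗ[ℂ] V) (α : Module.Dual ℂ V) : g * Q.s α * Q.s α = g := by
  rw [mul_assoc, s_mul_self, mul_one]

theorem s_mul_s_mul (g : V ≃ₗ[ℂ] V) (α : Module.Dual ℂ V) : Q.s α * (Q.s α * g) = g := by
  rw [← mul_assoc, s_mul_self, one_mul]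

theorem s_smul {c : ℂ} (hc : c ≠ 0) (α : Module.Dual ℂ V) : Q.s (c • α) = Q.s α := by
  ext x
  rw [s_apply, s_apply, vec_smul, smul_smul, dualForm_smul_left, dualForm_comm,
    dualForm_smul_left]
  congr 2
  simp only [LinearMap.smul_apply, smul_eq_mul]
  by_cases h : Q.dualForm α α = 0
  · simp [h]
  · field_simp

theorem s_neg (α : Module.Dual ℂ V) : Q.s (-α) = Q.s α := by
  rw [← neg_one_smul ℂ α, s_smul _ (by norm_num)]

theorem s_apply_eq_self {α : Module.Dual ℂ V} {v : V} (h : α v = 0) : Q.s α v = v := by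
  simp [s_apply, h]

theorem cact_s (α β : Module.Dual ℂ V) : cact (Q.s α) β = β - Q.copair α β • α := by
  ext x
  rw [cact_apply, s_inv, s_apply, map_sub, map_smul, copair, dualForm_eq, dualForm_eq]
  simp
  ring

theorem cact_s_eq_dualMap (α β : Module.Dual ℂ V) : cact (Q.s α) β = (Q.refl α).dualMap β := rfl

theorem cact_s_self {α : Module.Dual ℂ V} (h : Q.dualForm α α ≠ 0) : cact (Q.s α) α = -α := by
  rw [cact_s, copair, div_mul_cancel₀ _ h]
  module

theorem cact_s_cact_s (α β : Module.Dual ℂ V) : cact (Q.s α) (cact (Q.s α) β) = β := by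
  rw [← cact_mul, s_mul_self, cact_one]

/-- The orthogonal group of `Q`. -/
def orth : Subgroup (V ≃ₗ[ℂ] V) where
  carrier := {g | ∀ x y, Q.form (g x) (g y) = Q.form x y}
  mul_mem' {a b} ha hb x y := by rw [LinearEquiv.mul_apply, LinearEquiv.mul_apply, ha, hb]
  one_mem' _ _ := rfl
  inv_mem' {a} ha x y := by
    have h (z : V) : a (a⁻¹ z) = z := by rw [← LinearEquiv.mul_apply, mul_inv_cancel]; rfl
    rw [← ha, h, h]

theorem s_mem_orth (α : Module.Dual ℂ V) : Q.s α ∈ Q.orth := by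
  intro x y
  by_cases h : Q.dualForm α α = 0
  · simp [s_apply, h]
  · have h1 : Q.form (Q.vec α) y = α y := by rw [Q.symm, form_vec]
    have h2 : Q.form (Q.vec α) (Q.vec α) = Q.dualForm α α := rfl
    simp only [s_apply, map_sub, map_smul, LinearMap.sub_apply, LinearMap.smul_apply, form_vec,
      smul_eq_mul, h1, h2]
    field_simp
    ring

theorem vec_cact {g : V ≃ₗ[ℂ] V} (hg : g ∈ Q.orth) (α : Module.Dual ℂ V) :
    Q.vec (cact g α) = g (Q.vec α) := by
  apply (Q.form.toDual Q.nondeg).injective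
  ext x
  have h (z : V) : g (g⁻¹ z) = z := by rw [← LinearEquiv.mul_apply, mul_inv_cancel]; rfl
  rw [LinearMap.BilinForm.toDual_def, LinearMap.BilinForm.toDual_def, Q.symm, form_vec,
    cact_apply, ← Q.form_vec, Q.symm, ← hg, h]

theorem dualForm_cact {g : V ≃ₗ[ℂ] V} (hg : g ∈ Q.orth) (α β : Module.Dual ℂ V) :
    Q.dualForm (cact g α) (cact g β) = Q.dualForm α β := by
  rw [dualForm, vec_cact _ hg, vec_cact _ hg, hg, dualForm]

theorem copair_cact {g : V ≃ₗ[ℂ] V} (hg : g ∈ Q.orth) (α β : Module.Dual ℂ V) :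
    Q.copair (cact g α) (cact g β) = Q.copair α β := by
  simp [copair, dualForm_cact _ hg]

theorem s_cact {g : V ≃ₗ[ℂ] V} (hg : g ∈ Q.orth) (α : Module.Dual ℂ V) :
    Q.s (cact g α) = g * Q.s α * g⁻¹ := by
  ext x
  rw [s_apply, LinearEquiv.mul_apply, LinearEquiv.mul_apply, s_apply, vec_cact _ hg,
    dualForm_cact _ hg, cact_apply, map_sub, map_smul, ← LinearEquiv.mul_apply g, mul_inv_cancel]
  rfl

theorem s_cact_mul {g : V ≃ₗ[ℂ] V} (hg : g ∈ Q.orth) (α : Module.Dual ℂ V) :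
    Q.s (cact g α) * g = g * Q.s α := by
  rw [s_cact _ hg, inv_mul_cancel_right]

theorem weyl_eq_closure (R : Finset (Module.Dual ℂ V)) :
    Q.weyl R = Subgroup.closure (Q.s '' R) := by
  rw [weyl]
  congr 1
  ext g
  constructor
  · rintro ⟨α, hα, h⟩
    exact ⟨α, hα, LinearEquiv.toLinearMap_injective h.symm⟩
  · rintro ⟨α, hα, rfl⟩
    exact ⟨α, hα, rfl⟩

theorem s_mem_weyl {R : Finset (Module.Dual ℂ V)} {α : Module.Dual ℂ V} (h : α ∈ R) :
    Q.s α ∈ Q.weyl R := by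
  rw [weyl_eq_closure]
  exact Subgroup.subset_closure ⟨α, h, rfl⟩

theorem weyl_le {R : Finset (Module.Dual ℂ V)} {H : Subgroup (V ≃ₗ[ℂ] V)}
    (h : ∀ α ∈ R, Q.s α ∈ H) : Q.weyl R ≤ H := by
  rw [weyl_eq_closure, Subgroup.closure_le]
  rintro _ ⟨α, hα, rfl⟩
  exact h α hα

theorem weyl_mono {R R' : Finset (Module.Dual ℂ V)} (h : R ⊆ R') : Q.weyl R ≤ Q.weyl R' :=
  Q.weyl_le fun _ hα => Q.s_mem_weyl (h hα)

theorem weyl_le_orth (R : Finset (Module.Dual ℂ V)) : Q.weyl R ≤ Q.orth :=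
  Q.weyl_le fun α _ => Q.s_mem_orth α

variable {Q}

theorem IsRootSystem.cact_mem {R : Finset (Module.Dual ℂ V)} (hR : Q.IsRootSystem R)
    {g : V ≃ₗ[ℂ] V} (hg : g ∈ Q.weyl R) {β : Module.Dual ℂ V} (hβ : β ∈ R) : cact g β ∈ R := by
  rw [weyl_eq_closure] at hg
  revert β
  induction hg using Subgroup.closure_induction'' with
  | mem x hx =>
    intro β hβ
    obtain ⟨α, hα, rfl⟩ := hx
    exact hR.refl_mem α hα β hβ
  | inv_mem x hx =>
    intro β hβ
    obtain ⟨α, hα, rfl⟩ := hx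
    exact hR.refl_mem α hα β hβ
  | one => intro β hβ; rwa [cact_one]
  | mul x y _ _ ihx ihy => intro β hβ; rw [cact_mul]; exact ihx (ihy hβ)

theorem IsRootSystem.neg_mem {R : Finset (Module.Dual ℂ V)} (hR : Q.IsRootSystem R)
    {β : Module.Dual ℂ V} (hβ : β ∈ R) : -β ∈ R := by
  rw [← Q.cact_s_self (hR.nonisotropic β hβ)]
  exact hR.cact_mem (Q.s_mem_weyl hβ) hβ

theorem IsRootSystem.ne_zero {R : Finset (Module.Dual ℂ V)} (hR : Q.IsRootSystem R)
    {β : Module.Dual ℂ V} (hβ : β ∈ R) : β ≠ 0 := by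
  rintro rfl
  exact hR.nonisotropic 0 hβ (by simp [dualForm_eq])

theorem IsRootSystem.eq_or_eq_neg {R : Finset (Module.Dual ℂ V)} (hR : Q.IsRootSystem R)
    {α : Module.Dual ℂ V} (hα : α ∈ R) {c : ℂ} (hβ : c • α ∈ R) : c • α = α ∨ c • α = -α := by
  have := hR.inter_line α hα
  have h : c • α ∈ ({α, -α} : Set (Module.Dual ℂ V)) := by
    rw [← this]; exact ⟨hβ, c, rfl⟩
  simpa using h

variable (Q)

/-- The product `s_{α₁} ⋯ s_{α_r}` of reflections. -/
def wprod (l : List (Module.Dual ℂ V)) : V ≃ₗ[ℂ] V := (l.map Q.s).prod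

@[simp] theorem wprod_nil : Q.wprod [] = 1 := rfl

@[simp] theorem wprod_cons (α : Module.Dual ℂ V) (l : List (Module.Dual ℂ V)) :
    Q.wprod (α :: l) = Q.s α * Q.wprod l := by simp [wprod]

@[simp] theorem wprod_append (l l' : List (Module.Dual ℂ V)) :
    Q.wprod (l ++ l') = Q.wprod l * Q.wprod l' := by simp [wprod]

theorem wprod_reverse (l : List (Module.Dual ℂ V)) : Q.wprod l.reverse = (Q.wprod l)⁻¹ := by
  induction l with
  | nil => simp
  | cons α l ih => simp [ih, s_inv]

theorem wprod_mem {R : Finset (Module.Dual ℂ V)} {l : List (Module.Dual ℂ V)}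
    (h : ∀ α ∈ l, α ∈ R) : Q.wprod l ∈ Q.weyl R := by
  induction l with
  | nil => exact one_mem _
  | cons α l ih =>
    rw [wprod_cons]
    exact mul_mem (Q.s_mem_weyl (h α (by simp))) (ih fun β hβ => h β (by simp [hβ]))

theorem exists_wprod {R : Finset (Module.Dual ℂ V)} {g : V ≃ₗ[ℂ] V} (hg : g ∈ Q.weyl R) :
    ∃ l, (∀ α ∈ l, α ∈ R) ∧ Q.wprod l = g := by
  rw [weyl_eq_closure] at hg
  induction hg using Subgroup.closure_induction with
  | mem x hx =>
    obtain ⟨α, hα, rfl⟩ := hx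
    exact ⟨[α], by simpa using hα, by simp⟩
  | one => exact ⟨[], by simp, rfl⟩
  | mul x y _ _ ihx ihy =>
    obtain ⟨l, hl, rfl⟩ := ihx
    obtain ⟨l', hl', rfl⟩ := ihy
    refine ⟨l ++ l', fun α hα => ?_, by simp⟩
    rcases List.mem_append.1 hα with h | h
    exacts [hl α h, hl' α h]
  | inv x _ ih =>
    obtain ⟨l, hl, rfl⟩ := ih
    exact ⟨l.reverse, by simpa using hl, Q.wprod_reverse l⟩

theorem isWord_iff {Ω : Finset (Module.Dual ℂ V)} {σ : V ≃ₗ[ℂ] V} {l : List (Module.Dual ℂ V)} :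
    Q.IsWord Ω σ l ↔ (∀ α ∈ l, α ∈ Ω) ∧ Q.wprod l = σ := by
  rw [IsWord]
  have h : (l.map (fun α => (Q.refl α : Module.End ℂ V))).prod = (Q.wprod l).toLinearMap := by
    induction l with
    | nil => rfl
    | cons α l ih => rw [List.map_cons, List.prod_cons, ih, wprod_cons]; rfl
  rw [h]
  exact and_congr_right fun _ => LinearEquiv.toLinearMap_injective.eq_iff

end InnerForm

/-! ### Positive systems, inversions and the length function. -/

theorem IsNonneg.map_nonneg {Ω : Finset (Module.Dual ℂ V)} {β : Module.Dual ℂ V}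
    (h : IsNonneg Ω β) {k : Module.Dual ℂ V →ₗ[ℝ] ℝ} (hk : ∀ δ ∈ Ω, 0 ≤ k δ) : 0 ≤ k β := by
  obtain ⟨c, hc, rfl⟩ := h
  rw [map_sum]
  refine Finset.sum_nonneg fun δ hδ => ?_
  rw [Complex.coe_smul, map_smul]
  exact mul_nonneg (hc δ hδ) (hk δ hδ)

theorem IsNonneg.exists_neg {Ω : Finset (Module.Dual ℂ V)} {β : Module.Dual ℂ V}
    (h : IsNonneg Ω β) {k : Module.Dual ℂ V →ₗ[ℝ] ℝ} (hk : k β < 0) : ∃ δ ∈ Ω, k δ < 0 := by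
  by_contra! H
  exact absurd (h.map_nonneg H) (not_le.2 hk)

/-- The pullback of a real functional on `V^*` along the action of `g`. -/
def shift (k : Module.Dual ℂ V →ₗ[ℝ] ℝ) (g : V ≃ₗ[ℂ] V) : Module.Dual ℂ V →ₗ[ℝ] ℝ :=
  k ∘ₗ (cact g).toLinearMap.restrictScalars ℝ

theorem shift_apply (k : Module.Dual ℂ V →ₗ[ℝ] ℝ) (g : V ≃ₗ[ℂ] V) (β : Module.Dual ℂ V) :
    shift k g β = k (cact g β) := rfl

namespace InnerForm

variable [FiniteDimensional ℂ V] (Q : InnerForm V)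

/-- A positive system `{β ∈ R | h β > 0}` of a root system `R`, together with a set `Δ` of simple
roots, whose nonnegative combinations contain all positive roots. -/
structure PosSys (R Δ : Finset (Module.Dual ℂ V)) (h : Module.Dual ℂ V →ₗ[ℝ] ℝ) : Prop where
  root : Q.IsRootSystem R
  ne : ∀ β ∈ R, h β ≠ 0
  sub : Δ ⊆ R
  pos : ∀ δ ∈ Δ, 0 < h δ
  cone : ∀ β ∈ R, 0 < h β → IsNonneg Δ β
  -- Together with `cone` this is all that the length theory needs of simple roots; linear
  -- independence of Δ is not required.
  simple : ∀ δ ∈ Δ, ∀ β ∈ R, 0 < h β → β ≠ δ → 0 < h (cact (Q.s δ) β)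

variable {Q} {R Δ : Finset (Module.Dual ℂ V)} {h : Module.Dual ℂ V →ₗ[ℝ] ℝ}

open Classical in
/-- The positive roots on which `k` is negative. -/
def negSet (R : Finset (Module.Dual ℂ V)) (h k : Module.Dual ℂ V →ₗ[ℝ] ℝ) :
    Finset (Module.Dual ℂ V) := R.filter fun β => 0 < h β ∧ k β < 0

theorem mem_negSet {k : Module.Dual ℂ V →ₗ[ℝ] ℝ} {β : Module.Dual ℂ V} :
    β ∈ negSet R h k ↔ β ∈ R ∧ 0 < h β ∧ k β < 0 := by simp [negSet]

/-- The set of inversions of `g`. -/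
def inv (R : Finset (Module.Dual ℂ V)) (h : Module.Dual ℂ V →ₗ[ℝ] ℝ) (g : V ≃ₗ[ℂ] V) :
    Finset (Module.Dual ℂ V) := negSet R h (shift h g)

theorem mem_inv {g : V ≃ₗ[ℂ] V} {β : Module.Dual ℂ V} :
    β ∈ inv R h g ↔ β ∈ R ∧ 0 < h β ∧ h (cact g β) < 0 := mem_negSet

/-- The number of inversions of `g`. -/
def len (R : Finset (Module.Dual ℂ V)) (h : Module.Dual ℂ V →ₗ[ℝ] ℝ) (g : V ≃ₗ[ℂ] V) : ℕ :=
  (inv R h g).card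

theorem shift_mul (k : Module.Dual ℂ V →ₗ[ℝ] ℝ) (g g' : V ≃ₗ[ℂ] V) :
    shift k (g * g') = shift (shift k g) g' := by
  ext β; simp [shift_apply]

namespace PosSys

theorem weyl_le (P : Q.PosSys R Δ h) : Q.weyl Δ ≤ Q.weyl R := Q.weyl_mono P.sub

theorem s_self (P : Q.PosSys R Δ h) {β : Module.Dual ℂ V} (hβ : β ∈ R) :
    cact (Q.s β) β = -β := Q.cact_s_self (P.root.nonisotropic β hβ)

theorem lt_or_gt (P : Q.PosSys R Δ h) {g : V ≃ₗ[ℂ] V} (hg : g ∈ Q.weyl R)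
    {β : Module.Dual ℂ V} (hβ : β ∈ R) : h (cact g β) < 0 ∨ 0 < h (cact g β) :=
  (P.ne _ (P.root.cact_mem hg hβ)).lt_or_gt

/-- s_δ permutes the positive roots other than δ, so only δ itself leaves the set. An arbitrary
functional k is allowed because this serves both the length function and the search for a dominant
point in Steinberg's theorem. -/
theorem card_negSet_shift (P : Q.PosSys R Δ h) {k : Module.Dual ℂ V →ₗ[ℝ] ℝ}
    {δ : Module.Dual ℂ V} (hδ : δ ∈ Δ) (hk : k δ < 0) :
    (negSet R h (shift k (Q.s δ))).card + 1 = (negSet R h k).card := by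
  classical
  have hmem : δ ∈ negSet R h k := mem_negSet.2 ⟨P.sub hδ, P.pos δ hδ, hk⟩
  rw [← Finset.card_erase_add_one hmem]
  congr 1
  have key : ∀ β ∈ R, 0 < h β → β ≠ δ →
      cact (Q.s δ) β ∈ R ∧ 0 < h (cact (Q.s δ) β) ∧ cact (Q.s δ) β ≠ δ := by
    intro β hβ hpos hne
    refine ⟨P.root.cact_mem (Q.s_mem_weyl (P.sub hδ)) hβ, P.simple δ hδ β hβ hpos hne, ?_⟩
    intro H
    have := congrArg (cact (Q.s δ)) H
    rw [cact_s_cact_s, P.s_self (P.sub hδ)] at this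
    rw [this, map_neg] at hpos
    linarith [P.pos δ hδ]
  refine Finset.card_bij' (fun β _ => cact (Q.s δ) β) (fun β _ => cact (Q.s δ) β) ?_ ?_ ?_ ?_
  · intro β hβ
    obtain ⟨h1, h2, h3⟩ := mem_negSet.1 hβ
    have hne : β ≠ δ := by
      rintro rfl
      rw [shift_apply, P.s_self h1, map_neg] at h3
      linarith
    obtain ⟨a, b, c⟩ := key β h1 h2 hne
    exact Finset.mem_erase.2 ⟨c, mem_negSet.2 ⟨a, b, h3⟩⟩
  · intro β hβ
    obtain ⟨hne, hβ⟩ := Finset.mem_erase.1 hβ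
    obtain ⟨h1, h2, h3⟩ := mem_negSet.1 hβ
    obtain ⟨a, b, c⟩ := key β h1 h2 hne
    refine mem_negSet.2 ⟨a, b, ?_⟩
    rwa [shift_apply, cact_s_cact_s]
  · intro β _; exact Q.cact_s_cact_s _ _
  · intro β _; exact Q.cact_s_cact_s _ _

theorem len_mul_s_of_neg (P : Q.PosSys R Δ h) {g : V ≃ₗ[ℂ] V} {δ : Module.Dual ℂ V} (hδ : δ ∈ Δ)
    (hg : h (cact g δ) < 0) : len R h (g * Q.s δ) + 1 = len R h g := by
  rw [len, len, inv, inv, shift_mul]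
  exact P.card_negSet_shift hδ hg

theorem len_mul_s_of_pos (P : Q.PosSys R Δ h) {g : V ≃ₗ[ℂ] V} {δ : Module.Dual ℂ V} (hδ : δ ∈ Δ)
    (hg : 0 < h (cact g δ)) : len R h (g * Q.s δ) = len R h g + 1 := by
  have := P.len_mul_s_of_neg (g := g * Q.s δ) hδ (by
    rw [cact_mul, P.s_self (P.sub hδ), map_neg, map_neg]; linarith)
  rw [← this, mul_s_mul_s]

theorem exists_neg (P : Q.PosSys R Δ h) {g : V ≃ₗ[ℂ] V} (hg : len R h g ≠ 0) :
    ∃ δ ∈ Δ, h (cact g δ) < 0 := by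
  obtain ⟨β, hβ⟩ := Finset.card_ne_zero.1 hg
  obtain ⟨h1, h2, h3⟩ := mem_inv.1 hβ
  exact (P.cone β h1 h2).exists_neg (k := shift h g) h3

theorem len_one (_ : Q.PosSys R Δ h) : len R h 1 = 0 := by
  rw [len, Finset.card_eq_zero, Finset.eq_empty_iff_forall_notMem]
  intro β hβ
  obtain ⟨_, h2, h3⟩ := mem_inv.1 hβ
  rw [cact_one] at h3
  linarith

/-- The sign changes along a word in the simple roots: if `w β` is negative for a positive root
`β`, then `w s_β` is given by a shorter word. -/
theorem exchange (P : Q.PosSys R Δ h) {l : List (Module.Dual ℂ V)} (hl : ∀ α ∈ l, α ∈ Δ)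
    {β : Module.Dual ℂ V} (hβ : β ∈ R) (hpos : 0 < h β) (hneg : h (cact (Q.wprod l) β) < 0) :
    ∃ l', (∀ α ∈ l', α ∈ Δ) ∧ l'.length + 1 = l.length ∧ Q.wprod l' = Q.wprod l * Q.s β := by
  induction l with
  | nil =>
    rw [wprod_nil, cact_one] at hneg
    linarith
  | cons a l ih =>
    have hl' : ∀ α ∈ l, α ∈ Δ := fun α hα => hl α (by simp [hα])
    have ha : a ∈ Δ := hl a (by simp)
    have hw : Q.wprod l ∈ Q.weyl R := P.weyl_le (Q.wprod_mem hl')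
    rcases P.lt_or_gt hw hβ with hlt | hgt
    · obtain ⟨l', h1, h2, h3⟩ := ih hl' hlt
      refine ⟨a :: l', ?_, by simp [h2], ?_⟩
      · intro α hα
        rcases List.mem_cons.1 hα with rfl | hα
        exacts [ha, h1 α hα]
      · rw [wprod_cons, wprod_cons, h3, mul_assoc]
    · refine ⟨l, hl', rfl, ?_⟩
      have : cact (Q.wprod l) β = a := by
        by_contra hne
        have := P.simple a ha _ (P.root.cact_mem hw hβ) hgt hne
        rw [wprod_cons, cact_mul] at hneg
        linarith
      rw [wprod_cons, mul_assoc, ← Q.s_cact_mul (Q.weyl_le_orth R hw), this, s_mul_s_mul]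

/-- Every root made negative by a word in the simple roots is conjugate to a simple root. -/
theorem exists_conj (P : Q.PosSys R Δ h) {l : List (Module.Dual ℂ V)} (hl : ∀ α ∈ l, α ∈ Δ)
    {β : Module.Dual ℂ V} (hβ : β ∈ R) (hpos : 0 < h β) (hneg : h (cact (Q.wprod l) β) < 0) :
    Q.s β ∈ Q.weyl Δ := by
  obtain ⟨l', h1, -, h3⟩ := P.exchange hl hβ hpos hneg
  rw [← inv_mul_eq_iff_eq_mul] at h3
  rw [← h3]
  exact mul_mem (inv_mem (Q.wprod_mem hl)) (Q.wprod_mem h1)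

/-- Take w with the most inversions. If w kept a positive root positive, it would keep some simple δ
positive, and w s_δ would have one more inversion. -/
theorem exists_longest_simple (P : Q.PosSys R Δ h) :
    ∃ w ∈ Q.weyl Δ, ∀ β ∈ R, 0 < h β → h (cact w β) < 0 := by
  classical
  have hbdd : ∀ n, (∃ w ∈ Q.weyl Δ, len R h w = n) → n ≤ R.card := by
    rintro _ ⟨w, _, rfl⟩
    exact Finset.card_le_card (Finset.filter_subset _ _)
  have h0 : ∃ w ∈ Q.weyl Δ, len R h w = 0 := ⟨1, one_mem _, P.len_one⟩
  obtain ⟨w, hw, hwn⟩ := Nat.findGreatest_spec (P := fun n => ∃ w ∈ Q.weyl Δ, len R h w = n)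
    (Nat.zero_le R.card) h0
  refine ⟨w, hw, fun β hβ hpos => ?_⟩
  rcases P.lt_or_gt (P.weyl_le hw) hβ with hlt | hgt
  · exact hlt
  · exfalso
    have hk : shift (-h) w β < 0 := by
      rw [shift_apply, LinearMap.neg_apply]; linarith
    obtain ⟨δ, hδ, hneg⟩ := (P.cone β hβ hpos).exists_neg hk
    have h1 := P.len_mul_s_of_pos (g := w) hδ (by
      rw [shift_apply, LinearMap.neg_apply] at hneg; linarith)
    have h2 : ∃ u ∈ Q.weyl Δ, len R h u = len R h (w * Q.s δ) :=
      ⟨w * Q.s δ, mul_mem hw (Q.s_mem_weyl hδ), rfl⟩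
    have h3 := Nat.le_findGreatest (P := fun n => ∃ w ∈ Q.weyl Δ, len R h w = n) (hbdd _ h2) h2
    omega

/-- Some product of simple reflections makes every positive root negative, so the exchange property
expresses each s_β through simple reflections. -/
theorem weyl_eq (P : Q.PosSys R Δ h) : Q.weyl Δ = Q.weyl R := by
  refine le_antisymm P.weyl_le (Q.weyl_le fun β hβ => ?_)
  obtain ⟨w, hw, hneg⟩ := P.exists_longest_simple
  obtain ⟨l, hl, rfl⟩ := Q.exists_wprod hw
  rcases (P.ne β hβ).lt_or_gt with hlt | hgt
  · rw [← Q.s_neg]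
    have : 0 < h (-β) := by rw [map_neg]; linarith
    exact P.exists_conj hl (P.root.neg_mem hβ) this (hneg _ (P.root.neg_mem hβ) this)
  · exact P.exists_conj hl hβ hgt (hneg _ hβ hgt)

theorem exists_word (P : Q.PosSys R Δ h) {g : V ≃ₗ[ℂ] V} (hg : g ∈ Q.weyl R) :
    ∃ l, (∀ α ∈ l, α ∈ Δ) ∧ Q.wprod l = g := Q.exists_wprod (P.weyl_eq ▸ hg)

theorem wprod_mem_weyl (P : Q.PosSys R Δ h) {l : List (Module.Dual ℂ V)} (hl : ∀ α ∈ l, α ∈ Δ) :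
    Q.wprod l ∈ Q.weyl R := P.weyl_le (Q.wprod_mem hl)

theorem exists_longest (P : Q.PosSys R Δ h) :
    ∃ w ∈ Q.weyl R, ∀ β ∈ R, 0 < h β → h (cact w β) < 0 := by
  simpa only [P.weyl_eq] using P.exists_longest_simple

theorem len_wprod_le (P : Q.PosSys R Δ h) {l : List (Module.Dual ℂ V)} (hl : ∀ α ∈ l, α ∈ Δ) :
    len R h (Q.wprod l) ≤ l.length := by
  induction l using List.reverseRecOn with
  | nil => simp [P.len_one]
  | append_singleton l a ih =>
    have hl' : ∀ α ∈ l, α ∈ Δ := fun α hα => hl α (by simp [hα])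
    have ha : a ∈ Δ := hl a (by simp)
    have := ih hl'
    rw [wprod_append, wprod_cons, wprod_nil, mul_one, List.length_append, List.length_singleton]
    rcases P.lt_or_gt (P.wprod_mem_weyl hl') (P.sub ha) with h1 | h1
    · have := P.len_mul_s_of_neg ha h1; omega
    · have := P.len_mul_s_of_pos ha h1; omega

/-- In a nonempty word for g, the letters before the last must already make the last one negative,
for otherwise it would add an inversion. Exchange then yields a word shorter by two. -/
theorem eq_one_of_len (P : Q.PosSys R Δ h) {g : V ≃ₗ[ℂ] V} (hg : g ∈ Q.weyl R)
    (h0 : len R h g = 0) : g = 1 := by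
  obtain ⟨l, hl, rfl⟩ := P.exists_word hg
  induction hn : l.length using Nat.strong_induction_on generalizing l with
  | _ n ih =>
    rcases List.eq_nil_or_concat l with rfl | ⟨l', a, rfl⟩
    · rfl
    · rw [List.concat_eq_append] at *
      have hl' : ∀ α ∈ l', α ∈ Δ := fun α hα => hl α (by simp [hα])
      have ha : a ∈ Δ := hl a (by simp)
      have hprod : Q.wprod (l' ++ [a]) = Q.wprod l' * Q.s a := by simp
      have hneg : h (cact (Q.wprod l') a) < 0 := by
        rcases P.lt_or_gt (P.wprod_mem_weyl hl') (P.sub ha) with h1 | h1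
        · exact h1
        · have := P.len_mul_s_of_pos ha h1
          rw [hprod] at h0
          omega
      obtain ⟨l'', h1, h2, h3⟩ := P.exchange hl' (P.sub ha) (P.pos a ha) hneg
      rw [hprod, ← h3] at h0 hg ⊢
      refine ih l''.length ?_ l'' h1 hg h0 rfl
      rw [← hn, List.length_append, ← h2]
      simp

theorem exists_reduced (P : Q.PosSys R Δ h) {g : V ≃ₗ[ℂ] V} (hg : g ∈ Q.weyl R) :
    ∃ l, (∀ α ∈ l, α ∈ Δ) ∧ Q.wprod l = g ∧ l.length = len R h g := by
  induction hn : len R h g generalizing g with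
  | zero => exact ⟨[], by simp, (P.eq_one_of_len hg hn).symm, rfl⟩
  | succ n ih =>
    obtain ⟨δ, hδ, hneg⟩ := P.exists_neg (g := g) (by omega)
    have := P.len_mul_s_of_neg hδ hneg
    obtain ⟨l, hl, hp, hlen⟩ := ih (mul_mem hg (Q.s_mem_weyl (P.sub hδ))) (by omega)
    refine ⟨l ++ [δ], ?_, ?_, by simp [hlen]⟩
    · intro α hα
      rcases List.mem_append.1 hα with h | h
      · exact hl α h
      · rw [List.mem_singleton.1 h]; exact hδ
    · simp [hp, mul_s_mul_s]

/-- A letter changes the number of inversions by exactly one, so no word is shorter than that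
number, and removing descents one by one attains it. -/
theorem length_eq (P : Q.PosSys R Δ h) {g : V ≃ₗ[ℂ] V} (hg : g ∈ Q.weyl R) :
    Q.length Δ g = len R h g := by
  obtain ⟨l, hl, hp, hlen⟩ := P.exists_reduced hg
  apply le_antisymm
  · exact Nat.sInf_le ⟨l, Q.isWord_iff.2 ⟨hl, hp⟩, hlen⟩
  · refine le_csInf ⟨_, l, Q.isWord_iff.2 ⟨hl, hp⟩, hlen⟩ ?_
    rintro _ ⟨l', hl', rfl⟩
    obtain ⟨h1, rfl⟩ := Q.isWord_iff.1 hl'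
    exact P.len_wprod_le h1

theorem reducedWord_spec (P : Q.PosSys R Δ h) {g : V ≃ₗ[ℂ] V} (hg : g ∈ Q.weyl R) :
    (∀ α ∈ Q.reducedWord Δ g, α ∈ Δ) ∧ Q.wprod (Q.reducedWord Δ g) = g ∧
      (Q.reducedWord Δ g).length = len R h g := by
  obtain ⟨l, hl, hp, hlen⟩ := P.exists_reduced hg
  have := Classical.epsilon_spec (p := fun l => Q.IsWord Δ g l ∧ l.length = Q.length Δ g)
    ⟨l, Q.isWord_iff.2 ⟨hl, hp⟩, by rw [hlen, P.length_eq hg]⟩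
  obtain ⟨h1, h2⟩ := Q.isWord_iff.1 this.1
  exact ⟨h1, h2, this.2.trans (P.length_eq hg)⟩

theorem len_inv (P : Q.PosSys R Δ h) {g : V ≃ₗ[ℂ] V} (hg : g ∈ Q.weyl R) :
    len R h g⁻¹ = len R h g := by
  have key : ∀ g ∈ Q.weyl R, len R h g⁻¹ ≤ len R h g := by
    intro g hg
    obtain ⟨l, hl, rfl, hlen⟩ := P.exists_reduced hg
    rw [← wprod_reverse, ← hlen, ← List.length_reverse]
    exact P.len_wprod_le (by simpa using hl)
  apply le_antisymm (key g hg)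
  have := key g⁻¹ (inv_mem hg)
  rwa [inv_inv] at this

theorem len_mul_le (P : Q.PosSys R Δ h) {g g' : V ≃ₗ[ℂ] V} (hg : g ∈ Q.weyl R)
    (hg' : g' ∈ Q.weyl R) : len R h (g * g') ≤ len R h g + len R h g' := by
  obtain ⟨l, hl, rfl, hlen⟩ := P.exists_reduced hg
  obtain ⟨l', hl', rfl, hlen'⟩ := P.exists_reduced hg'
  rw [← wprod_append, ← hlen, ← hlen', ← List.length_append]
  refine P.len_wprod_le fun α hα => ?_
  rcases List.mem_append.1 hα with h | h
  exacts [hl α h, hl' α h]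

theorem len_s_mul_of_pos (P : Q.PosSys R Δ h) {g : V ≃ₗ[ℂ] V} (hg : g ∈ Q.weyl R)
    {δ : Module.Dual ℂ V} (hδ : δ ∈ Δ) (hpos : 0 < h (cact g⁻¹ δ)) :
    len R h (Q.s δ * g) = len R h g + 1 := by
  rw [← P.len_inv (mul_mem (Q.s_mem_weyl (P.sub hδ)) hg), mul_inv_rev, s_inv,
    P.len_mul_s_of_pos hδ hpos, P.len_inv hg]

theorem len_s_mul_of_neg (P : Q.PosSys R Δ h) {g : V ≃ₗ[ℂ] V} (hg : g ∈ Q.weyl R)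
    {δ : Module.Dual ℂ V} (hδ : δ ∈ Δ) (hneg : h (cact g⁻¹ δ) < 0) :
    len R h (Q.s δ * g) + 1 = len R h g := by
  rw [← P.len_inv (mul_mem (Q.s_mem_weyl (P.sub hδ)) hg), mul_inv_rev, s_inv,
    P.len_mul_s_of_neg hδ hneg, P.len_inv hg]

/-- An element with `w R⁺ = -R⁺` and its complements: `ℓ(g) + ℓ(g w) = |R⁺|`. -/
theorem len_add_len_mul (P : Q.PosSys R Δ h) {g w : V ≃ₗ[ℂ] V} (hg : g ∈ Q.weyl R)
    (hw : w ∈ Q.weyl R) (hneg : ∀ β ∈ R, 0 < h β → h (cact w β) < 0) :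
    len R h (g * w) + len R h g = len R h w := by
  classical
  -- β ↦ -wβ matches the inversions of gw with the positive roots that g keeps positive.
  have h1 : len R h (g * w) = (negSet R h (shift (-h) g)).card := by
    refine Finset.card_bij (fun β _ => -cact w β) ?_ ?_ ?_
    · intro β hβ
      obtain ⟨a, b, c⟩ := mem_inv.1 hβ
      have := hneg β a b
      refine mem_negSet.2 ⟨P.root.neg_mem (P.root.cact_mem hw a), by rw [map_neg]; linarith, ?_⟩
      rw [cact_mul] at c
      simp only [shift_apply, map_neg, LinearMap.neg_apply]
      linarith
    · intro β _ γ _ H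
      exact (cact w).injective (neg_injective H)
    · intro γ hγ
      obtain ⟨a, b, c⟩ := mem_negSet.1 hγ
      refine ⟨-cact w⁻¹ γ, ?_, by rw [map_neg, neg_neg, cact_cact_inv]⟩
      have hm := P.root.cact_mem (inv_mem hw) a
      refine mem_inv.2 ⟨P.root.neg_mem hm, ?_, ?_⟩
      · rcases P.lt_or_gt (inv_mem hw) a with h' | h'
        · rw [map_neg]; linarith
        · have := hneg _ hm h'
          rw [cact_cact_inv] at this
          linarith
      · simp only [shift_apply, LinearMap.neg_apply] at c
        rw [cact_mul, map_neg, cact_cact_inv, map_neg, map_neg]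
        linarith
  have h2 : len R h w = (R.filter fun β => 0 < h β).card := by
    rw [len, inv, negSet]
    congr 1
    refine Finset.filter_congr fun β hβ => ⟨fun H => H.1, fun H => ⟨H, hneg β hβ H⟩⟩
  rw [h1, h2, len, inv, negSet, negSet, ← Finset.filter_filter, ← Finset.filter_filter, add_comm]
  rw [← Finset.card_filter_add_card_filter_not (s := R.filter fun β => 0 < h β)
    (fun β => shift h g β < 0)]
  congr 2
  refine Finset.filter_congr fun β hβ => ?_
  have := P.lt_or_gt hg (Finset.mem_filter.1 hβ).1
  simp only [shift_apply, LinearMap.neg_apply, not_lt]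
  constructor
  · intro H; linarith
  · intro H
    rcases this with h' | h' <;> linarith

theorem len_le_longest (P : Q.PosSys R Δ h) {g w : V ≃ₗ[ℂ] V} (hg : g ∈ Q.weyl R)
    (hw : w ∈ Q.weyl R) (hneg : ∀ β ∈ R, 0 < h β → h (cact w β) < 0) :
    len R h g ≤ len R h w := by
  have := P.len_add_len_mul hg hw hneg
  omega

theorem eq_longest (P : Q.PosSys R Δ h) {g w : V ≃ₗ[ℂ] V} (hg : g ∈ Q.weyl R)
    (hw : w ∈ Q.weyl R) (hneg : ∀ β ∈ R, 0 < h β → h (cact w β) < 0)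
    (hlen : len R h w ≤ len R h g) : g = w := by
  have h1 := P.len_add_len_mul (inv_mem hg) hw hneg
  rw [P.len_inv hg] at h1
  have := P.eq_one_of_len (mul_mem (inv_mem hg) hw) (by omega)
  exact inv_mul_eq_one.1 this

theorem longest_spec (P : Q.PosSys R Δ h) :
    Q.longest Δ (Q.weyl R) ∈ Q.weyl R ∧
      ∀ β ∈ R, 0 < h β → h (cact (Q.longest Δ (Q.weyl R)) β) < 0 := by
  obtain ⟨w, hw, hneg⟩ := P.exists_longest
  have := Classical.epsilon_spec (p := fun ω => ω ∈ (Q.weyl R : Set (V ≃ₗ[ℂ] V)) ∧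
    ∀ τ ∈ (Q.weyl R : Set (V ≃ₗ[ℂ] V)), Q.length Δ τ ≤ Q.length Δ ω) ⟨w, hw, fun τ hτ => by
      rw [P.length_eq hτ, P.length_eq hw]; exact P.len_le_longest hτ hw hneg⟩
  have h2 := this.2 w hw
  have h1 : Q.longest Δ (Q.weyl R) ∈ Q.weyl R := this.1
  have h3 : Q.longest Δ (Q.weyl R) = w := by
    apply P.eq_longest h1 hw hneg
    rw [← P.length_eq hw, ← P.length_eq h1]
    exact h2
  rw [h3]
  exact ⟨hw, hneg⟩

theorem eq_one_of_forall (P : Q.PosSys R Δ h) {g : V ≃ₗ[ℂ] V} (hg : g ∈ Q.weyl R)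
    (H : ∀ β ∈ R, cact g β = β) : g = 1 := by
  apply P.eq_one_of_len hg
  rw [len, Finset.card_eq_zero, Finset.eq_empty_iff_forall_notMem]
  intro β hβ
  obtain ⟨h1, h2, h3⟩ := mem_inv.1 hβ
  rw [H β h1] at h3
  linarith

/-- An element fixing all roots has no inversions and so is 1, even when the roots do not span V^*.
The group therefore acts faithfully on the finite set R. -/
theorem finite (P : Q.PosSys R Δ h) : Finite (Q.weyl R) := by
  let F : Q.weyl R → (R → R) := fun g β => ⟨cact g.1 β.1, P.root.cact_mem g.2 β.2⟩
  refine Finite.of_injective F fun g g' H => ?_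
  apply Subtype.ext
  rw [← inv_mul_eq_one]
  apply P.eq_one_of_forall (mul_mem (inv_mem g.2) g'.2)
  intro β hβ
  have := congrArg Subtype.val (congrFun H ⟨β, hβ⟩)
  have h2 : cact g.1 β = cact g'.1 β := this
  rw [cact_mul, ← h2, cact_inv_cact]

end PosSys

end InnerForm

/-! ### Evaluation, translation and the action on polynomial functions -/

theorem lin_sub (α β : Module.Dual ℂ V) : lin (α - β) = lin α - lin β := map_sub _ _ _

theorem lin_neg (α : Module.Dual ℂ V) : lin (-α) = -lin α := map_neg _ _

theorem lin_smul (c : ℂ) (α : Module.Dual ℂ V) : lin (c • α) = c • lin α := map_smul _ _ _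

@[simp] theorem evalAt_lin (v : V) (α : Module.Dual ℂ V) : evalAt v (lin α) = α v := by
  simp [evalAt]

theorem lin_ne_zero {α : Module.Dual ℂ V} (h : α ≠ 0) : lin α ≠ 0 := by
  intro H
  apply h
  ext v
  rw [← evalAt_lin, H, map_zero, LinearMap.zero_apply]

@[simp] theorem act_lin (g : V ≃ₗ[ℂ] V) (β : Module.Dual ℂ V) : act g (lin β) = lin (cact g β) := by
  simp [act, pull]; rfl

theorem act_mul (g g' : V ≃ₗ[ℂ] V) (f : Poly V) : act (g * g') f = act g (act g' f) := by
  have : act (g * g') = (act g).comp (act g') := by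
    apply SymmetricAlgebra.algHom_ext
    ext β
    change act (g * g') (lin β) = act g (act g' (lin β))
    rw [act_lin, act_lin, act_lin, cact_mul]
  rw [this]; rfl

theorem act_one (f : Poly V) : act (1 : V ≃ₗ[ℂ] V) f = f := by
  have : act (1 : V ≃ₗ[ℂ] V) = AlgHom.id ℂ (Poly V) := by
    apply SymmetricAlgebra.algHom_ext
    ext β
    change act (1 : V ≃ₗ[ℂ] V) (lin β) = lin β
    rw [act_lin, cact_one]
  rw [this]; rfl

theorem evalAt_act (g : V ≃ₗ[ℂ] V) (v : V) (f : Poly V) :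
    evalAt v (act g f) = evalAt (g⁻¹ v) f := by
  have : (evalAt v).comp (act g) = evalAt (g⁻¹ v) := by
    apply SymmetricAlgebra.algHom_ext
    ext β
    change evalAt v (act g (lin β)) = evalAt (g⁻¹ v) (lin β)
    rw [act_lin, evalAt_lin, evalAt_lin, cact_apply]
  rw [← this]; rfl

theorem evalAt_zero_act (g : V ≃ₗ[ℂ] V) (f : Poly V) : evalAt 0 (act g f) = evalAt 0 f := by
  rw [evalAt_act, map_zero]

/-- The translation `(T_v f) (x) = f (x + v)` of polynomial functions. -/
def trans (v : V) : Poly V →ₐ[ℂ] Poly V :=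
  SymmetricAlgebra.lift (SymmetricAlgebra.ι ℂ (Module.Dual ℂ V) +
    Algebra.linearMap ℂ (Poly V) ∘ₗ Module.Dual.eval ℂ V v)

@[simp] theorem trans_lin (v : V) (β : Module.Dual ℂ V) :
    trans v (lin β) = lin β + algebraMap ℂ (Poly V) (β v) := by
  simp [trans]

theorem evalAt_trans (v w : V) (f : Poly V) : evalAt w (trans v f) = evalAt (w + v) f := by
  have : (evalAt w).comp (trans v) = evalAt (w + v) := by
    apply SymmetricAlgebra.algHom_ext
    ext β
    change evalAt w (trans v (lin β)) = evalAt (w + v) (lin β)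
    rw [trans_lin, map_add, evalAt_lin, evalAt_lin, AlgHom.commutes, map_add]
    rfl
  rw [← this]; rfl

theorem trans_act (g : V ≃ₗ[ℂ] V) (v : V) (f : Poly V) :
    trans (g v) (act g f) = act g (trans v f) := by
  have : (trans (g v)).comp (act g) = (act g).comp (trans v) := by
    apply SymmetricAlgebra.algHom_ext
    ext β
    change trans (g v) (act g (lin β)) = act g (trans v (lin β))
    rw [act_lin, trans_lin, trans_lin, map_add, act_lin, AlgHom.commutes, cact_apply_apply]
  exact DFunLike.congr_fun this f

theorem trans_trans_neg (v : V) (f : Poly V) : trans v (trans (-v) f) = f := by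
  have : (trans v).comp (trans (-v)) = AlgHom.id ℂ (Poly V) := by
    apply SymmetricAlgebra.algHom_ext
    ext β
    change trans v (trans (-v) (lin β)) = lin β
    rw [trans_lin, map_add, trans_lin, AlgHom.commutes, map_neg, map_neg]
    ring
  exact DFunLike.congr_fun this f

/-- The maximal ideal of polynomial functions vanishing at `v`. -/
def maxIdeal (v : V) : Ideal (Poly V) := RingHom.ker (evalAt v)

theorem mem_maxIdeal {v : V} {f : Poly V} : f ∈ maxIdeal v ↔ evalAt v f = 0 := RingHom.mem_ker

theorem lin_mem_maxIdeal (α : Module.Dual ℂ V) : lin α ∈ maxIdeal (0 : V) := by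
  rw [mem_maxIdeal, evalAt_lin, map_zero]

theorem act_mem_maxIdeal_pow {g : V ≃ₗ[ℂ] V} {v : V} {k : ℕ} {f : Poly V}
    (hf : f ∈ maxIdeal v ^ k) : act g f ∈ maxIdeal (g v) ^ k := by
  have h : (maxIdeal v).map (act g) ≤ maxIdeal (g v) := by
    rw [Ideal.map_le_iff_le_comap]
    intro f hf
    rw [Ideal.mem_comap, mem_maxIdeal, evalAt_act, ← LinearEquiv.mul_apply, inv_mul_cancel]
    exact hf
  have := Ideal.mem_map_of_mem (act g) hf
  rw [Ideal.map_pow] at this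
  exact Ideal.pow_right_mono h k this

theorem trans_mem_maxIdeal_pow {v : V} {k : ℕ} {f : Poly V}
    (hf : f ∈ maxIdeal v ^ k) : trans v f ∈ maxIdeal (0 : V) ^ k := by
  have h : (maxIdeal v).map (trans v) ≤ maxIdeal 0 := by
    rw [Ideal.map_le_iff_le_comap]
    intro f hf
    rw [Ideal.mem_comap, mem_maxIdeal, evalAt_trans, zero_add]
    exact hf
  have := Ideal.mem_map_of_mem (trans v) hf
  rw [Ideal.map_pow] at this
  exact Ideal.pow_right_mono h k this

/-! ### Divided differences and their composition rule. -/

namespace InnerForm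

variable [FiniteDimensional ℂ V] (Q : InnerForm V)

variable {α : Module.Dual ℂ V}

theorem act_s_act_s (α : Module.Dual ℂ V) (f : Poly V) : act (Q.s α) (act (Q.s α) f) = f := by
  rw [← act_mul, s_mul_self, act_one]

theorem lin_mul_nabla (α : Module.Dual ℂ V) (f : Poly V) :
    lin α * Q.nabla α f = f - act (Q.s α) f := Q.mul_nabla α f

theorem nabla_eq_of_lin_mul (hα : α ≠ 0) {f g : Poly V} (h : lin α * g = f - act (Q.s α) f) :
    Q.nabla α f = g :=
  mul_left_cancel₀ (lin_ne_zero hα) (by rw [lin_mul_nabla, h])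

/-- The divided difference operator as a linear map (zero for `α = 0`). -/
def nablaHom (α : Module.Dual ℂ V) : Poly V →ₗ[ℂ] Poly V :=
  open Classical in
  if hα : α = 0 then 0 else
  { toFun := Q.nabla α
    map_add' f g := Q.nabla_eq_of_lin_mul hα (by
      rw [mul_add, lin_mul_nabla, lin_mul_nabla, map_add]; ring)
    map_smul' c f := Q.nabla_eq_of_lin_mul hα (by
      rw [mul_smul_comm, RingHom.id_apply, lin_mul_nabla, map_smul, smul_sub]) }

theorem nablaHom_apply (hα : α ≠ 0) (f : Poly V) : Q.nablaHom α f = Q.nabla α f := by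
  rw [nablaHom, dif_neg hα]; rfl

theorem lin_mul_nablaHom (hα : α ≠ 0) (f : Poly V) :
    lin α * Q.nablaHom α f = f - act (Q.s α) f := by
  rw [nablaHom_apply _ hα, lin_mul_nabla]

theorem nablaHom_eq_of_lin_mul (hα : α ≠ 0) {f g : Poly V} (h : lin α * g = f - act (Q.s α) f) :
    Q.nablaHom α f = g := by
  rw [nablaHom_apply _ hα, Q.nabla_eq_of_lin_mul hα h]

theorem nablaHom_mul (hα : α ≠ 0) (f g : Poly V) :
    Q.nablaHom α (f * g) = Q.nablaHom α f * g + act (Q.s α) f * Q.nablaHom α g := by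
  apply Q.nablaHom_eq_of_lin_mul hα
  rw [map_mul]
  linear_combination g * Q.lin_mul_nablaHom hα f + act (Q.s α) f * Q.lin_mul_nablaHom hα g

theorem nablaHom_algebraMap (hα : α ≠ 0) (c : ℂ) :
    Q.nablaHom α (algebraMap ℂ (Poly V) c) = 0 := by
  apply Q.nablaHom_eq_of_lin_mul hα
  rw [AlgHom.commutes, sub_self, mul_zero]

theorem nablaHom_lin (hα : α ≠ 0) (β : Module.Dual ℂ V) :
    Q.nablaHom α (lin β) = algebraMap ℂ (Poly V) (Q.copair α β) := by
  apply Q.nablaHom_eq_of_lin_mul hα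
  rw [act_lin, cact_s, lin_sub, lin_smul, Algebra.smul_def]
  ring

theorem nablaHom_eq_zero_iff (hα : α ≠ 0) (f : Poly V) :
    Q.nablaHom α f = 0 ↔ act (Q.s α) f = f := by
  constructor
  · intro h
    have := Q.lin_mul_nablaHom hα f
    rw [h, mul_zero] at this
    exact (sub_eq_zero.1 this.symm).symm
  · intro h
    apply Q.nablaHom_eq_of_lin_mul hα
    rw [h, sub_self, mul_zero]

theorem nablaHom_mul_of_invariant (hα : α ≠ 0) {f : Poly V} (hf : act (Q.s α) f = f) (g : Poly V) :
    Q.nablaHom α (f * g) = f * Q.nablaHom α g := by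
  rw [nablaHom_mul _ hα, (Q.nablaHom_eq_zero_iff hα f).2 hf, hf, zero_mul, zero_add]

/-- Both α and f - s_α f change sign under s_α. -/
theorem act_s_nablaHom (hα : Q.dualForm α α ≠ 0) (f : Poly V) :
    act (Q.s α) (Q.nablaHom α f) = Q.nablaHom α f := by
  have h0 : α ≠ 0 := by rintro rfl; exact hα (by simp [dualForm_eq])
  apply mul_left_cancel₀ (lin_ne_zero h0)
  have h1 := congrArg (act (Q.s α)) (Q.lin_mul_nablaHom h0 f)
  rw [map_mul, map_sub, act_s_act_s, act_lin, cact_s_self _ hα, lin_neg] at h1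
  linear_combination -h1 - Q.lin_mul_nablaHom h0 f

theorem nablaHom_nablaHom (hα : Q.dualForm α α ≠ 0) (f : Poly V) :
    Q.nablaHom α (Q.nablaHom α f) = 0 := by
  have h0 : α ≠ 0 := by rintro rfl; exact hα (by simp [dualForm_eq])
  rw [nablaHom_eq_zero_iff _ h0, act_s_nablaHom _ hα]

theorem nablaHom_act_s (hα : α ≠ 0) (f : Poly V) :
    Q.nablaHom α (act (Q.s α) f) = -Q.nablaHom α f := by
  apply Q.nablaHom_eq_of_lin_mul hα
  rw [mul_neg, lin_mul_nablaHom _ hα, act_s_act_s, neg_sub]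

theorem act_nablaHom {g : V ≃ₗ[ℂ] V} (hg : g ∈ Q.orth) (hα : α ≠ 0) (f : Poly V) :
    act g (Q.nablaHom α f) = Q.nablaHom (cact g α) (act g f) := by
  symm
  apply Q.nablaHom_eq_of_lin_mul (fun h => hα ((cact g).map_eq_zero_iff.1 h))
  rw [← act_lin, ← map_mul, lin_mul_nablaHom _ hα, map_sub, ← act_mul, ← act_mul, s_cact_mul _ hg]

theorem evalAt_nablaHom (hα : α ≠ 0) {p : V} (hp : α p ≠ 0) (f : Poly V) :
    evalAt p (Q.nablaHom α f) = (evalAt p f - evalAt (Q.s α p) f) / α p := by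
  have := congrArg (evalAt p) (Q.lin_mul_nablaHom hα f)
  rw [map_mul, map_sub, evalAt_act, evalAt_lin, s_inv] at this
  rw [← this, mul_div_cancel_left₀ _ hp]

/-- By the twisted Leibniz rule, ∇_α lowers the order of vanishing at the origin by at most one. -/
theorem nablaHom_mem_maxIdeal_pow (hα : α ≠ 0) {k : ℕ} {f : Poly V}
    (hf : f ∈ maxIdeal (0 : V) ^ (k + 1)) : Q.nablaHom α f ∈ maxIdeal (0 : V) ^ k := by
  induction k generalizing f with
  | zero => simp
  | succ k ih =>
    rw [pow_succ'] at hf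
    induction hf using Submodule.mul_induction_on' with
    | mem_mul_mem a ha b hb =>
      rw [nablaHom_mul _ hα]
      refine add_mem (Ideal.mul_mem_left _ _ hb) ?_
      rw [pow_succ']
      refine Ideal.mul_mem_mul ?_ (ih hb)
      rw [mem_maxIdeal, evalAt_zero_act]
      exact ha
    | add a _ b _ iha ihb =>
      rw [map_add]
      exact add_mem iha ihb

/-- The composition of divided differences along a word. -/
def dd (l : List (Module.Dual ℂ V)) : Module.End ℂ (Poly V) := (l.map Q.nablaHom).prod

@[simp] theorem dd_nil (f : Poly V) : Q.dd [] f = f := rfl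

@[simp] theorem dd_cons (α : Module.Dual ℂ V) (l : List (Module.Dual ℂ V)) (f : Poly V) :
    Q.dd (α :: l) f = Q.nablaHom α (Q.dd l f) := by
  simp [dd]

theorem dd_append (l l' : List (Module.Dual ℂ V)) (f : Poly V) :
    Q.dd (l ++ l') f = Q.dd l (Q.dd l' f) := by
  simp [dd]

theorem dd_mul_of_invariant {l : List (Module.Dual ℂ V)} (hl : ∀ α ∈ l, α ≠ 0) {f : Poly V}
    (hf : ∀ α ∈ l, act (Q.s α) f = f) (g : Poly V) : Q.dd l (f * g) = f * Q.dd l g := by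
  induction l with
  | nil => rfl
  | cons a l ih =>
    rw [dd_cons, dd_cons, ih (fun α hα => hl α (by simp [hα])) (fun α hα => hf α (by simp [hα])),
      nablaHom_mul_of_invariant _ (hl a (by simp)) (hf a (by simp))]

theorem act_dd {g : V ≃ₗ[ℂ] V} (hg : g ∈ Q.orth) {l : List (Module.Dual ℂ V)}
    (hl : ∀ α ∈ l, α ≠ 0 ∧ cact g α = α) (f : Poly V) : act g (Q.dd l f) = Q.dd l (act g f) := by
  induction l with
  | nil => rfl
  | cons a l ih =>
    rw [dd_cons, dd_cons, act_nablaHom _ hg (hl a (by simp)).1, (hl a (by simp)).2,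
      ih fun α hα => hl α (by simp [hα])]

theorem dd_mem_maxIdeal_pow {l : List (Module.Dual ℂ V)} (hl : ∀ α ∈ l, α ≠ 0) {k : ℕ}
    {f : Poly V} (hf : f ∈ maxIdeal (0 : V) ^ (k + l.length)) :
    Q.dd l f ∈ maxIdeal (0 : V) ^ k := by
  induction l generalizing k with
  | nil => exact hf
  | cons a l ih =>
    rw [dd_cons]
    apply Q.nablaHom_mem_maxIdeal_pow (hl a (by simp))
    refine ih (fun α hα => hl α (by simp [hα])) ?_
    rwa [List.length_cons, add_comm l.length, ← add_assoc] at hf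

/-- The divided difference `∂_σ` as a linear map. -/
def ddiff (Ω : Finset (Module.Dual ℂ V)) (σ : V ≃ₗ[ℂ] V) : Module.End ℂ (Poly V) :=
  Q.dd (Q.reducedWord Ω σ)

variable {Q} {R Δ : Finset (Module.Dual ℂ V)} {h : Module.Dual ℂ V →ₗ[ℝ] ℝ}

namespace PosSys

theorem ne_zero (P : Q.PosSys R Δ h) {δ : Module.Dual ℂ V} (hδ : δ ∈ Δ) : δ ≠ 0 :=
  P.root.ne_zero (P.sub hδ)

theorem nonisotropic (P : Q.PosSys R Δ h) {δ : Module.Dual ℂ V} (hδ : δ ∈ Δ) :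
    Q.dualForm δ δ ≠ 0 := P.root.nonisotropic δ (P.sub hδ)

theorem divDiff_eq (P : Q.PosSys R Δ h) {σ : V ≃ₗ[ℂ] V} (hσ : σ ∈ Q.weyl R) (f : Poly V) :
    Q.divDiff Δ σ f = Q.ddiff Δ σ f := by
  rw [divDiff, ddiff]
  have : ∀ l : List (Module.Dual ℂ V), (∀ α ∈ l, α ∈ Δ) → l.foldr Q.nabla f = Q.dd l f := by
    intro l hl
    induction l with
    | nil => rfl
    | cons a l ih =>
      rw [List.foldr_cons, dd_cons, ih fun α hα => hl α (by simp [hα]),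
        nablaHom_apply _ (P.ne_zero (hl a (by simp)))]
  exact this _ (P.reducedWord_spec hσ).1

/-- Among all roots s_a changes the sign of ±a only, so the single new inversion is the root which σ
maps to a. -/
theorem inv_s_mul (P : Q.PosSys R Δ h) {σ : V ≃ₗ[ℂ] V} (hσ : σ ∈ Q.weyl R)
    {a : Module.Dual ℂ V} (ha : a ∈ Δ) (hpos : 0 < h (cact σ⁻¹ a)) :
    cact σ⁻¹ a ∉ inv R h σ ∧
      ∀ β, β ∈ inv R h (Q.s a * σ) ↔ β = cact σ⁻¹ a ∨ β ∈ inv R h σ := by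
  refine ⟨fun H => ?_, fun β => ⟨fun H => ?_, ?_⟩⟩
  · obtain ⟨-, -, H⟩ := mem_inv.1 H
    rw [cact_cact_inv] at H
    linarith [P.pos a ha]
  · obtain ⟨h1, h2, h3⟩ := mem_inv.1 H
    by_cases hβ : cact σ β = a
    · left; rw [← hβ, cact_inv_cact]
    · right
      refine mem_inv.2 ⟨h1, h2, ?_⟩
      rcases P.lt_or_gt hσ h1 with h4 | h4
      · exact h4
      · have := P.simple a ha _ (P.root.cact_mem hσ h1) h4 hβ
        rw [cact_mul] at h3
        linarith
  · rintro (rfl | H)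
    · refine mem_inv.2 ⟨P.root.cact_mem (inv_mem hσ) (P.sub ha), hpos, ?_⟩
      rw [cact_mul, cact_cact_inv, P.s_self (P.sub ha), map_neg]
      linarith [P.pos a ha]
    · obtain ⟨h1, h2, h3⟩ := mem_inv.1 H
      refine mem_inv.2 ⟨h1, h2, ?_⟩
      have h4 : 0 < h (-cact σ β) := by rw [map_neg]; linarith
      have h5 : -cact σ β ≠ a := by
        rintro rfl
        rw [map_neg, cact_inv_cact, map_neg] at hpos
        linarith
      have := P.simple a ha _ (P.root.neg_mem (P.root.cact_mem hσ h1)) h4 h5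
      rw [map_neg, map_neg] at this
      rw [cact_mul]
      linarith

theorem len_mul_s_inv (P : Q.PosSys R Δ h) {σ : V ≃ₗ[ℂ] V} (hσ : σ ∈ Q.weyl R)
    {β : Module.Dual ℂ V} (hβ : β ∈ inv R h σ) : len R h (σ * Q.s β) + 1 ≤ len R h σ := by
  obtain ⟨h1, h2, h3⟩ := mem_inv.1 hβ
  obtain ⟨l, hl, rfl, hlen⟩ := P.exists_reduced hσ
  obtain ⟨l', hl', hlen', hp⟩ := P.exchange hl h1 h2 h3
  have := P.len_wprod_le hl'
  rw [hp] at this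
  omega

open Classical in
/-- The correction term in the commutation of a divided difference with a linear form. -/
def leibnizTerm (Q : InnerForm V) (R Δ : Finset (Module.Dual ℂ V)) (h : Module.Dual ℂ V →ₗ[ℝ] ℝ)
    (σ : V ≃ₗ[ℂ] V) (χ : Module.Dual ℂ V) (f : Poly V) : Poly V :=
  ∑ β ∈ inv R h σ, Q.copair β χ •
    (if len R h (σ * Q.s β) + 1 = len R h σ then Q.ddiff Δ (σ * Q.s β) f else 0)

-- Applying ∇_a to the rule for σ, the factor ∇_a(σχ) is the constant ⟨σχ, a^∨⟩ and supplies the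
-- term of the new inversion σ⁻¹a. The remaining terms are ∇_a ∂_{σ s_β}, evaluated through `ih`.
open Classical in
theorem leibniz_step (P : Q.PosSys R Δ h) (r : ℕ)
    (ih : ∀ l, (∀ α ∈ l, α ∈ Δ) → l.length = r → ∀ f, Q.dd l f =
      if len R h (Q.wprod l) = r then Q.ddiff Δ (Q.wprod l) f else 0)
    {l : List (Module.Dual ℂ V)} (hl : ∀ α ∈ l, α ∈ Δ) (hlr : l.length = r)
    {a : Module.Dual ℂ V} (ha : a ∈ Δ) (hred : len R h (Q.wprod (a :: l)) = r + 1)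
    (χ : Module.Dual ℂ V) (f : Poly V)
    (hleib : Q.dd l (lin χ * f) = lin (cact (Q.wprod l) χ) * Q.dd l f +
      leibnizTerm Q R Δ h (Q.wprod l) χ f) :
    Q.dd (a :: l) (lin χ * f) = lin (cact (Q.wprod (a :: l)) χ) * Q.dd (a :: l) f +
      leibnizTerm Q R Δ h (Q.wprod (a :: l)) χ f := by
  set σ := Q.wprod l with hσdef
  have hσ : σ ∈ Q.weyl R := P.wprod_mem_weyl hl
  have h0 := P.len_wprod_le hl
  have hσr : len R h σ = r := by
    rw [wprod_cons] at hred
    have hs : len R h (Q.s a) ≤ 1 := by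
      have := P.len_wprod_le (l := [a]) (by simpa using ha)
      simpa using this
    have := P.len_mul_le (Q.s_mem_weyl (P.sub ha)) hσ
    rw [← hσdef] at h0 hred
    omega
  have hpos : 0 < h (cact σ⁻¹ a) := by
    rcases P.lt_or_gt (inv_mem hσ) (P.sub ha) with h1 | h1
    · have := P.len_s_mul_of_neg hσ ha h1
      rw [wprod_cons, ← hσdef] at hred
      omega
    · exact h1
  obtain ⟨hnot, hinv⟩ := P.inv_s_mul hσ ha hpos
  have hinv' : inv R h (Q.s a * σ) = insert (cact σ⁻¹ a) (inv R h σ) := by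
    ext β; rw [hinv, Finset.mem_insert]
  have ha0 := P.ne_zero ha
  have hO := Q.weyl_le_orth R hσ
  rw [dd_cons, dd_cons, hleib, map_add, nablaHom_mul _ ha0, nablaHom_lin _ ha0, act_lin,
    wprod_cons, cact_mul, leibnizTerm, leibnizTerm, hinv', Finset.sum_insert hnot]
  have e1 : Q.copair (cact σ⁻¹ a) χ = Q.copair a (cact σ χ) := by
    rw [← Q.copair_cact hO, cact_cact_inv]
  have e2 : Q.s a * σ * Q.s (cact σ⁻¹ a) = σ := by
    rw [s_cact _ (inv_mem hO), inv_inv]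
    simp only [mul_assoc, mul_inv_cancel_left, s_mul_s_mul]
  have e3 : len R h (Q.s a * σ) = r + 1 := hred
  rw [e1, e2, e3, hσr, if_pos rfl, map_sum]
  have e4 : Q.dd l f = Q.ddiff Δ σ f := by rw [ih l hl hlr, if_pos hσr]
  rw [e4, Algebra.smul_def]
  have e5 : ∀ β ∈ inv R h σ,
      Q.nablaHom a (Q.copair β χ • if len R h (σ * Q.s β) + 1 = r then
        Q.ddiff Δ (σ * Q.s β) f else 0) =
      Q.copair β χ • if len R h (Q.s a * σ * Q.s β) + 1 = r + 1 then
        Q.ddiff Δ (Q.s a * σ * Q.s β) f else 0 := by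
    intro β hβ
    have hτ : σ * Q.s β ∈ Q.weyl R := mul_mem hσ (Q.s_mem_weyl (mem_inv.1 hβ).1)
    rw [map_smul]
    congr 1
    rw [mul_assoc]
    split_ifs with c1 c2 c2
    · obtain ⟨w1, w2, w3⟩ := P.reducedWord_spec hτ
      have := ih (a :: Q.reducedWord Δ (σ * Q.s β)) (by
        intro α hα
        rcases List.mem_cons.1 hα with rfl | hα
        exacts [ha, w1 α hα]) (by rw [List.length_cons]; omega) f
      rw [dd_cons, wprod_cons, w2, if_pos (by omega)] at this
      exact this
    · obtain ⟨w1, w2, w3⟩ := P.reducedWord_spec hτ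
      have := ih (a :: Q.reducedWord Δ (σ * Q.s β)) (by
        intro α hα
        rcases List.mem_cons.1 hα with rfl | hα
        exacts [ha, w1 α hα]) (by rw [List.length_cons]; omega) f
      rw [dd_cons, wprod_cons, w2, if_neg (by omega)] at this
      exact this
    -- If σ s_β is shorter than σ by more than one, then s_a σ s_β cannot reach length r.
    · exfalso
      have h1 := P.len_mul_s_inv hσ hβ
      rcases P.lt_or_gt (inv_mem hτ) (P.sub ha) with h2 | h2
      · have := P.len_s_mul_of_neg hτ ha h2
        omega
      · have := P.len_s_mul_of_pos hτ ha h2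
        omega
    · exact map_zero _
  rw [Finset.sum_congr rfl e5]
  ring

/-- A word in simple roots yields the divided difference of its product if it is reduced, and zero
otherwise; divided differences along reduced words satisfy a Leibniz rule for linear forms. -/
theorem dd_eq_and_leibniz (P : Q.PosSys R Δ h) (r : ℕ) :
    (∀ l, (∀ α ∈ l, α ∈ Δ) → l.length = r → ∀ f, Q.dd l f =
      open Classical in if len R h (Q.wprod l) = r then Q.ddiff Δ (Q.wprod l) f else 0) ∧
    (∀ l, (∀ α ∈ l, α ∈ Δ) → l.length = r → len R h (Q.wprod l) = r → ∀ χ f,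
      Q.dd l (lin χ * f) = lin (cact (Q.wprod l) χ) * Q.dd l f +
        leibnizTerm Q R Δ h (Q.wprod l) χ f) := by
  classical
  induction r with
  | zero =>
    have hw : Q.reducedWord Δ 1 = [] := by
      have := (P.reducedWord_spec (one_mem _)).2.2
      rw [P.len_one] at this
      exact List.eq_nil_of_length_eq_zero this
    refine ⟨fun l _ h0 f => ?_, fun l _ h0 _ χ f => ?_⟩
    · obtain rfl := List.eq_nil_of_length_eq_zero h0
      rw [wprod_nil, if_pos P.len_one, ddiff, hw]
    · obtain rfl := List.eq_nil_of_length_eq_zero h0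
      have : inv R h 1 = ∅ := Finset.card_eq_zero.1 P.len_one
      rw [wprod_nil, leibnizTerm, this, cact_one]
      simp
  | succ r ih =>
    obtain ⟨ih1, ih2⟩ := ih
    have hleib : ∀ l, (∀ α ∈ l, α ∈ Δ) → l.length = r + 1 → len R h (Q.wprod l) = r + 1 →
        ∀ χ f, Q.dd l (lin χ * f) = lin (cact (Q.wprod l) χ) * Q.dd l f +
          leibnizTerm Q R Δ h (Q.wprod l) χ f := by
      intro l hl hlr hred χ f
      obtain _ | ⟨a, l⟩ := l
      · simp at hlr
      have hl' : ∀ α ∈ l, α ∈ Δ := fun α hα => hl α (by simp [hα])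
      have ha : a ∈ Δ := hl a (by simp)
      have hlr' : l.length = r := by simpa using hlr
      refine P.leibniz_step r ih1 hl' hlr' ha hred χ f (ih2 l hl' hlr' ?_ χ f)
      have h0 := P.len_wprod_le hl'
      have hs : len R h (Q.s a) ≤ 1 := by
        have := P.len_wprod_le (l := [a]) (by simpa using ha)
        simpa using this
      have := P.len_mul_le (Q.s_mem_weyl (P.sub ha)) (P.wprod_mem_weyl hl')
      rw [wprod_cons] at hred
      omega
    refine ⟨fun l hl hlr f => ?_, hleib⟩
    split_ifs with hred
    · obtain ⟨w1, w2, w3⟩ := P.reducedWord_spec (P.wprod_mem_weyl hl)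
      rw [ddiff]
      set l' := Q.reducedWord Δ (Q.wprod l)
      have hone : ∀ l : List (Module.Dual ℂ V), (∀ α ∈ l, α ∈ Δ) → l.length = r + 1 →
          ∀ c, Q.dd l (algebraMap ℂ (Poly V) c) = 0 := by
        intro l hl hlr c
        rcases List.eq_nil_or_concat l with rfl | ⟨l', b, rfl⟩
        · simp at hlr
        · rw [List.concat_eq_append, dd_append, dd_cons, dd_nil, nablaHom_algebraMap, map_zero]
          exact P.ne_zero (hl b (by simp))
      -- Two reduced words of one element have the same correction terms, since these depend only on
      -- the element. The difference D of the two operators is thus twisted-linear over Λ, and it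
      -- kills 1, so it vanishes. This replaces the braid relations.
      suffices H : ∀ D : Poly V →ₗ[ℂ] Poly V, (∀ c, D (algebraMap ℂ _ c) = 0) →
          (∀ χ f, D (lin χ * f) = lin (cact (Q.wprod l) χ) * D f) → ∀ f g, D (f * g) =
            act (Q.wprod l) f * D g by
        have := H (Q.dd l - Q.dd l') (fun c => by
          rw [LinearMap.sub_apply, hone l hl hlr, hone l' w1 (by omega), sub_zero]) (fun χ f => by
          have e := hleib l' w1 (by omega) (by rw [w2]; omega) χ f
          rw [w2] at e
          rw [LinearMap.sub_apply, LinearMap.sub_apply, hleib l hl hlr hred, e]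
          ring) f 1
        rw [mul_one, ← map_one (algebraMap ℂ (Poly V)), LinearMap.sub_apply, LinearMap.sub_apply,
          hone l hl hlr, hone l' w1 (by omega), sub_zero, mul_zero] at this
        exact sub_eq_zero.1 this
      intro D _ hD2 f
      induction f using SymmetricAlgebra.induction with
      | algebraMap c =>
        intro g
        rw [← Algebra.smul_def, map_smul, AlgHom.commutes, Algebra.smul_def]
      | ι χ => intro g; rw [hD2, act_lin]
      | mul a b ha hb => intro g; rw [mul_assoc, ha, hb, map_mul, mul_assoc]
      | add a b ha hb => intro g; rw [add_mul, map_add, ha, hb, map_add, add_mul]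
    · obtain _ | ⟨a, l⟩ := l
      · simp at hlr
      have hl' : ∀ α ∈ l, α ∈ Δ := fun α hα => hl α (by simp [hα])
      have ha : a ∈ Δ := hl a (by simp)
      have hlr' : l.length = r := by simpa using hlr
      have hσ := P.wprod_mem_weyl hl'
      rw [dd_cons, ih1 l hl' hlr' f]
      split_ifs with c
      -- Here the element has a reduced word beginning with a, so ∇_a is applied twice and ∇_a² = 0.
      · have hneg : h (cact (Q.wprod l)⁻¹ a) < 0 := by
          rcases P.lt_or_gt (inv_mem hσ) (P.sub ha) with h1 | h1
          · exact h1
          · have := P.len_s_mul_of_pos hσ ha h1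
            rw [wprod_cons] at hred
            omega
        have hlen := P.len_s_mul_of_neg hσ ha hneg
        obtain ⟨w1, w2, w3⟩ :=
          P.reducedWord_spec (mul_mem (Q.s_mem_weyl (P.sub ha)) hσ)
        have := ih1 (a :: Q.reducedWord Δ (Q.s a * Q.wprod l)) (by
          intro α hα
          rcases List.mem_cons.1 hα with rfl | hα
          exacts [ha, w1 α hα]) (by rw [List.length_cons]; omega) f
        rw [wprod_cons, w2, s_mul_s_mul, if_pos c, dd_cons] at this
        rw [← this, nablaHom_nablaHom _ (P.nonisotropic ha)]
      · exact map_zero _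

theorem dd_eq_ddiff (P : Q.PosSys R Δ h) {l : List (Module.Dual ℂ V)} (hl : ∀ α ∈ l, α ∈ Δ)
    (hred : len R h (Q.wprod l) = l.length) (f : Poly V) : Q.dd l f = Q.ddiff Δ (Q.wprod l) f := by
  rw [(P.dd_eq_and_leibniz l.length).1 l hl rfl, if_pos hred]

theorem ddiff_ddiff (P : Q.PosSys R Δ h) {σ τ : V ≃ₗ[ℂ] V} (hσ : σ ∈ Q.weyl R)
    (hτ : τ ∈ Q.weyl R) (f : Poly V) : Q.ddiff Δ σ (Q.ddiff Δ τ f) =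
      open Classical in
      if len R h (σ * τ) = len R h σ + len R h τ then Q.ddiff Δ (σ * τ) f else 0 := by
  obtain ⟨w1, w2, w3⟩ := P.reducedWord_spec hσ
  obtain ⟨u1, u2, u3⟩ := P.reducedWord_spec hτ
  rw [ddiff, ddiff, ← dd_append, (P.dd_eq_and_leibniz (len R h σ + len R h τ)).1 _ _ _ f,
    wprod_append, w2, u2, ddiff]
  · intro α hα
    rcases List.mem_append.1 hα with h | h
    exacts [w1 α h, u1 α h]
  · rw [List.length_append, w3, u3]

theorem ddiff_nablaHom (P : Q.PosSys R Δ h) {σ : V ≃ₗ[ℂ] V} (hσ : σ ∈ Q.weyl R)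
    {δ : Module.Dual ℂ V} (hδ : δ ∈ Δ) (f : Poly V) : Q.ddiff Δ σ (Q.nablaHom δ f) =
      open Classical in
      if 0 < h (cact σ δ) then Q.ddiff Δ (σ * Q.s δ) f else 0 := by
  obtain ⟨w1, w2, w3⟩ := P.reducedWord_spec hσ
  have := (P.dd_eq_and_leibniz (len R h σ + 1)).1 (Q.reducedWord Δ σ ++ [δ]) (by
    intro α hα
    rcases List.mem_append.1 hα with h | h
    · exact w1 α h
    · rw [List.mem_singleton.1 h]; exact hδ) (by simp [w3]) f
  rw [dd_append, dd_cons, dd_nil, wprod_append, w2, wprod_cons, wprod_nil, mul_one] at this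
  rw [ddiff, this]
  rcases P.lt_or_gt hσ (P.sub hδ) with h1 | h1
  · have := P.len_mul_s_of_neg hδ h1
    rw [if_neg (by omega), if_neg (by linarith)]
  · rw [if_pos (P.len_mul_s_of_pos hδ h1), if_pos h1]

theorem nablaHom_ddiff (P : Q.PosSys R Δ h) {σ : V ≃ₗ[ℂ] V} (hσ : σ ∈ Q.weyl R)
    {δ : Module.Dual ℂ V} (hδ : δ ∈ Δ) (hneg : h (cact σ⁻¹ δ) < 0) (f : Poly V) :
    Q.nablaHom δ (Q.ddiff Δ σ f) = 0 := by
  obtain ⟨w1, w2, w3⟩ := P.reducedWord_spec hσ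
  have := (P.dd_eq_and_leibniz (len R h σ + 1)).1 (δ :: Q.reducedWord Δ σ) (by
    intro α hα
    rcases List.mem_cons.1 hα with rfl | h
    exacts [hδ, w1 α h]) (by simp [w3]) f
  have h2 := P.len_s_mul_of_neg hσ hδ hneg
  rw [dd_cons, wprod_cons, w2, if_neg (by omega)] at this
  exact this

theorem ddiff_one (P : Q.PosSys R Δ h) (f : Poly V) : Q.ddiff Δ 1 f = f := by
  have := P.dd_eq_ddiff (l := []) (by simp) (by simp [P.len_one]) f
  rw [wprod_nil] at this
  rw [← this, dd_nil]

theorem ddiff_mul_of_invariant (P : Q.PosSys R Δ h) {σ : V ≃ₗ[ℂ] V} (hσ : σ ∈ Q.weyl R)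
    {f : Poly V} (hf : f ∈ Q.invariants R) (g : Poly V) :
    Q.ddiff Δ σ (f * g) = f * Q.ddiff Δ σ g := by
  obtain ⟨w1, -, -⟩ := P.reducedWord_spec hσ
  exact Q.dd_mul_of_invariant (fun α hα => P.ne_zero (w1 α hα))
    (fun α hα => hf _ (Q.s_mem_weyl (P.sub (w1 α hα)))) g

theorem ddiff_mem_maxIdeal_pow (P : Q.PosSys R Δ h) {σ : V ≃ₗ[ℂ] V} (hσ : σ ∈ Q.weyl R) {k : ℕ}
    {f : Poly V} (hf : f ∈ maxIdeal (0 : V) ^ (k + len R h σ)) :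
    Q.ddiff Δ σ f ∈ maxIdeal (0 : V) ^ k := by
  obtain ⟨w1, -, w3⟩ := P.reducedWord_spec hσ
  rw [← w3] at hf
  exact Q.dd_mem_maxIdeal_pow (fun α hα => P.ne_zero (w1 α hα)) hf

end PosSys

end InnerForm

/-! ### The degree filtration and interpolation at finitely many points. -/

theorem poly_induction {C : Poly V → Prop} (one : C 1) (smul : ∀ (c : ℂ) f, C f → C (c • f))
    (add : ∀ f g, C f → C g → C (f + g)) (lin_mul : ∀ α f, C f → C (lin α * f)) (f : Poly V) :
    C f := by
  suffices H : ∀ f g : Poly V, C g → C (f * g) by simpa using H f 1 one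
  intro f
  induction f using SymmetricAlgebra.induction with
  | algebraMap c => intro g hg; rw [← Algebra.smul_def]; exact smul c g hg
  | ι α => exact lin_mul α
  | mul a b ha hb => intro g hg; rw [mul_assoc]; exact ha _ (hb g hg)
  | add a b ha hb => intro g hg; rw [add_mul]; exact add _ _ (ha g hg) (hb g hg)

/-- Polynomial functions of degree at most one. -/
def affine (V : Type*) [AddCommGroup V] [Module ℂ V] : Submodule ℂ (Poly V) :=
  1 ⊔ LinearMap.range (SymmetricAlgebra.ι ℂ (Module.Dual ℂ V))

theorem one_mem_affine : (1 : Poly V) ∈ affine V :=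
  Submodule.mem_sup_left (Submodule.mem_one.2 ⟨1, map_one _⟩)

theorem lin_mem_affine (α : Module.Dual ℂ V) : lin α ∈ affine V :=
  Submodule.mem_sup_right ⟨α, rfl⟩

theorem exists_of_mem_affine {f : Poly V} (hf : f ∈ affine V) :
    ∃ (c : ℂ) (α : Module.Dual ℂ V), algebraMap ℂ (Poly V) c + lin α = f := by
  obtain ⟨y, hy, z, hz, rfl⟩ := Submodule.mem_sup.1 hf
  obtain ⟨c, rfl⟩ := Submodule.mem_one.1 hy
  obtain ⟨α, rfl⟩ := hz
  exact ⟨c, α, rfl⟩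

theorem one_mem_affine_pow (k : ℕ) : (1 : Poly V) ∈ affine V ^ k := by
  have := Submodule.pow_mem_pow (affine V) one_mem_affine k
  rwa [one_pow] at this

theorem affine_pow_mono {k l : ℕ} (h : k ≤ l) : affine V ^ k ≤ affine V ^ l := by
  obtain ⟨m, rfl⟩ := Nat.exists_eq_add_of_le h
  intro f hf
  rw [pow_add, ← mul_one f]
  exact Submodule.mul_mem_mul hf (one_mem_affine_pow m)

theorem exists_mem_affine_pow (f : Poly V) : ∃ k, f ∈ affine V ^ k := by
  induction f using poly_induction with
  | one => exact ⟨0, by simp⟩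
  | smul c f hf => obtain ⟨k, hk⟩ := hf; exact ⟨k, Submodule.smul_mem _ c hk⟩
  | add f g hf hg =>
    obtain ⟨k, hk⟩ := hf
    obtain ⟨l, hl⟩ := hg
    exact ⟨max k l, add_mem (affine_pow_mono (le_max_left _ _) hk)
      (affine_pow_mono (le_max_right _ _) hl)⟩
  | lin_mul α f hf =>
    obtain ⟨k, hk⟩ := hf
    refine ⟨k + 1, ?_⟩
    rw [pow_succ']
    exact Submodule.mul_mem_mul (lin_mem_affine α) hk

theorem act_mem_affine {g : V ≃ₗ[ℂ] V} {f : Poly V} (hf : f ∈ affine V) : act g f ∈ affine V := by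
  obtain ⟨c, α, rfl⟩ := exists_of_mem_affine hf
  rw [map_add, AlgHom.commutes, act_lin, Algebra.algebraMap_eq_smul_one]
  exact add_mem (Submodule.smul_mem _ _ one_mem_affine) (lin_mem_affine _)

instance [FiniteDimensional ℂ V] (k : ℕ) : FiniteDimensional ℂ ↥(affine V ^ k) := by
  have : (affine V).FG := by
    refine Submodule.FG.sup ?_ ?_
    · rw [Submodule.one_eq_span]
      exact Submodule.fg_span_singleton 1
    · rw [LinearMap.range_eq_map]
      exact Submodule.FG.map _ Module.Finite.fg_top
  exact Module.Finite.iff_fg.2 (this.pow k)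

/-- Polynomial functions with prescribed jets at finitely many points. -/
theorem exists_interpolation (S : Finset V) (k : ℕ) (t : V → Poly V) :
    ∃ f : Poly V, ∀ v ∈ S, f - t v ∈ maxIdeal v ^ k := by
  have hmax : ∀ v : V, (maxIdeal v).IsMaximal := fun v =>
    RingHom.ker_isMaximal_of_surjective _ fun c => ⟨algebraMap ℂ _ c, AlgHom.commutes _ c⟩
  obtain ⟨f, hf⟩ := Ideal.exists_forall_sub_mem_ideal (ι := S) (I := fun v => maxIdeal v.1 ^ k)
    (fun v w hvw => by
      apply IsCoprime.pow
      have := hmax v.1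
      have := hmax w.1
      apply Ideal.isCoprime_of_isMaximal
      intro H
      obtain ⟨β, hβ⟩ := exists_dual_ne fun e => hvw (Subtype.ext e)
      apply hβ
      have : lin β - algebraMap ℂ _ (β v.1) ∈ maxIdeal v.1 := by
        rw [mem_maxIdeal, map_sub, AlgHom.commutes, evalAt_lin]; exact sub_self _
      rw [H, mem_maxIdeal, map_sub, AlgHom.commutes, evalAt_lin] at this
      exact (sub_eq_zero.1 this).symm) (fun v => t v.1)
  exact ⟨f, fun v hv => hf ⟨v, hv⟩⟩

/-! ### The pairing of Θ and the Euler operator. -/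

namespace InnerForm

variable [FiniteDimensional ℂ V] (Q : InnerForm V)

theorem theta_mul_apply (f g p : Poly V) : Q.theta (f * g) p = Q.theta f (Q.theta g p) := by
  rw [map_mul, Module.End.mul_apply]

theorem theta_algebraMap_apply (c : ℂ) (p : Poly V) :
    Q.theta (algebraMap ℂ (Poly V) c) p = c • p := by
  rw [AlgHom.commutes, Module.algebraMap_end_apply]

theorem theta₁_trans (α : Module.Dual ℂ V) (v : V) (f : Poly V) :
    Q.theta₁ α (trans v f) = trans v (Q.theta₁ α f) := by
  induction f using SymmetricAlgebra.induction with
  | algebraMap c => rw [AlgHom.commutes, theta₁_algebraMap, map_zero]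
  | ι β => rw [trans_lin, map_add, theta₁_algebraMap, theta₁_lin, add_zero, AlgHom.commutes]
  | mul a b ha hb => rw [map_mul, theta₁_mul, theta₁_mul, map_add, map_mul, map_mul, ha, hb]
  | add a b ha hb => simp only [map_add, ha, hb]

theorem theta_trans (f : Poly V) (v : V) (p : Poly V) :
    Q.theta f (trans v p) = trans v (Q.theta f p) := by
  induction f using SymmetricAlgebra.induction generalizing p with
  | algebraMap c => rw [theta_algebraMap_apply, theta_algebraMap_apply, map_smul]
  | ι β => rw [theta_lin, theta₁_trans]
  | mul a b ha hb => rw [theta_mul_apply, theta_mul_apply, hb, ha]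
  | add a b ha hb => rw [map_add, LinearMap.add_apply, LinearMap.add_apply, ha, hb, map_add]

/-- The Heisenberg relation [Θ(g), α] = Θ(∂_α g). At the origin it makes multiplication by α adjoint
to ∂_α in the second argument. -/
theorem theta_lin_mul (g : Poly V) (α : Module.Dual ℂ V) (f : Poly V) :
    Q.theta g (lin α * f) = lin α * Q.theta g f + Q.theta (Q.theta₁ α g) f := by
  induction g using SymmetricAlgebra.induction generalizing f with
  | algebraMap c =>
    rw [theta_algebraMap_apply, theta_algebraMap_apply, theta₁_algebraMap, map_zero,
      LinearMap.zero_apply, add_zero, mul_smul_comm]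
  | ι β =>
    rw [theta_lin, theta₁_mul, theta₁_lin, theta₁_lin, theta_algebraMap_apply, dualForm_comm,
      Algebra.smul_def]
  | mul a b ha hb =>
    rw [theta_mul_apply, theta_mul_apply, hb, map_add, ha, theta₁_mul, map_add,
      LinearMap.add_apply, theta_mul_apply, theta_mul_apply]
    ring
  | add a b ha hb =>
    simp only [map_add, LinearMap.add_apply, ha, hb]
    ring

theorem theta_one_apply (g : Poly V) : Q.theta g 1 = algebraMap ℂ (Poly V) (evalAt 0 g) := by
  induction g using poly_induction with
  | one =>
    rw [map_one Q.theta, map_one (evalAt 0), map_one (algebraMap ℂ (Poly V)), Module.End.one_apply]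
  | smul c f hf => rw [map_smul, LinearMap.smul_apply, hf, map_smul, smul_eq_mul, map_mul,
      Algebra.smul_def]
  | add f g hf hg => rw [map_add, LinearMap.add_apply, hf, hg, map_add, map_add]
  | lin_mul α f hf =>
    rw [theta_mul_apply, hf, theta_lin, theta₁_algebraMap, map_mul, evalAt_lin, map_zero, zero_mul,
      map_zero]

/-- The pairing `(f, g)_Θ` as a bilinear map. -/
def pairingHom : Poly V →ₗ[ℂ] Poly V →ₗ[ℂ] ℂ :=
  LinearMap.mk₂ ℂ Q.pairing
    (fun a b c => by simp [pairing]) (fun a b c => by simp [pairing])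
    (fun a b c => by simp [pairing]) (fun a b c => by simp [pairing])

theorem pairingHom_apply (f g : Poly V) : Q.pairingHom f g = Q.pairing f g := rfl

theorem pairing_lin_mul_left (α : Module.Dual ℂ V) (f g : Poly V) :
    Q.pairing (lin α * f) g = Q.pairing f (Q.theta₁ α g) := by
  rw [pairing, mul_comm, theta_mul_apply, theta_lin, pairing]

theorem pairing_lin_mul_right (α : Module.Dual ℂ V) (f g : Poly V) :
    Q.pairing g (lin α * f) = Q.pairing (Q.theta₁ α g) f := by
  rw [pairing, theta_lin_mul, map_add, map_mul, evalAt_lin, map_zero, zero_mul, zero_add, pairing]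

theorem pairing_one_left (g : Poly V) : Q.pairing 1 g = evalAt 0 g := by
  rw [pairing, map_one]; rfl

/-- Multiplication by α is adjoint to ∂_α in either argument, so linear factors can be moved across
one at a time. -/
theorem pairing_comm (f g : Poly V) : Q.pairing f g = Q.pairing g f := by
  induction f using poly_induction generalizing g with
  | one => rw [pairing_one_left, pairing, theta_one_apply, AlgHom.commutes]; rfl
  | smul c f hf =>
    rw [← pairingHom_apply, ← pairingHom_apply, map_smul, map_smul, LinearMap.smul_apply,
      pairingHom_apply, hf, pairingHom_apply]
  | add a b ha hb =>
    rw [← pairingHom_apply, ← pairingHom_apply, map_add, map_add, LinearMap.add_apply,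
      pairingHom_apply, pairingHom_apply, ha, hb, pairingHom_apply, pairingHom_apply]
  | lin_mul α f hf => rw [pairing_lin_mul_left, pairing_lin_mul_right, hf]

/-- The Euler operator on polynomial functions. -/
def euler : Poly V →ₗ[ℂ] Poly V :=
  ∑ i, LinearMap.mulLeft ℂ (lin ((Module.finBasis ℂ V).coord i)) ∘ₗ
    Q.theta₁ (Q.form.toDual Q.nondeg (Module.finBasis ℂ V i))

theorem euler_apply (f : Poly V) : Q.euler f = ∑ i, lin ((Module.finBasis ℂ V).coord i) *
    Q.theta₁ (Q.form.toDual Q.nondeg (Module.finBasis ℂ V i)) f := by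
  simp [euler, LinearMap.sum_apply]

theorem euler_mul (f g : Poly V) : Q.euler (f * g) = f * Q.euler g + Q.euler f * g := by
  simp only [euler_apply, theta₁_mul, Finset.mul_sum, Finset.sum_mul, ← Finset.sum_add_distrib]
  exact Finset.sum_congr rfl fun i _ => by ring

theorem euler_lin (α : Module.Dual ℂ V) : Q.euler (lin α) = lin α := by
  rw [euler_apply]
  simp only [theta₁_lin, dualForm_eq, vec, LinearEquiv.symm_apply_apply, mul_comm (lin _),
    ← Algebra.smul_def, ← lin_smul]
  rw [← map_sum]
  congr 1
  ext x
  have := congrArg α ((Module.finBasis ℂ V).sum_repr x)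
  simp only [map_sum, map_smul, smul_eq_mul] at this
  simp only [LinearMap.sum_apply, LinearMap.smul_apply, Module.Basis.coord_apply, smul_eq_mul]
  rw [← this]
  exact Finset.sum_congr rfl fun i _ => mul_comm _ _

theorem euler_one : Q.euler 1 = 0 := by
  have : ∀ α, Q.theta₁ α 1 = 0 := fun α => by
    rw [← map_one (algebraMap ℂ (Poly V)), theta₁_algebraMap]
  simp [euler_apply, this]

theorem euler_mem (f : Poly V) : Q.euler f ∈ maxIdeal (0 : V) := by
  rw [euler_apply]
  exact sum_mem fun i _ => Ideal.mul_mem_right _ _ (lin_mem_maxIdeal _)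

theorem euler_sub_mem {f : Poly V} (hf : f ∈ maxIdeal (0 : V)) :
    Q.euler f - f ∈ maxIdeal (0 : V) ^ 2 := by
  have : ∀ f : Poly V, Q.euler f - (f - algebraMap ℂ _ (evalAt 0 f)) ∈ maxIdeal (0 : V) ^ 2 := by
    intro f
    induction f using poly_induction with
    | one => simp [euler_one]
    | smul c f hf =>
      have := Ideal.mul_mem_left _ (algebraMap ℂ (Poly V) c) hf
      convert this using 1
      rw [map_smul, map_smul, smul_eq_mul, map_mul, Algebra.smul_def, Algebra.smul_def]
      ring
    | add f g hf hg =>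
      convert add_mem hf hg using 1
      simp only [map_add]
      ring
    | lin_mul α f hf =>
      rw [euler_mul, euler_lin, map_mul, evalAt_lin, map_zero, zero_mul, map_zero, sub_zero,
        add_sub_cancel_right, pow_two]
      exact Ideal.mul_mem_mul (lin_mem_maxIdeal α) (Q.euler_mem f)
  have h := this f
  rwa [mem_maxIdeal.1 hf, map_zero, sub_zero] at h

/-- The Euler operator is a derivation inducing the identity on 𝔪/𝔪², hence multiplication by k on
𝔪^k/𝔪^(k+1). -/
theorem euler_sub_smul_mem {k : ℕ} {f : Poly V} (hf : f ∈ maxIdeal (0 : V) ^ k) :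
    Q.euler f - (k : ℂ) • f ∈ maxIdeal (0 : V) ^ (k + 1) := by
  induction k generalizing f with
  | zero => simpa using Q.euler_mem f
  | succ k ih =>
    rw [pow_succ'] at hf
    induction hf using Submodule.mul_induction_on' with
    | mem_mul_mem a ha b hb =>
      have h1 : a * (Q.euler b - (k : ℂ) • b) ∈ maxIdeal (0 : V) ^ (k + 1 + 1) := by
        rw [pow_succ' _ (k + 1)]
        exact Ideal.mul_mem_mul ha (ih hb)
      have h2 : (Q.euler a - a) * b ∈ maxIdeal (0 : V) ^ (k + 1 + 1) := by
        rw [show k + 1 + 1 = 2 + k by ring, pow_add]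
        exact Ideal.mul_mem_mul (Q.euler_sub_mem ha) hb
      convert add_mem h1 h2 using 1
      rw [euler_mul]
      push_cast
      simp only [Algebra.smul_def, map_add, map_one]
      ring
    | add a _ b _ ha hb =>
      convert add_mem ha hb using 1
      rw [map_add, smul_add]
      ring

/-- In characteristic zero the eigenvalue j + 1 on 𝔪^(j+1)/𝔪^(j+2) is invertible, so f climbs
through the powers one at a time. -/
theorem mem_maxIdeal_pow_of_euler {k : ℕ} {f : Poly V} (h0 : f ∈ maxIdeal (0 : V))
    (h : Q.euler f ∈ maxIdeal (0 : V) ^ (k + 1)) : f ∈ maxIdeal (0 : V) ^ (k + 1) := by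
  have : ∀ j ≤ k, f ∈ maxIdeal (0 : V) ^ (j + 1) := by
    intro j hj
    induction j with
    | zero => simpa using h0
    | succ j ih =>
      have h1 := Q.euler_sub_smul_mem (ih (by omega))
      have h2 := sub_mem (Ideal.pow_le_pow_right (show j + 1 + 1 ≤ k + 1 by omega) h) h1
      rw [sub_sub_cancel] at h2
      have hne : ((j + 1 : ℕ) : ℂ) ≠ 0 := Nat.cast_ne_zero.2 (by omega)
      have h3 := Ideal.mul_mem_left _ (algebraMap ℂ (Poly V) ((j + 1 : ℕ) : ℂ)⁻¹) h2
      rwa [← Algebra.smul_def, smul_smul, inv_mul_cancel₀ hne, one_smul] at h3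
  exact this k le_rfl

/-- A polynomial function whose derivatives of order at most `k` vanish at the origin. -/
theorem mem_maxIdeal_pow_of_pairing {k : ℕ} {f : Poly V}
    (h : ∀ p ∈ affine V ^ k, Q.pairing p f = 0) : f ∈ maxIdeal (0 : V) ^ (k + 1) := by
  induction k generalizing f with
  | zero =>
    rw [zero_add, pow_one, mem_maxIdeal, ← Q.pairing_one_left]
    exact h 1 (one_mem_affine_pow 0)
  | succ k ih =>
    apply Q.mem_maxIdeal_pow_of_euler
    · rw [mem_maxIdeal, ← Q.pairing_one_left]
      exact h 1 (one_mem_affine_pow _)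
    · rw [euler_apply]
      refine sum_mem fun i _ => ?_
      rw [pow_succ']
      refine Ideal.mul_mem_mul (lin_mem_maxIdeal _) (ih fun p hp => ?_)
      rw [← pairing_lin_mul_left]
      apply h
      rw [pow_succ']
      exact Submodule.mul_mem_mul (lin_mem_affine _) hp

/-- Pairings with polynomials of degree at most k form a finite-dimensional space of functionals
whose common kernel lies in 𝔪^(k+1). Such a space contains every functional vanishing on its common
kernel. -/
theorem exists_pairing_eq (k : ℕ) (L : Poly V →ₗ[ℂ] ℂ)
    (hL : ∀ f ∈ maxIdeal (0 : V) ^ (k + 1), L f = 0) :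
    ∃ p, ∀ f, Q.pairing p f = L f := by
  let F : Submodule ℂ (Module.Dual ℂ (Poly V)) := (affine V ^ k).map Q.pairingHom
  have hmem : L ∈ F.dualCoannihilator.dualAnnihilator := by
    rw [Submodule.mem_dualAnnihilator]
    intro f hf
    rw [Submodule.mem_dualCoannihilator] at hf
    exact hL f (Q.mem_maxIdeal_pow_of_pairing fun p hp => hf _ ⟨p, hp, rfl⟩)
  rw [Subspace.dualCoannihilator_dualAnnihilator_eq] at hmem
  obtain ⟨p, -, hp⟩ := hmem
  exact ⟨p, fun f => by rw [← hp, pairingHom_apply]⟩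

theorem nablaHom_mem_affine_pow {α : Module.Dual ℂ V} (hα : α ≠ 0) {k : ℕ} {f : Poly V}
    (hf : f ∈ affine V ^ (k + 1)) : Q.nablaHom α f ∈ affine V ^ k := by
  have key : ∀ f ∈ affine V, ∃ c, Q.nablaHom α f = algebraMap ℂ _ c := by
    intro f hf
    obtain ⟨c, β, rfl⟩ := exists_of_mem_affine hf
    exact ⟨_, by rw [map_add, nablaHom_algebraMap _ hα, nablaHom_lin _ hα, zero_add]⟩
  induction k generalizing f with
  | zero =>
    rw [zero_add, pow_one] at hf
    obtain ⟨c, hc⟩ := key f hf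
    rw [hc, pow_zero]
    exact Submodule.mem_one.2 ⟨c, rfl⟩
  | succ k ih =>
    rw [pow_succ'] at hf
    induction hf using Submodule.mul_induction_on' with
    | mem_mul_mem a ha b hb =>
      obtain ⟨c, hc⟩ := key a ha
      rw [nablaHom_mul _ hα, hc, ← Algebra.smul_def]
      refine add_mem (Submodule.smul_mem _ _ hb) ?_
      rw [pow_succ']
      exact Submodule.mul_mem_mul (act_mem_affine ha) (ih hb)
    | add a _ b _ ha hb => rw [map_add]; exact add_mem ha hb

theorem dd_mem_affine_pow {l : List (Module.Dual ℂ V)} (hl : ∀ α ∈ l, α ≠ 0) {k : ℕ}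
    {f : Poly V} (hf : f ∈ affine V ^ (k + l.length)) : Q.dd l f ∈ affine V ^ k := by
  induction l generalizing k with
  | nil => exact hf
  | cons a l ih =>
    rw [dd_cons]
    apply Q.nablaHom_mem_affine_pow (hl a (by simp))
    refine ih (fun α hα => hl α (by simp [hα])) ?_
    rwa [List.length_cons, add_comm l.length, ← add_assoc] at hf

end InnerForm

/-! ### Stabilizers of points and positive systems of vanishing roots. -/

/-- The real functional `β ↦ Re (c · β(v))` on `V^*`. -/
def reAt (c : ℂ) (v : V) : Module.Dual ℂ V →ₗ[ℝ] ℝ :=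
  Complex.reLm ∘ₗ ((c • Module.Dual.eval ℂ V v : Module.Dual ℂ V →ₗ[ℂ] ℂ).restrictScalars ℝ)

theorem reAt_apply (c : ℂ) (v : V) (β : Module.Dual ℂ V) : reAt c v β = (c * β v).re := rfl

/-- Any real functional f on ℂ is z ↦ Re(cz) with c = f(1) - f(i)i, and some f is nonzero on the
finitely many nonzero values β(v). -/
theorem exists_reAt_ne_zero (R : Finset (Module.Dual ℂ V)) (v : V) :
    ∃ c : ℂ, ∀ β ∈ R, β v ≠ 0 → reAt c v β ≠ 0 := by
  obtain ⟨f, hf⟩ := Module.exists_dual_forall_apply_ne_zero (K := ℝ) (M := ℂ)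
    (fun β : {β : R // β.1 v ≠ 0} => β.1.1 v) (fun β => β.2)
  refine ⟨f 1 - f Complex.I * Complex.I, fun β hβ hne => ?_⟩
  have h1 := hf ⟨⟨β, hβ⟩, hne⟩
  have h2 : f (β v) = (β v).re * f 1 + (β v).im * f Complex.I := by
    conv_lhs => rw [← Complex.re_add_im (β v)]
    have e1 : ((β v).re : ℂ) = (β v).re • (1 : ℂ) := by simp
    have e2 : ((β v).im : ℂ) * Complex.I = (β v).im • Complex.I := by simp
    rw [map_add, e2, map_smul]
    nth_rw 1 [e1]
    rw [map_smul]
    rfl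
  rw [reAt_apply]
  simp only at h1
  rw [h2] at h1
  simp [Complex.mul_re]
  intro H
  apply h1
  linarith

namespace InnerForm

variable [FiniteDimensional ℂ V] {Q : InnerForm V} {R Δ : Finset (Module.Dual ℂ V)}
  {h : Module.Dual ℂ V →ₗ[ℝ] ℝ}

namespace PosSys

/-- Steinberg's fixed point theorem: the stabilizer of a point is generated by the reflections
which it contains. -/
theorem steinberg (P : Q.PosSys R Δ h) {v : V} {w : V ≃ₗ[ℂ] V} (hw : w ∈ Q.weyl R)
    (hwv : w v = v) : w ∈ Subgroup.closure {g | ∃ β ∈ R, β v = 0 ∧ g = Q.s β} := by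
  classical
  -- the case of a dominant point
  have dom : ∀ (c : ℂ) (x : V), (∀ β ∈ R, β x ≠ 0 → reAt c x β ≠ 0) → (∀ δ ∈ Δ, 0 ≤ reAt c x δ) →
      ∀ w ∈ Q.weyl R, w x = x → w ∈ Subgroup.closure {g | ∃ β ∈ R, β x = 0 ∧ g = Q.s β} := by
    intro c x hc hx w hw hwx
    induction hn : len R h w using Nat.strong_induction_on generalizing w with
    | _ n ih =>
      by_cases hn0 : n = 0
      · rw [P.eq_one_of_len hw (hn.trans hn0)]; exact one_mem _
      obtain ⟨δ, hδ, hneg⟩ := P.exists_neg (g := w) (by omega)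
      have hval : cact w δ x = δ x := by
        conv_lhs => rw [← hwx]
        rw [cact_apply_apply]
      have hm := P.root.cact_mem hw (P.sub hδ)
      have h1 : 0 ≤ reAt c x (-cact w δ) :=
        (P.cone _ (P.root.neg_mem hm) (by rw [map_neg]; linarith)).map_nonneg hx
      have h2 : reAt c x (cact w δ) = reAt c x δ := by rw [reAt_apply, reAt_apply, hval]
      -- Since wδ is negative and x is dominant, Re(c δ(x)) is both nonnegative and nonpositive; by
      -- the choice of c this forces δ(x) = 0, and s_δ can be split off from w.
      have h0 : δ x = 0 := by
        by_contra hne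
        apply hc δ (P.sub hδ) hne
        rw [map_neg, h2] at h1
        linarith [hx δ hδ]
      have hlen := P.len_mul_s_of_neg hδ hneg
      have := ih (len R h (w * Q.s δ)) (by omega) (w * Q.s δ)
        (mul_mem hw (Q.s_mem_weyl (P.sub hδ)))
        (by rw [LinearEquiv.mul_apply, Q.s_apply_eq_self h0, hwx]) rfl
      rw [← Q.mul_s_mul_s w δ]
      exact mul_mem this (Subgroup.subset_closure ⟨δ, P.sub hδ, h0, rfl⟩)
  obtain ⟨c, hc⟩ := exists_reAt_ne_zero R v
  -- a dominant point in the orbit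
  obtain ⟨u, hu, hdom⟩ : ∃ u ∈ Q.weyl R, ∀ δ ∈ Δ, 0 ≤ reAt c v (cact u δ) := by
    -- Minimize the number of positive roots with negative value: a simple root with negative value
    -- would allow one further reduction.
    have hex : ∃ n, ∃ u ∈ Q.weyl R, (negSet R h (shift (reAt c v) u)).card = n :=
      ⟨_, 1, one_mem _, rfl⟩
    obtain ⟨u, hu, hn⟩ := Nat.find_spec hex
    refine ⟨u, hu, fun δ hδ => ?_⟩
    by_contra! hlt
    have h1 := P.card_negSet_shift (k := shift (reAt c v) u) hδ hlt
    rw [← shift_mul] at h1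
    have h2 := Nat.find_min' hex ⟨u * Q.s δ, mul_mem hu (Q.s_mem_weyl (P.sub hδ)), rfl⟩
    omega
  have key := dom c (u⁻¹ v) (fun β hβ hne => by
      have := hc (cact u β) (P.root.cact_mem hu hβ) hne
      exact this) hdom (u⁻¹ * w * u) (mul_mem (mul_mem (inv_mem hu) hw) hu) (by
      rw [LinearEquiv.mul_apply, LinearEquiv.mul_apply, ← LinearEquiv.mul_apply u,
        mul_inv_cancel]
      change u⁻¹ (w v) = _
      rw [hwv])
  have hconj : ∀ g ∈ Subgroup.closure {g | ∃ β ∈ R, β (u⁻¹ v) = 0 ∧ g = Q.s β},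
      u * g * u⁻¹ ∈ Subgroup.closure {g | ∃ β ∈ R, β v = 0 ∧ g = Q.s β} := by
    intro g hg
    induction hg using Subgroup.closure_induction with
    | mem g hg =>
      obtain ⟨β, hβ, h0, rfl⟩ := hg
      exact Subgroup.subset_closure ⟨cact u β, P.root.cact_mem hu hβ, h0,
        (Q.s_cact (Q.weyl_le_orth R hu) β).symm⟩
    | one => rw [mul_one, mul_inv_cancel]; exact one_mem _
    | mul a b _ _ ha hb =>
      have := mul_mem ha hb
      simpa [mul_assoc] using this
    | inv a _ ha =>
      have := inv_mem ha
      simpa [mul_assoc] using this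
  have := hconj _ key
  simpa [mul_assoc] using this

end PosSys

/-- The roots vanishing at `v`. -/
def vanishing (R : Finset (Module.Dual ℂ V)) (v : V) : Finset (Module.Dual ℂ V) :=
  open Classical in R.filter fun β => β v = 0

theorem mem_vanishing {v : V} {β : Module.Dual ℂ V} : β ∈ vanishing R v ↔ β ∈ R ∧ β v = 0 := by
  simp [vanishing]

theorem PosSys.mem_weyl_vanishing (P : Q.PosSys R Δ h) {v : V} {w : V ≃ₗ[ℂ] V}
    (hw : w ∈ Q.weyl R) (hwv : w v = v) : w ∈ Q.weyl (vanishing R v) := by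
  have := P.steinberg hw hwv
  rw [weyl_eq_closure]
  refine Subgroup.closure_mono ?_ this
  rintro _ ⟨β, hβ, h0, rfl⟩
  exact ⟨β, mem_vanishing.2 ⟨hβ, h0⟩, rfl⟩

/-- A subset of a root system closed under its reflections is a root system. -/
theorem IsRootSystem.of_subset (hR : Q.IsRootSystem R) {S : Finset (Module.Dual ℂ V)} (hS : S ⊆ R)
    (hclosed : ∀ α ∈ S, ∀ β ∈ S, cact (Q.s α) β ∈ S) : Q.IsRootSystem S where
  nonisotropic α hα := hR.nonisotropic α (hS hα)
  inter_line α hα := by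
    apply Set.Subset.antisymm
    · rintro β ⟨hβ, c, rfl⟩
      exact hR.eq_or_eq_neg (hS hα) (hS hβ)
    · rintro β (rfl | rfl)
      · exact ⟨hα, 1, by simp⟩
      · refine ⟨?_, -1, by simp⟩
        rw [← Q.cact_s_self (hR.nonisotropic α (hS hα))]
        exact hclosed α hα α hα
  refl_mem α hα β hβ := hclosed α hα β hβ

theorem IsRootSystem.isRootSystem_vanishing (hR : Q.IsRootSystem R) (v : V) :
    Q.IsRootSystem (vanishing R v) := by
  refine hR.of_subset (Finset.filter_subset _ _) fun α hα β hβ => ?_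
  obtain ⟨a, a0⟩ := mem_vanishing.1 hα
  obtain ⟨b, b0⟩ := mem_vanishing.1 hβ
  refine mem_vanishing.2 ⟨hR.cact_mem (Q.s_mem_weyl a) b, ?_⟩
  rw [cact_s]
  simp [a0, b0]

/-! ### Positive systems of a base and of a standard point -/

/-- A real functional on `V^*` taking the value one on a linearly independent set. -/
theorem exists_height {Ω : Finset (Module.Dual ℂ V)}
    (hli : LinearIndependent ℂ (fun α : Ω => (α : Module.Dual ℂ V))) (k : Ω → ℂ) :
    ∃ f : Module.Dual ℂ V →ₗ[ℂ] ℂ, ∀ α : Ω, f α = k α := by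
  obtain ⟨f, hf⟩ := LinearMap.exists_extend ((Module.Basis.span hli).constr ℂ k)
  refine ⟨f, fun α => ?_⟩
  have := DFunLike.congr_fun hf (Module.Basis.span hli α)
  rw [Module.Basis.constr_basis] at this
  rw [← this, LinearMap.comp_apply, Submodule.subtype_apply, Module.Basis.span_apply]

/-- The functional is the height: the sum of the coefficients with respect to Ω. -/
theorem exists_posSys_of_base {Ψ Ω : Finset (Module.Dual ℂ V)} (hΨ : Q.IsRootSystem Ψ)
    (hΩ : IsBase Ψ Ω) : ∃ h, Q.PosSys Ψ Ω h := by
  classical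
  obtain ⟨f, hf⟩ := exists_height hΩ.linearIndependent 1
  have hcoord : ∀ δ : Ω, ∃ k : Module.Dual ℂ V →ₗ[ℂ] ℂ, ∀ α : Ω, k α = if α = δ then 1 else 0 :=
    fun δ => exists_height hΩ.linearIndependent _
  choose k hk using hcoord
  let h : Module.Dual ℂ V →ₗ[ℝ] ℝ := Complex.reLm ∘ₗ f.restrictScalars ℝ
  have hh : ∀ δ ∈ Ω, h δ = 1 := fun δ hδ => by
    change (f δ).re = 1
    rw [hf ⟨δ, hδ⟩]; simp
  have hpos : ∀ β, IsNonneg Ω β → 0 ≤ h β := fun β hβ =>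
    hβ.map_nonneg fun δ hδ => by rw [hh δ hδ]; exact zero_le_one
  -- real coordinates
  have hkval : ∀ (c : Module.Dual ℂ V → ℝ) (δ : Ω), k δ (∑ α ∈ Ω, (c α : ℂ) • α) = c δ := by
    intro c δ
    rw [map_sum, Finset.sum_eq_single δ.1]
    · rw [map_smul, hk δ δ, if_pos rfl]; simp
    · intro α hα hne
      rw [map_smul, hk δ ⟨α, hα⟩, if_neg (fun H => hne (congrArg Subtype.val H)), smul_zero]
    · intro H; exact absurd δ.2 H
  have hsum : ∀ c : Module.Dual ℂ V → ℝ, h (∑ α ∈ Ω, (c α : ℂ) • α) = ∑ α ∈ Ω, c α := by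
    intro c
    rw [map_sum]
    refine Finset.sum_congr rfl fun α hα => ?_
    rw [Complex.coe_smul, map_smul, hh α hα, smul_eq_mul, mul_one]
  have hstrict : ∀ β ∈ Ψ, IsNonneg Ω β → 0 < h β := by
    rintro β hβ ⟨c, hc, rfl⟩
    rw [hsum]
    refine lt_of_le_of_ne (Finset.sum_nonneg hc) fun H => ?_
    apply hΨ.ne_zero hβ
    rw [eq_comm, Finset.sum_eq_zero_iff_of_nonneg hc] at H
    exact Finset.sum_eq_zero fun α hα => by rw [H α hα]; simp
  have hne : ∀ β ∈ Ψ, h β ≠ 0 := by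
    intro β hβ
    rcases hΩ.nonneg_or β hβ with H | H
    · exact (hstrict β hβ H).ne'
    · have := hstrict _ (hΨ.neg_mem hβ) H
      rw [map_neg] at this
      linarith
  have hcone : ∀ β ∈ Ψ, 0 < h β → IsNonneg Ω β := by
    intro β hβ hp
    rcases hΩ.nonneg_or β hβ with H | H
    · exact H
    · have := hpos _ H
      rw [map_neg] at this
      linarith
  refine ⟨h, hΨ, hne, hΩ.subset, fun δ hδ => by rw [hh δ hδ]; exact one_pos, hcone, ?_⟩
  intro δ hδ β hβ hp hβδ
  obtain ⟨c, hc, hcβ⟩ := hcone β hβ hp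
  -- A positive root other than δ is not a multiple of δ, so it involves another simple root γ. s_δ
  -- leaves that coefficient unchanged, and one positive coefficient decides the sign.
  obtain ⟨γ, hγ, hγδ, hcγ⟩ : ∃ γ ∈ Ω, γ ≠ δ ∧ 0 < c γ := by
    by_contra! H
    have hβ' : β = (c δ : ℂ) • δ := by
      rw [hcβ, Finset.sum_eq_single δ]
      · intro α hα hne
        rw [le_antisymm (H α hα hne) (hc α hα)]; simp
      · intro H; exact absurd hδ H
    have h1 := hΨ.eq_or_eq_neg (hΩ.subset hδ) (c := (c δ : ℂ)) (hβ' ▸ hβ)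
    rw [← hβ'] at h1
    rcases h1 with h1 | h1
    · exact hβδ h1
    · rw [h1, map_neg, hh δ hδ] at hp
      linarith
  have hm : cact (Q.s δ) β ∈ Ψ := hΨ.cact_mem (Q.s_mem_weyl (hΩ.subset hδ)) hβ
  have hkβ : k ⟨γ, hγ⟩ (cact (Q.s δ) β) = c γ := by
    rw [cact_s, map_sub, map_smul, hk ⟨γ, hγ⟩ ⟨δ, hδ⟩, if_neg, smul_zero, sub_zero]
    · conv_lhs => rw [hcβ]
      exact hkval c ⟨γ, hγ⟩
    · intro H; exact hγδ (congrArg Subtype.val H).symm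
  rcases hΩ.nonneg_or _ hm with H | H
  · exact hstrict _ hm H
  · exfalso
    obtain ⟨d, hd, hdβ⟩ := H
    have h2 := hkval d ⟨γ, hγ⟩
    rw [← hdβ, map_neg, hkβ] at h2
    have h3 : -c γ = d γ := by exact_mod_cast h2
    linarith [hd γ hγ]

/-- The roots vanishing at a standard point have a positive system whose simple roots are simple. -/
theorem exists_posSys_vanishing {Ψ Ω : Finset (Module.Dual ℂ V)} (hΩ : IsBase Ψ Ω)
    (P : Q.PosSys Ψ Ω h) {v : V} (hv : Q.IsStandard Ψ Ω v) :
    ∃ θ ⊆ Ω, Q.PosSys (vanishing Ψ v) θ h := by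
  classical
  obtain ⟨θ, hθ, hgen⟩ := hv
  have hθv : ∀ δ ∈ θ, δ v = 0 := fun δ hδ =>
    (hgen δ (P.sub (hθ hδ))).2 fun Ψ' _ _ h' => h' hδ
  -- The roots of Ψ in the span of θ form a subsystem containing θ, so the subsystem generated by θ
  -- lies in that span. Coefficients outside θ then vanish, and the functional h of Ω also serves
  -- for θ.
  have hspan : ∀ β ∈ Ψ, β v = 0 → β ∈ Submodule.span ℂ (θ : Set (Module.Dual ℂ V)) := by
    intro β hβ h0
    have hS := (hgen β hβ).1 h0
      (Ψ.filter fun β => β ∈ Submodule.span ℂ (θ : Set (Module.Dual ℂ V)))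
      (Finset.filter_subset _ _) (P.root.of_subset (Finset.filter_subset _ _) ?_) ?_
    · exact (Finset.mem_filter.1 hS).2
    · intro α hα β hβ
      rw [Finset.mem_filter] at hα hβ ⊢
      refine ⟨P.root.cact_mem (Q.s_mem_weyl hα.1) hβ.1, ?_⟩
      rw [cact_s]
      exact sub_mem hβ.2 (Submodule.smul_mem _ _ hα.2)
    · intro δ hδ
      exact Finset.mem_filter.2 ⟨P.sub (hθ hδ), Submodule.subset_span hδ⟩
  refine ⟨θ, hθ, P.root.isRootSystem_vanishing v, fun β hβ => P.ne β (mem_vanishing.1 hβ).1,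
    fun δ hδ => mem_vanishing.2 ⟨P.sub (hθ hδ), hθv δ hδ⟩, fun δ hδ => P.pos δ (hθ hδ), ?_,
    fun δ hδ β hβ => P.simple δ (hθ hδ) β (mem_vanishing.1 hβ).1⟩
  intro β hβ hp
  obtain ⟨hβ, h0⟩ := mem_vanishing.1 hβ
  obtain ⟨c, hc, hcβ⟩ := P.cone β hβ hp
  refine ⟨c, fun α hα => hc α (hθ hα), ?_⟩
  rw [hcβ]
  refine (Finset.sum_subset hθ fun γ hγ hγθ => ?_).symm
  obtain ⟨k, hk⟩ := exists_height hΩ.linearIndependent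
    (fun α => if α = ⟨γ, hγ⟩ then 1 else 0)
  have h1 : k β = c γ := by
    rw [hcβ, map_sum, Finset.sum_eq_single γ]
    · rw [map_smul, hk ⟨γ, hγ⟩, if_pos rfl]; simp
    · intro α hα hne
      rw [map_smul, hk ⟨α, hα⟩, if_neg (fun H => hne (congrArg Subtype.val H)), smul_zero]
    · intro H; exact absurd hγ H
  have h2 : k β = 0 := by
    have : Submodule.span ℂ (θ : Set (Module.Dual ℂ V)) ≤ LinearMap.ker k := by
      rw [Submodule.span_le]
      intro δ hδ
      change k δ = 0
      rw [hk ⟨δ, hθ hδ⟩, if_neg]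
      intro H
      have e : δ = γ := congrArg Subtype.val H
      exact hγθ (e ▸ hδ)
    exact this (hspan β hβ h0)
  rw [← h1, h2, zero_smul]

end InnerForm

/-! ### Positive systems for arbitrary root systems, by rescaling. -/

namespace IsNonneg

variable {S : Finset (Module.Dual ℂ V)} {β γ : Module.Dual ℂ V}

theorem zero : IsNonneg S 0 := ⟨0, by simp, by simp⟩

theorem add (h : IsNonneg S β) (h' : IsNonneg S γ) : IsNonneg S (β + γ) := by
  obtain ⟨c, hc, rfl⟩ := h
  obtain ⟨d, hd, rfl⟩ := h'
  refine ⟨c + d, fun α hα => add_nonneg (hc α hα) (hd α hα), ?_⟩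
  simp [add_smul, Finset.sum_add_distrib]

theorem smul {a : ℝ} (ha : 0 ≤ a) (h : IsNonneg S β) : IsNonneg S ((a : ℂ) • β) := by
  obtain ⟨c, hc, rfl⟩ := h
  refine ⟨fun α => a * c α, fun α hα => mul_nonneg ha (hc α hα), ?_⟩
  rw [Finset.smul_sum]
  exact Finset.sum_congr rfl fun α _ => by rw [smul_smul, Complex.ofReal_mul]

theorem of_mem (h : β ∈ S) : IsNonneg S β := by
  classical
  refine ⟨fun α => if α = β then 1 else 0, fun α _ => by dsimp only; split_ifs <;> norm_num, ?_⟩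
  rw [Finset.sum_eq_single β]
  · simp
  · intro α _ hα; simp [hα]
  · intro H; exact absurd h H

theorem sum {ι : Type*} {s : Finset ι} {f : ι → Module.Dual ℂ V}
    (h : ∀ i ∈ s, IsNonneg S (f i)) : IsNonneg S (∑ i ∈ s, f i) := by
  classical
  induction s using Finset.induction_on with
  | empty => simpa using zero
  | insert a s ha ih =>
    rw [Finset.sum_insert ha]
    exact (h a (by simp)).add (ih fun i hi => h i (by simp [hi]))

theorem of_forall {T : Finset (Module.Dual ℂ V)} (h : IsNonneg S β)
    (hST : ∀ α ∈ S, IsNonneg T α) : IsNonneg T β := by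
  obtain ⟨c, hc, rfl⟩ := h
  exact sum fun α hα => (hST α hα).smul (hc α hα)

end IsNonneg

theorem exists_mul_self_mul_eq_one : ∃ r : ℂ → ℂ, ∀ z ≠ 0, r z * r z * z = 1 := by
  have : ∀ z : ℂ, ∃ w, z ≠ 0 → w * w * z = 1 := by
    intro z
    obtain ⟨w, hw⟩ := IsAlgClosed.exists_pow_nat_eq z⁻¹ (n := 2) (by norm_num)
    refine ⟨w, fun hz => ?_⟩
    rw [← pow_two, hw, inv_mul_cancel₀ hz]
  choose r hr using this
  exact ⟨r, hr⟩

/-- Applied with c = (α, β) and ζ an eigenvalue of s_α s_β on the span of α and β. As ζ⁻¹ is the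
conjugate of ζ, the equation gives c² = (1 + Re ζ)/2 ≥ 0, so c is real. -/
theorem im_eq_zero_of_root_of_unity {c ζ : ℂ} {n : ℕ} (hn : n ≠ 0) (hζ : ζ ^ n = 1)
    (h : ζ * ζ - (4 * c * c - 2) * ζ + 1 = 0) : c.im = 0 := by
  have hnorm : ‖ζ‖ = 1 := Complex.norm_eq_one_of_pow_eq_one hζ hn
  have hconj : ζ * (starRingEnd ℂ) ζ = 1 := by
    rw [Complex.mul_conj, Complex.normSq_eq_norm_sq, hnorm]; norm_num
  have hζ0 : ζ ≠ 0 := by rintro rfl; simp at hconj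
  have h1 : 4 * c * c - 2 = ζ + (starRingEnd ℂ) ζ := by
    apply mul_right_cancel₀ hζ0
    linear_combination -h - hconj
  rw [Complex.add_conj] at h1
  have hre := congrArg Complex.re h1
  have him := congrArg Complex.im h1
  simp [Complex.mul_re, Complex.mul_im] at hre him
  have hle : -1 ≤ ζ.re := by
    have := Complex.abs_re_le_norm ζ
    rw [hnorm] at this
    exact (abs_le.1 this).1
  by_contra hne
  have : c.re = 0 := by
    have : c.re * c.im = 0 := by linarith
    exact (mul_eq_zero.1 this).resolve_right hne
  rw [this] at hre
  have := mul_self_pos.2 hne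
  nlinarith

namespace InnerForm

variable [FiniteDimensional ℂ V] {Q : InnerForm V} {R : Finset (Module.Dual ℂ V)}

theorem IsRootSystem.exists_pow_cact (hR : Q.IsRootSystem R) {g : V ≃ₗ[ℂ] V}
    (hg : g ∈ Q.weyl R) {β : Module.Dual ℂ V} (hβ : β ∈ R) :
    ∃ n ≠ 0, cact (g ^ n) β = β := by
  obtain ⟨m, n, hmn, H⟩ := Finite.exists_ne_map_eq_of_infinite
    (fun n : ℕ => (⟨cact (g ^ n) β, hR.cact_mem (pow_mem hg n) hβ⟩ : R))
  replace H : cact (g ^ m) β = cact (g ^ n) β := congrArg Subtype.val H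
  wlog hlt : m < n generalizing m n
  · exact this n m hmn.symm H.symm (lt_of_le_of_ne (not_lt.1 hlt) hmn.symm)
  refine ⟨n - m, by omega, ?_⟩
  apply (cact (g ^ m)).injective
  rw [← cact_mul, ← pow_add, Nat.add_sub_cancel' hlt.le, H]

/-- Inner products of roots of length one are real. -/
theorem IsRootSystem.dualForm_im (hR : Q.IsRootSystem R) (h1 : ∀ α ∈ R, Q.dualForm α α = 1)
    {α β : Module.Dual ℂ V} (hα : α ∈ R) (hβ : β ∈ R) : (Q.dualForm α β).im = 0 := by
  set c := Q.dualForm α β with hc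
  have hc' : Q.dualForm β α = c := Q.dualForm_comm β α
  let g := Q.s α * Q.s β
  have hg : g ∈ Q.weyl R := mul_mem (Q.s_mem_weyl hα) (Q.s_mem_weyl hβ)
  have c1 : Q.copair α β = 2 * c := by rw [copair, h1 α hα, hc', div_one]
  have c2 : Q.copair β α = 2 * c := by rw [copair, h1 β hβ, div_one]
  have gα : cact g α = (4 * c * c - 1) • α - (2 * c) • β := by
    rw [cact_mul, cact_s _ β, c2, map_sub, map_smul, cact_s _ α β, c1,
      cact_s_self _ (hR.nonisotropic α hα)]
    module
  have gβ : cact g β = (2 * c) • α - β := by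
    rw [cact_mul, cact_s_self _ (hR.nonisotropic β hβ), map_neg, cact_s, c1]
    module
  obtain ⟨n, hn, hgn⟩ := hR.exists_pow_cact hg hα
  obtain ⟨ζ, hζ⟩ : ∃ ζ : ℂ, ζ * ζ - (4 * c * c - 2) * ζ + 1 = 0 := by
    obtain ⟨w, hw⟩ := IsAlgClosed.exists_pow_nat_eq ((4 * c * c - 2) ^ 2 - 4) (n := 2) (by norm_num)
    exact ⟨((4 * c * c - 2) + w) / 2, by linear_combination hw / 4⟩
  have hζ0 : ζ ≠ 0 := by rintro rfl; simp at hζ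
  have hζi : ζ * ζ⁻¹ = 1 := mul_inv_cancel₀ hζ0
  -- (g - ζ⁻¹)α is an eigenvector for ζ unless it is zero, in which case α is one for ζ⁻¹. A power
  -- of g fixes α, so ζ is a root of unity either way.
  let y := cact g α - ζ⁻¹ • α
  have hgy : cact g y = ζ • y := by
    have e : (4 * c * c - 2) = ζ + ζ⁻¹ := by
      apply mul_right_cancel₀ hζ0
      linear_combination -hζ - hζi
    have e2 : cact g (cact g α) = (4 * c * c - 2) • cact g α - α := by
      nth_rw 1 [gα]
      rw [map_sub, map_smul, map_smul, gα, gβ]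
      module
    simp only [y]
    rw [map_sub, map_smul, e2, e, smul_sub, smul_smul, hζi]
    module
  have hpow : ∀ (z : ℂ) (x : Module.Dual ℂ V), cact g x = z • x →
      ∀ n, cact (g ^ n) x = z ^ n • x := by
    intro z x hx n
    induction n with
    | zero => rw [pow_zero, cact_one, pow_zero, one_smul]
    | succ n ih => rw [pow_succ, cact_mul, hx, map_smul, ih, smul_smul, pow_succ, mul_comm]
  refine im_eq_zero_of_root_of_unity hn ?_ hζ
  by_cases hy : y = 0
  · have h2 := hpow ζ⁻¹ α (sub_eq_zero.1 hy) n
    rw [hgn] at h2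
    have h3 : (ζ⁻¹ ^ n - 1) • α = 0 := by rw [sub_smul, ← h2, one_smul, sub_self]
    have h4 := (smul_eq_zero.1 h3).resolve_right (hR.ne_zero hα)
    rw [inv_pow, sub_eq_zero, inv_eq_one] at h4
    exact h4
  · have h2 := hpow ζ y hgy n
    have h5 : cact (g ^ n) y = y := by
      simp only [y]
      rw [map_sub, map_smul, hgn, ← cact_mul, ← pow_succ, pow_succ', cact_mul, hgn]
    rw [h5] at h2
    have h3 : (ζ ^ n - 1) • y = 0 := by rw [sub_smul, ← h2, one_smul, sub_self]
    exact sub_eq_zero.1 ((smul_eq_zero.1 h3).resolve_right hy)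

/-- A root system with roots of length one has a positive system. -/
theorem IsRootSystem.exists_posSys (hR : Q.IsRootSystem R) (h1 : ∀ α ∈ R, Q.dualForm α α = 1) :
    ∃ Δ h, Q.PosSys R Δ h := by
  classical
  obtain ⟨h, hh⟩ := Module.exists_dual_forall_apply_ne_zero (K := ℝ) (fun β : R => β.1)
    (fun β => hR.ne_zero β.2)
  have hne : ∀ β ∈ R, h β ≠ 0 := fun β hβ => hh ⟨β, hβ⟩
  let P := R.filter fun β => 0 < h β
  -- Simple roots are a subset of least cardinality whose nonnegative combinations contain all
  -- positive roots.
  have hex : ∃ n, ∃ Δ ⊆ P, (∀ β ∈ P, IsNonneg Δ β) ∧ Δ.card = n :=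
    ⟨_, P, subset_rfl, fun β hβ => .of_mem hβ, rfl⟩
  obtain ⟨Δ, hΔ, hcone, hcard⟩ := Nat.find_spec hex
  have hmem : ∀ β, β ∈ P ↔ β ∈ R ∧ 0 < h β := fun β => by simp [P]
  refine ⟨Δ, h, hR, hne, fun δ hδ => ((hmem δ).1 (hΔ hδ)).1, fun δ hδ => ((hmem δ).1 (hΔ hδ)).2,
    fun β hβ hp => hcone β ((hmem β).2 ⟨hβ, hp⟩), ?_⟩
  intro δ hδ β hβ hp hβδ
  obtain ⟨hδR, hδp⟩ := (hmem δ).1 (hΔ hδ)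
  by_contra! hle
  have hm : cact (Q.s δ) β ∈ R := hR.cact_mem (Q.s_mem_weyl hδR) hβ
  have hlt : h (cact (Q.s δ) β) < 0 := lt_of_le_of_ne hle (hne _ hm)
  obtain ⟨b, hb, hbβ⟩ := hcone β ((hmem β).2 ⟨hβ, hp⟩)
  obtain ⟨b', hb', hbβ'⟩ := hcone (-cact (Q.s δ) β)
    ((hmem _).2 ⟨hR.neg_mem hm, by rw [map_neg]; linarith⟩)
  let x : ℝ := 2 * (Q.dualForm β δ).re
  have hx : Q.copair δ β = x := by
    rw [copair, h1 δ hδR, div_one]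
    apply Complex.ext
    · simp [x]
    · simp [x, hR.dualForm_im h1 hβ hδR]
  -- If β and -s_δ β are both positive, their sum is a real multiple of δ. Reality of the inner
  -- products is needed here, to compare coefficients by sign.
  have hsum : (x : ℂ) • δ = ∑ γ ∈ Δ, ((b γ + b' γ : ℝ) : ℂ) • γ := by
    have : (x : ℂ) • δ = β + -cact (Q.s δ) β := by rw [cact_s, hx]; module
    rw [this, hbβ']
    conv_lhs => rw [hbβ]
    rw [← Finset.sum_add_distrib]
    refine Finset.sum_congr rfl fun γ _ => ?_
    rw [Complex.ofReal_add, add_smul]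
  rw [← Finset.add_sum_erase _ _ hδ] at hsum
  -- A negative coefficient makes δ a nonnegative combination of the other elements of Δ, against
  -- minimality. Otherwise applying h kills all other coefficients, so β is proportional to δ.
  by_cases he : b δ + b' δ - x < 0
  · have hδcone : IsNonneg (Δ.erase δ) δ := by
      have h2 : IsNonneg (Δ.erase δ) (∑ γ ∈ Δ.erase δ, ((b γ + b' γ : ℝ) : ℂ) • γ) :=
        .sum fun γ hγ => (IsNonneg.of_mem hγ).smul
          (add_nonneg (hb γ (Finset.mem_of_mem_erase hγ)) (hb' γ (Finset.mem_of_mem_erase hγ)))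
      have h3 := h2.smul (a := (x - (b δ + b' δ))⁻¹) (by
        rw [inv_nonneg]; linarith)
      convert h3 using 1
      rw [← sub_eq_iff_eq_add'.2 hsum, ← sub_smul, ← Complex.ofReal_sub, smul_smul,
        ← Complex.ofReal_mul, inv_mul_cancel₀ (by linarith), Complex.ofReal_one, one_smul]
    have h4 := Nat.find_min' hex ⟨Δ.erase δ, (Finset.erase_subset _ _).trans hΔ, fun γ hγ =>
      (hcone γ hγ).of_forall fun α hα => by
        by_cases hαδ : α = δ
        · rw [hαδ]; exact hδcone
        · exact .of_mem (Finset.mem_erase.2 ⟨hαδ, hα⟩), rfl⟩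
    have := Finset.card_erase_lt_of_mem hδ
    omega
  · have h2 : (b δ + b' δ - x) * h δ + ∑ γ ∈ Δ.erase δ, (b γ + b' γ) * h γ = 0 := by
      have := congrArg h hsum
      simp only [map_add, map_sum, Complex.coe_smul, map_smul, smul_eq_mul] at this
      linarith
    have hnn : ∀ γ ∈ Δ.erase δ, 0 ≤ (b γ + b' γ) * h γ := fun γ hγ =>
      mul_nonneg (add_nonneg (hb γ (Finset.mem_of_mem_erase hγ))
        (hb' γ (Finset.mem_of_mem_erase hγ))) ((hmem γ).1 (hΔ (Finset.mem_of_mem_erase hγ))).2.le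
    have h3 : ∑ γ ∈ Δ.erase δ, (b γ + b' γ) * h γ = 0 := by
      apply le_antisymm _ (Finset.sum_nonneg hnn)
      have := mul_nonneg (not_lt.1 he) hδp.le
      linarith
    rw [Finset.sum_eq_zero_iff_of_nonneg hnn] at h3
    have hβ' : β = (b δ : ℂ) • δ := by
      rw [hbβ, Finset.sum_eq_single_of_mem δ hδ]
      intro γ hγ hγδ
      have h4 := h3 γ (Finset.mem_erase.2 ⟨hγδ, hγ⟩)
      have h5 := (mul_eq_zero.1 h4).resolve_right (((hmem γ).1 (hΔ hγ)).2.ne')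
      have h6 : b γ = 0 := by linarith [hb γ hγ, hb' γ hγ]
      rw [h6, Complex.ofReal_zero, zero_smul]
    rcases hR.eq_or_eq_neg hδR (c := (b δ : ℂ)) (hβ' ▸ hβ) with h4 | h4
    · exact hβδ (hβ'.trans h4)
    · rw [hβ', h4, map_neg] at hp
      linarith

/-- Every root system is equivalent, by rescaling the roots, to one with a positive system. -/
theorem IsRootSystem.exists_rescaled (hR : Q.IsRootSystem R) :
    ∃ R' Δ h, Q.PosSys R' Δ h ∧ Q.weyl R' = Q.weyl R ∧
      ∀ α ∈ R', ∃ c : ℂ, c ≠ 0 ∧ c • α ∈ R := by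
  classical
  obtain ⟨r, hr⟩ := exists_mul_self_mul_eq_one
  have hr0 : ∀ z ≠ 0, r z ≠ 0 := fun z hz H => by simpa [H] using hr z hz
  -- The factor depends only on (α, α), so α and -α are rescaled alike.
  let n : Module.Dual ℂ V → ℂ := fun α => r (Q.dualForm α α)
  have hn0 : ∀ α ∈ R, n α ≠ 0 := fun α hα => hr0 _ (hR.nonisotropic α hα)
  have hnneg : ∀ α, n (-α) = n α := fun α => by
    simp only [n]
    rw [dualForm_neg_left, dualForm_comm, dualForm_neg_left, neg_neg]
  let R' := R.image fun α => n α • α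
  have hs : ∀ α ∈ R, Q.s (n α • α) = Q.s α := fun α hα => Q.s_smul (hn0 α hα) α
  have hunit : ∀ α ∈ R', Q.dualForm α α = 1 := by
    intro α hα
    obtain ⟨β, hβ, rfl⟩ := Finset.mem_image.1 hα
    rw [dualForm_smul_left, dualForm_comm, dualForm_smul_left, ← mul_assoc]
    exact hr _ (hR.nonisotropic β hβ)
  have hR' : Q.IsRootSystem R' := by
    refine ⟨fun α hα => by rw [hunit α hα]; exact one_ne_zero, ?_, ?_⟩
    · intro α hα
      obtain ⟨α, hα', rfl⟩ := Finset.mem_image.1 hα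
      apply Set.Subset.antisymm
      · rintro _ ⟨hβ, c, hc⟩
        obtain ⟨β, hβ', rfl⟩ := Finset.mem_image.1 hβ
        have h2 : β = ((n β)⁻¹ * (c * n α)) • α := by
          rw [mul_smul, mul_smul, ← hc, smul_smul, inv_mul_cancel₀ (hn0 β hβ'), one_smul]
        rcases hR.eq_or_eq_neg hα' (h2 ▸ hβ') with h3 | h3
        · left; rw [h2, h3]
        · right
          rw [Set.mem_singleton_iff, h2, h3]
          rw [hnneg, smul_neg]
      · rintro β (rfl | rfl)
        · exact ⟨hα, 1, by simp⟩
        · refine ⟨Finset.mem_image.2 ⟨-α, hR.neg_mem hα', ?_⟩, -1, by simp⟩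
          rw [hnneg, smul_neg]
    · intro α hα β hβ
      obtain ⟨α, hα', rfl⟩ := Finset.mem_image.1 hα
      obtain ⟨β, hβ', rfl⟩ := Finset.mem_image.1 hβ
      rw [← cact_s_eq_dualMap, hs α hα', map_smul]
      refine Finset.mem_image.2 ⟨cact (Q.s α) β, hR.cact_mem (Q.s_mem_weyl hα') hβ', ?_⟩
      simp only [n]
      rw [Q.dualForm_cact (Q.s_mem_orth α)]
  obtain ⟨Δ, h, P⟩ := hR'.exists_posSys hunit
  refine ⟨R', Δ, h, P, le_antisymm ?_ ?_, ?_⟩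
  · refine Q.weyl_le fun α hα => ?_
    obtain ⟨β, hβ, rfl⟩ := Finset.mem_image.1 hα
    rw [hs β hβ]
    exact Q.s_mem_weyl hβ
  · refine Q.weyl_le fun α hα => ?_
    rw [← hs α hα]
    exact Q.s_mem_weyl (Finset.mem_image_of_mem _ hα)
  · intro α hα
    obtain ⟨β, hβ, rfl⟩ := Finset.mem_image.1 hα
    exact ⟨(n β)⁻¹, inv_ne_zero (hn0 β hβ), by
      rw [smul_smul, inv_mul_cancel₀ (hn0 β hβ), one_smul]; exact hβ⟩

theorem IsRootSystem.finite_weyl (hR : Q.IsRootSystem R) : Finite (Q.weyl R) := by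
  obtain ⟨R', Δ, h, P, hw, -⟩ := hR.exists_rescaled
  rw [← hw]
  exact P.finite

/-- Rescaling changes neither the reflections nor the hyperplanes of the roots, so Steinberg's
theorem carries over from the rescaled system. -/
theorem IsRootSystem.mem_weyl_vanishing (hR : Q.IsRootSystem R) {v : V} {g : V ≃ₗ[ℂ] V}
    (hg : g ∈ Q.weyl R) (hgv : g v = v) : g ∈ Q.weyl (vanishing R v) := by
  obtain ⟨R', Δ, h, P, hw, hc⟩ := hR.exists_rescaled
  rw [← hw] at hg
  refine Q.weyl_le (fun α hα => ?_) (P.mem_weyl_vanishing hg hgv)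
  obtain ⟨h1, h2⟩ := mem_vanishing.1 hα
  obtain ⟨c, hc0, hc1⟩ := hc α h1
  rw [← Q.s_smul hc0]
  exact Q.s_mem_weyl (mem_vanishing.2 ⟨hc1, by simp [h2]⟩)

end InnerForm

/-! ### Coefficient functionals, Schubert polynomials and the coinvariant ideal. -/

theorem exists_regular [FiniteDimensional ℂ V] (R : Finset (Module.Dual ℂ V))
    (hR : ∀ β ∈ R, β ≠ 0) : ∃ p : V, ∀ β ∈ R, β p ≠ 0 := by
  obtain ⟨p, hp⟩ := Module.Dual.exists_forall_ne_zero_of_forall_exists (K := ℂ)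
    (fun β : R => β.1) (fun β => by
      by_contra! H
      exact hR β β.2 (LinearMap.ext H))
  exact ⟨p, fun β hβ => hp ⟨β, hβ⟩⟩

namespace InnerForm

variable [FiniteDimensional ℂ V] {Q : InnerForm V} {R Δ : Finset (Module.Dual ℂ V)}
  {h : Module.Dual ℂ V →ₗ[ℝ] ℝ}

theorem act_mem_coinvIdeal {w : V ≃ₗ[ℂ] V} (hw : w ∈ Q.weyl R) {f : Poly V}
    (hf : f ∈ Q.coinvIdeal R) : act w f ∈ Q.coinvIdeal R := by
  have : (Q.coinvIdeal R).map (act w) ≤ Q.coinvIdeal R := by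
    rw [coinvIdeal, Ideal.map_span, Ideal.span_le]
    rintro _ ⟨g, hg, rfl⟩
    apply Ideal.subset_span
    change act w g ∈ {f | f ∈ Q.invariants R ∧ evalAt 0 f = 0}
    rwa [hg.1 w hw]
  exact this (Ideal.mem_map_of_mem (act w) hf)

variable (Q) in
/-- The coefficient functional `f ↦ (∂_σ f)(0)`. -/
def coef (Δ : Finset (Module.Dual ℂ V)) (σ : V ≃ₗ[ℂ] V) : Poly V →ₗ[ℂ] ℂ :=
  (evalAt 0).toLinearMap ∘ₗ Q.ddiff Δ σ

theorem coef_apply (σ : V ≃ₗ[ℂ] V) (f : Poly V) :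
    Q.coef Δ σ f = evalAt 0 (Q.ddiff Δ σ f) := rfl

variable (Q) in
/-- The longest element of the reflection group of `R`. -/
def w0 (R Δ : Finset (Module.Dual ℂ V)) : V ≃ₗ[ℂ] V := Q.longest Δ (Q.weyl R)

/-- The product of the positive roots. -/
def posProd (R Δ : Finset (Module.Dual ℂ V)) : Poly V := ∏ α ∈ posRoots R Δ, lin α

namespace PosSys

theorem w0_mem (P : Q.PosSys R Δ h) : Q.w0 R Δ ∈ Q.weyl R := P.longest_spec.1

theorem w0_neg (P : Q.PosSys R Δ h) : ∀ β ∈ R, 0 < h β → h (cact (Q.w0 R Δ) β) < 0 :=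
  P.longest_spec.2

theorem mem_posRoots (P : Q.PosSys R Δ h) {β : Module.Dual ℂ V} :
    β ∈ posRoots R Δ ↔ β ∈ R ∧ 0 < h β := by
  simp only [posRoots, Finset.mem_filter]
  refine and_congr_right fun hβ => ⟨fun H => ?_, P.cone β hβ⟩
  exact lt_of_le_of_ne (H.map_nonneg fun δ hδ => (P.pos δ hδ).le) (P.ne β hβ).symm

theorem inv_w0 (P : Q.PosSys R Δ h) : inv R h (Q.w0 R Δ) = posRoots R Δ := by
  ext β
  rw [mem_inv, P.mem_posRoots]
  exact ⟨fun H => ⟨H.1, H.2.1⟩, fun H => ⟨H.1, H.2, P.w0_neg β H.1 H.2⟩⟩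

theorem card_posRoots (P : Q.PosSys R Δ h) : (posRoots R Δ).card = len R h (Q.w0 R Δ) := by
  rw [len, P.inv_w0]

theorem len_le_w0 (P : Q.PosSys R Δ h) {g : V ≃ₗ[ℂ] V} (hg : g ∈ Q.weyl R) :
    len R h g ≤ len R h (Q.w0 R Δ) := P.len_le_longest hg P.w0_mem P.w0_neg

theorem len_mul_w0 (P : Q.PosSys R Δ h) {g : V ≃ₗ[ℂ] V} (hg : g ∈ Q.weyl R) :
    len R h (g * Q.w0 R Δ) + len R h g = len R h (Q.w0 R Δ) :=
  P.len_add_len_mul hg P.w0_mem P.w0_neg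

theorem eq_w0 (P : Q.PosSys R Δ h) {g : V ≃ₗ[ℂ] V} (hg : g ∈ Q.weyl R)
    (hlen : len R h (Q.w0 R Δ) ≤ len R h g) : g = Q.w0 R Δ :=
  P.eq_longest hg P.w0_mem P.w0_neg hlen

theorem w0_mul_w0 (P : Q.PosSys R Δ h) : Q.w0 R Δ * Q.w0 R Δ = 1 := by
  apply P.eq_one_of_len (mul_mem P.w0_mem P.w0_mem)
  have := P.len_mul_w0 P.w0_mem
  omega

theorem posProd_mem_maxIdeal_pow (P : Q.PosSys R Δ h) :
    posProd R Δ ∈ maxIdeal (0 : V) ^ len R h (Q.w0 R Δ) := by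
  rw [← P.card_posRoots, posProd, ← Finset.prod_const]
  exact Ideal.prod_mem_prod fun α _ => lin_mem_maxIdeal α

theorem posProd_mem_affine_pow (P : Q.PosSys R Δ h) :
    posProd R Δ ∈ affine V ^ len R h (Q.w0 R Δ) := by
  rw [← P.card_posRoots, posProd]
  induction posRoots R Δ using Finset.cons_induction with
  | empty => simp
  | cons a s ha ih =>
    rw [Finset.prod_cons, Finset.card_cons, pow_succ']
    exact Submodule.mul_mem_mul (lin_mem_affine a) ih

theorem act_s_posProd (P : Q.PosSys R Δ h) {δ : Module.Dual ℂ V} (hδ : δ ∈ Δ) :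
    act (Q.s δ) (posProd R Δ) = -posProd R Δ := by
  classical
  have hm : δ ∈ posRoots R Δ := P.mem_posRoots.2 ⟨P.sub hδ, P.pos δ hδ⟩
  rw [posProd, ← Finset.mul_prod_erase _ _ hm, map_mul, map_prod, act_lin, P.s_self (P.sub hδ),
    lin_neg, neg_mul]
  congr 2
  have key : ∀ β ∈ (posRoots R Δ).erase δ, cact (Q.s δ) β ∈ (posRoots R Δ).erase δ := by
    intro β hβ
    obtain ⟨hne, hβ⟩ := Finset.mem_erase.1 hβ
    obtain ⟨h1, h2⟩ := P.mem_posRoots.1 hβ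
    refine Finset.mem_erase.2 ⟨fun H => ?_, P.mem_posRoots.2
      ⟨P.root.cact_mem (Q.s_mem_weyl (P.sub hδ)) h1, P.simple δ hδ β h1 h2 hne⟩⟩
    have := congrArg (cact (Q.s δ)) H
    rw [cact_s_cact_s, P.s_self (P.sub hδ)] at this
    rw [this, map_neg] at h2
    linarith [P.pos δ hδ]
  refine Finset.prod_bij' (fun β _ => cact (Q.s δ) β) (fun β _ => cact (Q.s δ) β) key key
    (fun β _ => Q.cact_s_cact_s _ _) (fun β _ => Q.cact_s_cact_s _ _) fun β _ => ?_
  rw [act_lin]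

/-- ∂_{ω₀} ends in ∇_δ for every simple δ, and ∇_δ s_δ = -∇_δ. -/
theorem ddiff_act_s (P : Q.PosSys R Δ h) {δ : Module.Dual ℂ V} (hδ : δ ∈ Δ) (f : Poly V) :
    Q.ddiff Δ (Q.w0 R Δ) (act (Q.s δ) f) = -Q.ddiff Δ (Q.w0 R Δ) f := by
  have hm := mul_mem P.w0_mem (Q.s_mem_weyl (P.sub hδ))
  have e : ∀ f, Q.ddiff Δ (Q.w0 R Δ) f =
      Q.ddiff Δ (Q.w0 R Δ * Q.s δ) (Q.nablaHom δ f) := fun f => by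
    rw [P.ddiff_nablaHom hm hδ, if_pos, mul_s_mul_s]
    rw [cact_mul, P.s_self (P.sub hδ), map_neg, map_neg]
    linarith [P.w0_neg δ (P.sub hδ) (P.pos δ hδ)]
  rw [e, e, nablaHom_act_s _ (P.ne_zero hδ), map_neg]

/-- The product of the positive roots and the top divided difference transform by the same sign. -/
theorem exists_sign (P : Q.PosSys R Δ h) {w : V ≃ₗ[ℂ] V} (hw : w ∈ Q.weyl R) :
    ∃ ε : ℂ, ε * ε = 1 ∧ act w (posProd R Δ) = ε • posProd R Δ ∧
      ∀ f, Q.ddiff Δ (Q.w0 R Δ) (act w f) = ε • Q.ddiff Δ (Q.w0 R Δ) f := by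
  obtain ⟨l, hl, rfl⟩ := P.exists_word hw
  clear hw
  induction l with
  | nil => exact ⟨1, one_mul 1, by rw [wprod_nil, act_one, one_smul], fun f => by
      rw [wprod_nil, act_one, one_smul]⟩
  | cons a l ih =>
    obtain ⟨ε, h1, h2, h3⟩ := ih fun α hα => hl α (by simp [hα])
    have ha : a ∈ Δ := hl a (by simp)
    refine ⟨-ε, by rw [neg_mul_neg, h1], ?_, fun f => ?_⟩
    · rw [wprod_cons, act_mul, h2, map_smul, P.act_s_posProd ha, smul_neg, neg_smul]
    · rw [wprod_cons, act_mul, P.ddiff_act_s ha, h3, neg_smul]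

theorem eq_of_apply_regular (P : Q.PosSys R Δ h) {p : V} (hp : ∀ β ∈ R, β p ≠ 0)
    {g g' : V ≃ₗ[ℂ] V} (hg : g ∈ Q.weyl R) (hg' : g' ∈ Q.weyl R) (H : g p = g' p) : g = g' := by
  have h1 : (g⁻¹ * g') p = p := by
    rw [LinearEquiv.mul_apply, ← H, ← LinearEquiv.mul_apply, inv_mul_cancel]; rfl
  have h2 := P.mem_weyl_vanishing (mul_mem (inv_mem hg) hg') h1
  have h3 : vanishing R p = ∅ := by
    rw [Finset.eq_empty_iff_forall_notMem]
    intro β hβ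
    exact hp β (mem_vanishing.1 hβ).1 (mem_vanishing.1 hβ).2
  have h4 : Q.weyl (∅ : Finset (Module.Dual ℂ V)) = ⊥ := by rw [weyl_eq_closure]; simp
  rw [h3, h4, Subgroup.mem_bot] at h2
  exact inv_mul_eq_one.1 h2

/-- Values of divided differences of a function that vanishes at all points of a regular orbit
except one. -/
theorem evalAt_dd_of_delta (P : Q.PosSys R Δ h) {p : V} (hp : ∀ β ∈ R, β p ≠ 0) {f : Poly V}
    (hf1 : evalAt (Q.w0 R Δ p) f = 1)
    (hf0 : ∀ w ∈ Q.weyl R, w ≠ Q.w0 R Δ → evalAt (w p) f = 0) (l : List (Module.Dual ℂ V))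
    (hl : ∀ α ∈ l, α ∈ Δ) (hred : len R h (Q.wprod l) = l.length) :
    (∀ w ∈ Q.weyl R, len R h w + l.length < len R h (Q.w0 R Δ) → evalAt (w p) (Q.dd l f) = 0) ∧
      evalAt ((Q.wprod l * Q.w0 R Δ) p) (Q.dd l f) *
        ∏ β ∈ inv R h (Q.wprod l), β (Q.w0 R Δ p) = 1 := by
  have hne : ∀ w ∈ Q.weyl R, ∀ β ∈ R, β (w p) ≠ 0 := fun w hw β hβ => by
    have := hp _ (P.root.cact_mem (inv_mem hw) hβ)
    rwa [cact_apply, inv_inv] at this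
  induction l with
  | nil =>
    constructor
    · intro w hw hlen
      rw [dd_nil]
      refine hf0 w hw ?_
      rintro rfl
      simp at hlen
    · have : inv R h 1 = ∅ := Finset.card_eq_zero.1 P.len_one
      rw [wprod_nil, one_mul, dd_nil, hf1, this, Finset.prod_empty, one_mul]
  | cons a l ih =>
    have hl' : ∀ α ∈ l, α ∈ Δ := fun α hα => hl α (by simp [hα])
    have ha : a ∈ Δ := hl a (by simp)
    have hσ := P.wprod_mem_weyl hl'
    have hsa := Q.s_mem_weyl (P.sub ha)
    rw [wprod_cons, List.length_cons] at hred
    have hle := P.len_wprod_le hl'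
    have hpos : 0 < h (cact (Q.wprod l)⁻¹ a) := by
      rcases P.lt_or_gt (inv_mem hσ) (P.sub ha) with h1 | h1
      · have := P.len_s_mul_of_neg hσ ha h1
        omega
      · exact h1
    have hlen := P.len_s_mul_of_pos hσ ha hpos
    obtain ⟨ih1, ih2⟩ := ih hl' (by omega)
    have step : ∀ w ∈ Q.weyl R, evalAt (w p) (Q.dd (a :: l) f) =
        (evalAt (w p) (Q.dd l f) - evalAt ((Q.s a * w) p) (Q.dd l f)) / a (w p) := by
      intro w hw
      rw [dd_cons, evalAt_nablaHom _ (P.ne_zero ha) (hne w hw a (P.sub ha))]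
      rfl
    constructor
    · intro w hw hlt
      rw [List.length_cons] at hlt
      have h1 := P.len_mul_le hsa hw
      have h2 : len R h (Q.s a) ≤ 1 := by
        have := P.len_wprod_le (l := [a]) (by simpa using ha)
        simpa using this
      rw [step w hw, ih1 w hw (by omega), ih1 _ (mul_mem hsa hw) (by omega)]
      simp
    · have hw : Q.wprod (a :: l) * Q.w0 R Δ ∈ Q.weyl R :=
        mul_mem (P.wprod_mem_weyl hl) P.w0_mem
      have h1 := P.len_mul_w0 (P.wprod_mem_weyl hl)
      obtain ⟨hnot, hinv⟩ := P.inv_s_mul hσ ha hpos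
      have hinv' : inv R h (Q.s a * Q.wprod l) =
          Finset.cons (cact (Q.wprod l)⁻¹ a) (inv R h (Q.wprod l)) hnot := by
        ext β; rw [hinv, Finset.mem_cons]
      -- The point lies outside the support of `Q.dd l f` for reasons of length, so only the value
      -- at its image under s_a survives. Up to sign the denominator is the new inversion at ω₀p.
      rw [step _ hw, ih1 _ hw (by rw [wprod_cons] at h1 ⊢; omega), wprod_cons, hinv',
        Finset.prod_cons, ← mul_assoc (Q.s a), s_mul_s_mul]
      have e1 : a ((Q.s a * Q.wprod l * Q.w0 R Δ) p) = -(cact (Q.wprod l)⁻¹ a) (Q.w0 R Δ p) := by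
        rw [cact_apply, inv_inv, mul_assoc, LinearEquiv.mul_apply]
        have := congrArg (fun β => β ((Q.wprod l * Q.w0 R Δ) p)) (P.s_self (P.sub ha))
        exact this
      have h0 : (cact (Q.wprod l)⁻¹ a) (Q.w0 R Δ p) ≠ 0 :=
        hne _ P.w0_mem _ (P.root.cact_mem (inv_mem hσ) (P.sub ha))
      rw [e1, zero_sub, neg_div_neg_eq, ← mul_assoc, div_mul_cancel₀ _ h0]
      exact ih2

theorem evalAt_dd_congr (P : Q.PosSys R Δ h) {p : V} (hp : ∀ β ∈ R, β p ≠ 0) {f : Poly V}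
    (hf : ∀ w ∈ Q.weyl R, evalAt (w p) f = 0) (l : List (Module.Dual ℂ V))
    (hl : ∀ α ∈ l, α ∈ Δ) : ∀ w ∈ Q.weyl R, evalAt (w p) (Q.dd l f) = 0 := by
  induction l with
  | nil => exact hf
  | cons a l ih =>
    intro w hw
    have ha : a ∈ Δ := hl a (by simp)
    have ih := ih fun α hα => hl α (by simp [hα])
    have hne : a (w p) ≠ 0 := by
      have := hp _ (P.root.cact_mem (inv_mem hw) (P.sub ha))
      rwa [cact_apply, inv_inv] at this
    have := ih _ (mul_mem (Q.s_mem_weyl (P.sub ha)) hw)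
    rw [LinearEquiv.mul_apply] at this
    rw [dd_cons, evalAt_nablaHom _ (P.ne_zero ha) hne, ih w hw, this, sub_zero, zero_div]

/-- On a regular orbit ∂_{ω₀} depends only on the values there, so the product of the positive roots
may be replaced by a combination of |W| delta functions. All contributions equal 1, as the product
and ∂_{ω₀} transform by the same sign. -/
theorem evalAt_regular_ddiff_w0 (P : Q.PosSys R Δ h) {p : V} (hp : ∀ β ∈ R, β p ≠ 0) :
    evalAt p (Q.ddiff Δ (Q.w0 R Δ) (posProd R Δ)) = Nat.card (Q.weyl R) := by
  classical
  have := P.finite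
  have := Fintype.ofFinite (Q.weyl R)
  set ω := Q.w0 R Δ with hω
  have hωm : ω ∈ Q.weyl R := P.w0_mem
  obtain ⟨e, he⟩ := exists_interpolation (Finset.univ.image fun w : Q.weyl R => w.1 p) 1
    (fun x => if x = ω p then 1 else 0)
  have he' : ∀ w ∈ Q.weyl R, evalAt (w p) e = if w = ω then 1 else 0 := by
    intro w hw
    have h1 := he (w p) (Finset.mem_image.2 ⟨⟨w, hw⟩, Finset.mem_univ _, rfl⟩)
    rw [pow_one, mem_maxIdeal, map_sub, sub_eq_zero] at h1
    rw [h1]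
    by_cases hc : w = ω
    · rw [if_pos hc, if_pos (by rw [hc]), map_one]
    · rw [if_neg hc, if_neg (fun H => hc (P.eq_of_apply_regular hp hw hωm H)), map_zero]
  obtain ⟨w1, w2, w3⟩ := P.reducedWord_spec hωm
  obtain ⟨-, hval⟩ := P.evalAt_dd_of_delta hp (by rw [he' _ hωm, if_pos rfl])
    (fun w hw hne => by rw [he' w hw, if_neg hne]) (Q.reducedWord Δ ω) w1 (by rw [w2, w3])
  rw [w2, P.w0_mul_w0, P.inv_w0] at hval
  have hval' : evalAt p (Q.ddiff Δ ω e) * evalAt (ω p) (posProd R Δ) = 1 := by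
    rw [posProd, map_prod, Finset.prod_congr rfl fun α _ => evalAt_lin (ω p) α]
    exact hval
  -- The translate of e by wω⁻¹ is the delta function at wp.
  let F : Poly V := ∑ w : Q.weyl R, evalAt (w.1 p) (posProd R Δ) • act (w.1 * ω⁻¹) e
  have hF : ∀ w ∈ Q.weyl R, evalAt (w p) (posProd R Δ - F) = 0 := by
    intro w hw
    rw [map_sub, map_sum, Finset.sum_eq_single (⟨w, hw⟩ : Q.weyl R)]
    · rw [map_smul, evalAt_act, ← LinearEquiv.mul_apply, he' _ (by
        exact mul_mem (inv_mem (mul_mem hw (inv_mem hωm))) hw), if_pos (by group), smul_eq_mul,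
        mul_one, sub_self]
    · intro u _ hu
      rw [map_smul, evalAt_act, ← LinearEquiv.mul_apply, he' _ (by
        exact mul_mem (inv_mem (mul_mem u.2 (inv_mem hωm))) hw), if_neg, smul_zero]
      intro H
      apply hu
      apply Subtype.ext
      rw [mul_inv_rev, inv_inv, mul_assoc, mul_eq_left, inv_mul_eq_one] at H
      exact H
    · intro H; exact absurd (Finset.mem_univ _) H
  have h1 := P.evalAt_dd_congr hp hF (Q.reducedWord Δ ω) w1 1 (one_mem _)
  change evalAt p (Q.ddiff Δ ω (posProd R Δ - F)) = 0 at h1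
  rw [map_sub, map_sub, sub_eq_zero] at h1
  rw [h1, map_sum, map_sum]
  have hterm : ∀ w : Q.weyl R, evalAt p (Q.ddiff Δ ω
      (evalAt (w.1 p) (posProd R Δ) • act (w.1 * ω⁻¹) e)) = 1 := by
    intro w
    obtain ⟨ε, hε, hε1, hε2⟩ := P.exists_sign (mul_mem w.2 (inv_mem hωm))
    have h2 : evalAt (ω p) (posProd R Δ) = ε * evalAt (w.1 p) (posProd R Δ) := by
      have := congrArg (evalAt (w.1 p)) hε1
      rw [evalAt_act, map_smul, smul_eq_mul, mul_inv_rev, inv_inv, LinearEquiv.mul_apply,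
        ← LinearEquiv.mul_apply w.1⁻¹, inv_mul_cancel] at this
      exact this
    rw [map_smul, map_smul, ← hω] at *
    rw [hε2, map_smul, smul_eq_mul, smul_eq_mul]
    rw [h2] at hval'
    linear_combination hval'
  rw [Finset.sum_congr rfl fun w _ => hterm w]
  simp

/-- The degree of the product equals ℓ(ω₀), so its image under ∂_{ω₀} is constant and its value at a
regular point determines it. -/
theorem coef_w0_posProd (P : Q.PosSys R Δ h) :
    Q.coef Δ (Q.w0 R Δ) (posProd R Δ) = Nat.card (Q.weyl R) := by
  obtain ⟨p, hp⟩ := exists_regular R fun β hβ => P.root.ne_zero hβ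
  obtain ⟨w1, w2, w3⟩ := P.reducedWord_spec P.w0_mem
  have h1 : Q.ddiff Δ (Q.w0 R Δ) (posProd R Δ) ∈ affine V ^ 0 := by
    refine Q.dd_mem_affine_pow (fun α hα => P.ne_zero (w1 α hα)) ?_
    rw [zero_add, w3]
    exact P.posProd_mem_affine_pow
  rw [pow_zero] at h1
  obtain ⟨c, hc⟩ := Submodule.mem_one.1 h1
  have h2 := P.evalAt_regular_ddiff_w0 hp
  rw [← hc, AlgHom.commutes] at h2
  rw [coef_apply, ← hc, AlgHom.commutes, h2]

theorem coef_eq_zero_of_mem (P : Q.PosSys R Δ h) {σ : V ≃ₗ[ℂ] V} (hσ : σ ∈ Q.weyl R) {k : ℕ}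
    (hk : len R h σ < k) {f : Poly V} (hf : f ∈ maxIdeal (0 : V) ^ k) : Q.coef Δ σ f = 0 := by
  rw [coef_apply, ← mem_maxIdeal, ← pow_one (maxIdeal (0 : V))]
  apply P.ddiff_mem_maxIdeal_pow hσ
  exact Ideal.pow_le_pow_right (by omega) hf

theorem coef_posProd (P : Q.PosSys R Δ h) {σ : V ≃ₗ[ℂ] V} (hσ : σ ∈ Q.weyl R)
    (hne : σ ≠ Q.w0 R Δ) : Q.coef Δ σ (posProd R Δ) = 0 := by
  apply P.coef_eq_zero_of_mem hσ _ P.posProd_mem_maxIdeal_pow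
  by_contra! H
  exact hne (P.eq_w0 hσ H)

theorem schubert_eq (P : Q.PosSys R Δ h) {τ : V ≃ₗ[ℂ] V} (hτ : τ ∈ Q.weyl R) :
    Q.schubert R Δ τ =
      (Nat.card (Q.weyl R) : ℂ)⁻¹ • Q.ddiff Δ (τ⁻¹ * Q.w0 R Δ) (posProd R Δ) := by
  rw [schubert, ← P.divDiff_eq (mul_mem (inv_mem hτ) P.w0_mem)]; rfl

theorem card_ne_zero (P : Q.PosSys R Δ h) : (Nat.card (Q.weyl R) : ℂ) ≠ 0 := by
  have := P.finite
  exact Nat.cast_ne_zero.2 Nat.card_pos.ne'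

/-- ∂_σ ∂_{τ⁻¹ω₀} is either zero or ∂_{στ⁻¹ω₀}. On the product of the positive roots only ∂_{ω₀}
leaves a constant term, which requires σ = τ. -/
theorem coef_schubert (P : Q.PosSys R Δ h) {σ τ : V ≃ₗ[ℂ] V} (hσ : σ ∈ Q.weyl R)
    (hτ : τ ∈ Q.weyl R) :
    Q.coef Δ σ (Q.schubert R Δ τ) = open Classical in if σ = τ then 1 else 0 := by
  classical
  have hm := mul_mem (inv_mem hτ) P.w0_mem
  rw [P.schubert_eq hτ, map_smul, coef_apply, P.ddiff_ddiff hσ hm]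
  by_cases hst : σ = τ
  · subst hst
    have h1 := P.len_mul_w0 (inv_mem hσ)
    rw [P.len_inv hσ] at h1
    rw [if_pos rfl, mul_inv_cancel_left, if_pos (by omega), ← coef_apply, P.coef_w0_posProd,
      smul_eq_mul, inv_mul_cancel₀ P.card_ne_zero]
  · rw [if_neg hst]
    split_ifs
    · rw [← coef_apply, P.coef_posProd (mul_mem hσ hm), smul_zero]
      rw [← mul_assoc, Ne, mul_eq_right, mul_inv_eq_one]
      exact hst
    · rw [map_zero, smul_zero]

theorem schubert_mem_maxIdeal_pow (P : Q.PosSys R Δ h) {τ : V ≃ₗ[ℂ] V} (hτ : τ ∈ Q.weyl R) :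
    Q.schubert R Δ τ ∈ maxIdeal (0 : V) ^ len R h τ := by
  rw [P.schubert_eq hτ, Algebra.smul_def]
  apply Ideal.mul_mem_left
  apply P.ddiff_mem_maxIdeal_pow (mul_mem (inv_mem hτ) P.w0_mem)
  have h1 := P.len_mul_w0 (inv_mem hτ)
  rw [P.len_inv hτ] at h1
  rw [show len R h τ + len R h (τ⁻¹ * Q.w0 R Δ) = len R h (Q.w0 R Δ) by omega]
  exact P.posProd_mem_maxIdeal_pow

theorem coef_nablaHom (P : Q.PosSys R Δ h) {f : Poly V}
    (hf : ∀ σ ∈ Q.weyl R, Q.coef Δ σ f = 0) {δ : Module.Dual ℂ V} (hδ : δ ∈ Δ) :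
    ∀ σ ∈ Q.weyl R, Q.coef Δ σ (Q.nablaHom δ f) = 0 := by
  intro σ hσ
  rw [coef_apply, P.ddiff_nablaHom hσ hδ]
  split_ifs
  · exact hf _ (mul_mem hσ (Q.s_mem_weyl (P.sub hδ)))
  · exact map_zero _

/-- By induction on the degree ∇_δ f lies in I_W, hence so does f - s_δ f. Modulo I_W the polynomial
f therefore equals its average over W, an invariant without constant term. -/
theorem mem_coinvIdeal_of_coef (P : Q.PosSys R Δ h) {f : Poly V}
    (hf : ∀ σ ∈ Q.weyl R, Q.coef Δ σ f = 0) : f ∈ Q.coinvIdeal R := by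
  classical
  have := P.finite
  have := Fintype.ofFinite (Q.weyl R)
  obtain ⟨d, hd⟩ := exists_mem_affine_pow f
  induction d generalizing f with
  | zero =>
    rw [pow_zero] at hd
    obtain ⟨c, rfl⟩ := Submodule.mem_one.1 hd
    have h1 := hf 1 (one_mem _)
    rw [coef_apply, P.ddiff_one, AlgHom.commutes] at h1
    have h1 : c = 0 := h1
    rw [h1, map_zero]
    exact zero_mem _
  | succ d ih =>
    have hs : ∀ δ ∈ Δ, f - act (Q.s δ) f ∈ Q.coinvIdeal R := by
      intro δ hδ
      rw [← Q.lin_mul_nablaHom (P.ne_zero hδ)]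
      exact Ideal.mul_mem_left _ _ (ih (P.coef_nablaHom hf hδ)
        (Q.nablaHom_mem_affine_pow (P.ne_zero hδ) hd))
    have hw : ∀ l : List (Module.Dual ℂ V), (∀ α ∈ l, α ∈ Δ) →
        f - act (Q.wprod l) f ∈ Q.coinvIdeal R := by
      intro l hl
      induction l with
      | nil => rw [wprod_nil, act_one, sub_self]; exact zero_mem _
      | cons a l ihl =>
        have ha : a ∈ Δ := hl a (by simp)
        have h1 := act_mem_coinvIdeal (Q.s_mem_weyl (P.sub ha))
          (ihl fun α hα => hl α (by simp [hα]))
        rw [wprod_cons, act_mul]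
        convert add_mem (hs a ha) h1 using 1
        rw [map_sub]; ring
    have hw' : ∀ w ∈ Q.weyl R, f - act w f ∈ Q.coinvIdeal R := fun w hw' => by
      obtain ⟨l, hl, rfl⟩ := P.exists_word hw'
      exact hw l hl
    have hsum : ∑ w : Q.weyl R, (f - act w.1 f) ∈ Q.coinvIdeal R :=
      sum_mem fun w _ => hw' w.1 w.2
    have hinv : ∑ w : Q.weyl R, act w.1 f ∈ Q.coinvIdeal R := by
      apply Ideal.subset_span
      refine ⟨fun g hg => ?_, ?_⟩
      · rw [map_sum]
        exact (Finset.sum_congr rfl fun w _ => (act_mul g w.1 f).symm).trans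
          (Equiv.sum_comp (Equiv.mulLeft (⟨g, hg⟩ : Q.weyl R)) fun w => act w.1 f)
      · rw [map_sum]
        refine Finset.sum_eq_zero fun w _ => ?_
        have h1 := hf 1 (one_mem _)
        rw [coef_apply, P.ddiff_one] at h1
        rw [evalAt_zero_act, h1]
    have h2 := add_mem hsum hinv
    rw [← Finset.sum_add_distrib, Finset.sum_congr rfl fun w _ => sub_add_cancel f (act w.1 f),
      Finset.sum_const, Finset.card_univ, ← Nat.card_eq_fintype_card] at h2
    have h3 := Ideal.mul_mem_left _ (algebraMap ℂ (Poly V) (Nat.card (Q.weyl R) : ℂ)⁻¹) h2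
    rwa [← Algebra.smul_def, ← Nat.cast_smul_eq_nsmul ℂ, smul_smul,
      inv_mul_cancel₀ P.card_ne_zero, one_smul] at h3

/-- ∂_σ is linear over the W-invariants. -/
theorem coef_of_mem_coinvIdeal (P : Q.PosSys R Δ h) {f : Poly V} (hf : f ∈ Q.coinvIdeal R)
    {σ : V ≃ₗ[ℂ] V} (hσ : σ ∈ Q.weyl R) : Q.coef Δ σ f = 0 := by
  suffices H : ∀ a, Q.coef Δ σ (a * f) = 0 by simpa using H 1
  rw [coinvIdeal] at hf
  induction hf using Submodule.span_induction with
  | mem x hx =>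
    intro a
    rw [coef_apply, mul_comm, P.ddiff_mul_of_invariant hσ hx.1, map_mul, hx.2, zero_mul]
  | zero => intro a; rw [mul_zero, map_zero]
  | add x y _ _ hx hy => intro a; rw [mul_add, map_add, hx, hy, add_zero]
  | smul b x _ hx => intro a; rw [smul_eq_mul, ← mul_assoc, hx]

end PosSys

end InnerForm

/-- The group of linear automorphisms which fix a polynomial function. -/
def fixer (f : Poly V) : Subgroup (V ≃ₗ[ℂ] V) where
  carrier := {g | act g f = f}
  mul_mem' {a b} ha hb := by
    rw [Set.mem_ofPred_eq] at ha hb ⊢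
    rw [act_mul, hb, ha]
  one_mem' := act_one f
  inv_mem' {a} ha := by
    rw [Set.mem_ofPred_eq] at ha ⊢
    nth_rw 1 [← ha]
    rw [← act_mul, inv_mul_cancel, act_one]

theorem mem_fixer {f : Poly V} {g : V ≃ₗ[ℂ] V} : g ∈ fixer f ↔ act g f = f := Iff.rfl

namespace InnerForm

variable [FiniteDimensional ℂ V] {Q : InnerForm V} {Φ Ψ Ω θ : Finset (Module.Dual ℂ V)}
  {h : Module.Dual ℂ V →ₗ[ℝ] ℝ} {v : V}

/-! ### The functionals `𝒟_σ^v` -/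

namespace PosSys

theorem sub_sum_coef_mem (P : Q.PosSys Ψ Ω h) [Fintype (Q.weyl Ψ)] (f : Poly V) :
    f - ∑ τ : Q.weyl Ψ, Q.coef Ω τ f • Q.schubert Ψ Ω τ ∈ Q.coinvIdeal Ψ := by
  classical
  apply P.mem_coinvIdeal_of_coef
  intro σ hσ
  rw [map_sub, map_sum, Finset.sum_eq_single (⟨σ, hσ⟩ : Q.weyl Ψ)]
  · rw [map_smul, P.coef_schubert hσ hσ, if_pos rfl, smul_eq_mul, mul_one, sub_self]
  · intro τ _ hne
    rw [map_smul, P.coef_schubert hσ τ.2, if_neg fun H => hne (Subtype.ext H.symm), smul_zero]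
  · intro H; exact absurd (Finset.mem_univ _) H

theorem eq_sum_coef (P : Q.PosSys Ψ Ω h) [Fintype (Q.weyl Ψ)] (L : Poly V →ₗ[ℂ] ℂ)
    (hL : ∀ f ∈ Q.coinvIdeal Ψ, L f = 0) (f : Poly V) :
    L f = ∑ τ : Q.weyl Ψ, Q.coef Ω τ f * L (Q.schubert Ψ Ω τ) := by
  have := hL _ (P.sub_sum_coef_mem f)
  rw [map_sub, map_sum, sub_eq_zero] at this
  rw [this]
  exact Finset.sum_congr rfl fun τ _ => by rw [map_smul, smul_eq_mul]

-- `coef` at σ vanishes on a power of the maximal ideal at 0, so some polynomial represents it and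
-- satisfies the defining conditions of P_σ. Conversely these conditions fix the pairing on I_W and
-- on the Schubert polynomials, which together span Λ.
open Classical in
theorem pairing_dualSchubert (P : Q.PosSys Ψ Ω h) {σ : V ≃ₗ[ℂ] V} (hσ : σ ∈ Q.weyl Ψ)
    (f : Poly V) : Q.pairing (Q.dualSchubert Ψ Ω σ) f = Q.coef Ω σ f := by
  have := P.finite
  have := Fintype.ofFinite (Q.weyl Ψ)
  obtain ⟨p, hp⟩ := Q.exists_pairing_eq (len Ψ h σ) (Q.coef Ω σ)
    (fun f hf => P.coef_eq_zero_of_mem hσ (Nat.lt_succ_self _) hf)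
  have hspec := Classical.epsilon_spec (p := fun P =>
    (∀ f ∈ Q.coinvIdeal Ψ, Q.pairing f P = 0) ∧
      ∀ τ ∈ Q.weyl Ψ, Q.pairing P (Q.schubert Ψ Ω τ) = if σ = τ then 1 else 0)
    ⟨p, fun f hf => by rw [pairing_comm, hp, P.coef_of_mem_coinvIdeal hf hσ], fun τ hτ => by
      rw [hp, P.coef_schubert hσ hτ]⟩
  obtain ⟨h1, h2⟩ : (∀ f ∈ Q.coinvIdeal Ψ, Q.pairing f (Q.dualSchubert Ψ Ω σ) = 0) ∧
      ∀ τ ∈ Q.weyl Ψ, Q.pairing (Q.dualSchubert Ψ Ω σ) (Q.schubert Ψ Ω τ) =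
        if σ = τ then 1 else 0 := hspec
  rw [← pairingHom_apply, P.eq_sum_coef (Q.pairingHom (Q.dualSchubert Ψ Ω σ)) (fun f hf => by
    rw [pairingHom_apply, pairing_comm, h1 f hf]),
    Finset.sum_eq_single (⟨σ, hσ⟩ : Q.weyl Ψ)]
  · rw [pairingHom_apply, h2 σ hσ, if_pos rfl, mul_one]
  · intro τ _ hne
    rw [pairingHom_apply, h2 τ.1 τ.2, if_neg fun H => hne (Subtype.ext H.symm), mul_zero]
  · intro H; exact absurd (Finset.mem_univ _) H

theorem bgg_apply (P : Q.PosSys Ψ Ω h) {σ : V ≃ₗ[ℂ] V} (hσ : σ ∈ Q.weyl Ψ) (v : V)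
    (γ : Q.invariants Φ) : Q.bgg Φ Ψ Ω v σ γ = Q.coef Ω σ (trans v γ) := by
  rw [← P.pairing_dualSchubert hσ, pairing, theta_trans, evalAt_trans, zero_add]
  rfl

theorem bgg_mem {σ : V ≃ₗ[ℂ] V} (hσ : σ ∈ Q.weyl Ψ) :
    Q.bgg Φ Ψ Ω v σ ∈ Q.bggSpace Φ Ψ Ω v := Submodule.subset_span ⟨σ, hσ, rfl⟩

theorem ev_apply (γ : Q.invariants Φ) : Q.ev Φ v γ = evalAt v (γ : Poly V) := rfl

theorem bgg_one (P : Q.PosSys Ψ Ω h) (v : V) : Q.bgg Φ Ψ Ω v 1 = Q.ev Φ v := by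
  ext γ
  rw [P.bgg_apply (one_mem _), coef_apply, P.ddiff_one, evalAt_trans, zero_add, ev_apply]

theorem ev_mem (P : Q.PosSys Ψ Ω h) (v : V) : Q.ev Φ v ∈ Q.bggSpace Φ Ψ Ω v := by
  rw [← P.bgg_one]
  exact bgg_mem (one_mem _)

/-- A functional given by a linear form on `Λ` vanishing on the coinvariant ideal. -/
theorem mem_bggSpace (P : Q.PosSys Ψ Ω h) {x : Module.Dual ℂ (Q.invariants Φ)}
    (L : Poly V →ₗ[ℂ] ℂ) (hL : ∀ f ∈ Q.coinvIdeal Ψ, L f = 0)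
    (hx : ∀ γ, x γ = L (trans v γ)) : x ∈ Q.bggSpace Φ Ψ Ω v := by
  have := P.finite
  have := Fintype.ofFinite (Q.weyl Ψ)
  have : x = ∑ τ : Q.weyl Ψ, L (Q.schubert Ψ Ω τ) • Q.bgg Φ Ψ Ω v τ := by
    ext γ
    rw [hx, P.eq_sum_coef L hL, LinearMap.sum_apply]
    refine Finset.sum_congr rfl fun τ _ => ?_
    rw [LinearMap.smul_apply, P.bgg_apply τ.2, smul_eq_mul, mul_comm]
  rw [this]
  exact Submodule.sum_mem _ fun τ _ => Submodule.smul_mem _ _ (bgg_mem τ.2)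

/-- Multiplication by T_v γ preserves I_W, so `coef` at σ composed with it still vanishes there. -/
theorem dualAct_mem (P : Q.PosSys Ψ Ω h) (γ : Q.invariants Φ)
    {x : Module.Dual ℂ (Q.invariants Φ)} (hx : x ∈ Q.bggSpace Φ Ψ Ω v) :
    Q.dualAct γ x ∈ Q.bggSpace Φ Ψ Ω v := by
  rw [bggSpace] at hx
  induction hx using Submodule.span_induction with
  | mem x hx =>
    obtain ⟨σ, hσ, rfl⟩ := hx
    refine P.mem_bggSpace (Q.coef Ω σ ∘ₗ LinearMap.mulLeft ℂ (trans v γ)) ?_ ?_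
    · intro f hf
      exact P.coef_of_mem_coinvIdeal (Ideal.mul_mem_left _ _ hf) hσ
    · intro γ'
      change Q.bgg Φ Ψ Ω v σ (γ * γ') = _
      rw [P.bgg_apply hσ, Subalgebra.coe_mul, map_mul]
      rfl
  | zero => rw [dualAct, LinearMap.zero_comp]; exact zero_mem _
  | add x y _ _ hx hy => rw [dualAct, LinearMap.add_comp]; exact add_mem hx hy
  | smul c x _ hx => rw [dualAct, LinearMap.smul_comp]; exact Submodule.smul_mem _ _ hx

/-- ∂_σ lowers the order of vanishing by at most ℓ(σ) ≤ ℓ(ω₀). This is the source of all nilpotency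
arguments below. -/
theorem apply_mul_eq_zero (P : Q.PosSys Ψ Ω h) {γ : Q.invariants Φ} {k : ℕ}
    (hk : len Ψ h (Q.w0 Ψ Ω) < k) (hγ : (γ : Poly V) ∈ maxIdeal v ^ k)
    {x : Module.Dual ℂ (Q.invariants Φ)} (hx : x ∈ Q.bggSpace Φ Ψ Ω v) (γ' : Q.invariants Φ) :
    x (γ * γ') = 0 := by
  rw [bggSpace] at hx
  induction hx using Submodule.span_induction with
  | mem x hx =>
    obtain ⟨σ, hσ, rfl⟩ := hx
    rw [P.bgg_apply hσ, Subalgebra.coe_mul, map_mul]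
    exact P.coef_eq_zero_of_mem hσ ((P.len_le_w0 hσ).trans_lt hk)
      (Ideal.mul_mem_right _ _ (trans_mem_maxIdeal_pow hγ))
  | zero => rfl
  | add x y _ _ hx hy => rw [LinearMap.add_apply, hx, hy, add_zero]
  | smul c x _ hx => rw [LinearMap.smul_apply, hx, smul_zero]

/-- For invariant γ one has T_{wv} γ = w(T_v γ), and w preserves I_W. -/
theorem bggSpace_le_of_mem_weyl (P : Q.PosSys Ψ Ω h) (hΨΦ : Ψ ⊆ Φ) {w : V ≃ₗ[ℂ] V}
    (hw : w ∈ Q.weyl Ψ) (v : V) : Q.bggSpace Φ Ψ Ω (w v) ≤ Q.bggSpace Φ Ψ Ω v := by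
  rw [bggSpace, Submodule.span_le]
  rintro _ ⟨σ, hσ, rfl⟩
  refine P.mem_bggSpace (Q.coef Ω σ ∘ₗ (act w).toLinearMap) ?_ ?_
  · intro f hf
    exact P.coef_of_mem_coinvIdeal (act_mem_coinvIdeal hw hf) hσ
  · intro γ
    rw [P.bgg_apply hσ]
    nth_rw 1 [← γ.2 w (Q.weyl_mono hΨΦ hw)]
    rw [trans_act]
    rfl

theorem bggSpace_eq_of_mem_weyl (P : Q.PosSys Ψ Ω h) (hΨΦ : Ψ ⊆ Φ) {w : V ≃ₗ[ℂ] V}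
    (hw : w ∈ Q.weyl Ψ) (v : V) : Q.bggSpace Φ Ψ Ω v = Q.bggSpace Φ Ψ Ω (w v) := by
  refine le_antisymm ?_ (P.bggSpace_le_of_mem_weyl hΨΦ hw v)
  have := P.bggSpace_le_of_mem_weyl hΨΦ (inv_mem hw) (w v)
  rwa [← LinearEquiv.mul_apply, inv_mul_cancel] at this

end PosSys

theorem ev_ne_zero (Q : InnerForm V) (Φ : Finset (Module.Dual ℂ V)) (v : V) : Q.ev Φ v ≠ 0 := by
  intro H
  have := DFunLike.congr_fun H 1
  rw [PosSys.ev_apply, Subalgebra.coe_one, map_one] at this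
  exact one_ne_zero this

/-- Evaluating the condition at 1 gives x(γ) = γ(v) x(1). -/
theorem dualAct_sub_eq_zero_iff {x : Module.Dual ℂ (Q.invariants Φ)} :
    (∀ γ : Q.invariants Φ, Q.dualAct γ x - Q.ev Φ v γ • x = 0) ↔ ∃ c : ℂ, x = c • Q.ev Φ v := by
  constructor
  · intro H
    refine ⟨x 1, ?_⟩
    ext γ
    have := DFunLike.congr_fun (H γ) 1
    rw [LinearMap.sub_apply, LinearMap.zero_apply, sub_eq_zero] at this
    change x (γ * 1) = Q.ev Φ v γ * x 1 at this
    rw [mul_one] at this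
    rw [this, LinearMap.smul_apply, smul_eq_mul, mul_comm]
  · rintro ⟨c, rfl⟩ γ
    ext γ'
    change c * Q.ev Φ v (γ * γ') - Q.ev Φ v γ * (c * Q.ev Φ v γ') = 0
    rw [PosSys.ev_apply, PosSys.ev_apply, PosSys.ev_apply, Subalgebra.coe_mul, map_mul]
    ring

/-! ### Interpolation by invariants -/

theorem sum_act_mem_invariants [Fintype (Q.weyl Φ)] (f : Poly V) :
    ∑ a : Q.weyl Φ, act a.1 f ∈ Q.invariants Φ := by
  intro g hg
  rw [map_sum]
  exact (Finset.sum_congr rfl fun w _ => (act_mul g w.1 f).symm).trans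
    (Equiv.sum_comp (Equiv.mulLeft (⟨g, hg⟩ : Q.weyl Φ)) fun w => act w.1 f)

/-- Choose a polynomial with the desired jet at v and zero jet at the other points of the orbit, and
average over G. The terms that contribute at v come from the stabilizer, which preserves the jet. -/
theorem IsRootSystem.exists_invariant_lift (hΦ : Q.IsRootSystem Φ) (v : V) (k : ℕ) {f : Poly V}
    (hf : ∀ α ∈ Φ, α v = 0 → act (Q.s α) f = f) :
    ∃ γ : Q.invariants Φ, trans v γ - f ∈ maxIdeal (0 : V) ^ k := by
  classical
  have := hΦ.finite_weyl
  have := Fintype.ofFinite (Q.weyl Φ)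
  obtain ⟨e, he⟩ := exists_interpolation (Finset.univ.image fun a : Q.weyl Φ => a.1⁻¹ v) k
    (fun x => if x = v then trans (-v) f else 0)
  have he' : ∀ a : Q.weyl Φ,
      act a.1 e - (if a.1 v = v then trans (-v) f else 0) ∈ maxIdeal v ^ k := by
    intro a
    have h1 := act_mem_maxIdeal_pow (g := a.1)
      (he (a.1⁻¹ v) (Finset.mem_image_of_mem _ (Finset.mem_univ a)))
    have hav : a.1 (a.1⁻¹ v) = v := by
      rw [← LinearEquiv.mul_apply, mul_inv_cancel]; rfl
    have hiff : a.1⁻¹ v = v ↔ a.1 v = v := by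
      constructor
      · intro H; nth_rw 1 [← H]; exact hav
      · intro H; nth_rw 1 [← H]; rw [← LinearEquiv.mul_apply, inv_mul_cancel]; rfl
    rw [hav, map_sub] at h1
    by_cases hc : a.1 v = v
    · rw [if_pos hc]
      rw [if_pos (hiff.2 hc)] at h1
      -- By Steinberg's theorem a is a product of reflections in roots vanishing at v, and each of
      -- these fixes f.
      have h2 : a.1 ∈ fixer f := by
        refine Q.weyl_le (fun α hα => ?_) (hΦ.mem_weyl_vanishing a.2 hc)
        exact hf α (mem_vanishing.1 hα).1 (mem_vanishing.1 hα).2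
      have h3 : act a.1 (trans (-v) f) = trans (-v) f := by
        rw [← trans_act, map_neg, hc, mem_fixer.1 h2]
      rwa [h3] at h1
    · rw [if_neg hc]
      rwa [if_neg (fun H => hc (hiff.1 H)), map_zero] at h1
  -- The order of the stabilizer of v: the number of summands carrying the jet.
  let n : ℕ := (Finset.univ.filter fun a : Q.weyl Φ => a.1 v = v).card
  have hn : (n : ℂ) ≠ 0 := Nat.cast_ne_zero.2
    (Finset.card_ne_zero.2 ⟨1, Finset.mem_filter.2 ⟨Finset.mem_univ _, rfl⟩⟩)
  refine ⟨(n : ℂ)⁻¹ • ⟨_, sum_act_mem_invariants e⟩, ?_⟩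
  have h1 : ∑ a : Q.weyl Φ, act a.1 e - (n : ℂ) • trans (-v) f ∈ maxIdeal v ^ k := by
    have h2 := Ideal.sum_mem (maxIdeal v ^ k) fun (a : Q.weyl Φ) (_ : a ∈ Finset.univ) => he' a
    rw [Finset.sum_sub_distrib, ← Finset.sum_filter, Finset.sum_const,
      ← Nat.cast_smul_eq_nsmul ℂ] at h2
    exact h2
  have h3 := trans_mem_maxIdeal_pow
    (Ideal.mul_mem_left _ (algebraMap ℂ (Poly V) (n : ℂ)⁻¹) h1)
  rw [← Algebra.smul_def, smul_sub, smul_smul, inv_mul_cancel₀ hn, one_smul, map_sub,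
    trans_trans_neg] at h3
  exact h3

/-- Invariants separate orbits. -/
theorem IsRootSystem.exists_invariant_separating (hΦ : Q.IsRootSystem Φ) {v v' : V}
    (hne : ∀ g ∈ Q.weyl Φ, v' ≠ g v) :
    ∃ γ : Q.invariants Φ, evalAt v (γ : Poly V) = 0 ∧ evalAt v' (γ : Poly V) = 1 := by
  classical
  have := hΦ.finite_weyl
  have := Fintype.ofFinite (Q.weyl Φ)
  obtain ⟨e, he⟩ := exists_interpolation ((Finset.univ.image fun a : Q.weyl Φ => a.1⁻¹ v) ∪
    (Finset.univ.image fun a : Q.weyl Φ => a.1⁻¹ v')) 1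
    (fun x => if ∃ a : Q.weyl Φ, x = a.1⁻¹ v' then 1 else 0)
  have hv : ∀ a : Q.weyl Φ, evalAt (a.1⁻¹ v) e = 0 := by
    intro a
    have h1 := he (a.1⁻¹ v) (Finset.mem_union_left _
      (Finset.mem_image_of_mem _ (Finset.mem_univ a)))
    rw [pow_one, mem_maxIdeal, map_sub, sub_eq_zero, if_neg, map_zero] at h1
    · exact h1
    · rintro ⟨b, hb⟩
      apply hne (b.1 * a.1⁻¹) (mul_mem b.2 (inv_mem a.2))
      rw [LinearEquiv.mul_apply, hb, ← LinearEquiv.mul_apply, mul_inv_cancel]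
      rfl
  have hv' : ∀ a : Q.weyl Φ, evalAt (a.1⁻¹ v') e = 1 := by
    intro a
    have h1 := he (a.1⁻¹ v') (Finset.mem_union_right _
      (Finset.mem_image_of_mem _ (Finset.mem_univ a)))
    rwa [pow_one, mem_maxIdeal, map_sub, sub_eq_zero, if_pos ⟨a, rfl⟩, map_one] at h1
  have hcard : (Fintype.card (Q.weyl Φ) : ℂ) ≠ 0 := Nat.cast_ne_zero.2 Fintype.card_ne_zero
  refine ⟨(Fintype.card (Q.weyl Φ) : ℂ)⁻¹ • ⟨_, sum_act_mem_invariants e⟩, ?_, ?_⟩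
  · rw [Subalgebra.coe_smul, map_smul, map_sum]
    simp only [evalAt_act, hv, Finset.sum_const_zero, smul_zero]
  · rw [Subalgebra.coe_smul, map_smul, map_sum]
    simp only [evalAt_act, hv', Finset.sum_const, Finset.card_univ, nsmul_eq_mul, mul_one,
      smul_eq_mul]
    exact inv_mul_cancel₀ hcard

/-- If γ(v) = 0 and γ(v') = 1, then γ^k annihilates one space and (1 - γ)^k the other once k >
ℓ(ω₀); these powers are coprime, so the intersection is zero. On a common G-orbit both spaces
contain the same nonzero evaluation. -/
theorem PosSys.bggSpace_inf_ne_bot_iff (P : Q.PosSys Ψ Ω h) (hΦ : Q.IsRootSystem Φ) {v v' : V} :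
    Q.bggSpace Φ Ψ Ω v ⊓ Q.bggSpace Φ Ψ Ω v' ≠ ⊥ ↔ ∃ g ∈ Q.weyl Φ, v' = g v := by
  constructor
  · intro H
    by_contra! hne
    apply H
    obtain ⟨γ, h0, h1⟩ := hΦ.exists_invariant_separating hne
    rw [eq_bot_iff]
    rintro x ⟨hx, hx'⟩
    rw [Submodule.mem_bot]
    set k := len Ψ h (Q.w0 Ψ Ω) + 1
    obtain ⟨a, b, hab⟩ : IsCoprime (γ ^ k) ((1 - γ) ^ k) :=
      IsCoprime.pow ⟨1, 1, by ring⟩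
    ext γ'
    have e : γ' = γ ^ k * (a * γ') + (1 - γ) ^ k * (b * γ') := by
      linear_combination (-γ') * hab
    rw [e, map_add, P.apply_mul_eq_zero (Nat.lt_succ_self _) _ hx,
      P.apply_mul_eq_zero (Nat.lt_succ_self _) _ hx', add_zero, LinearMap.zero_apply]
    · rw [Subalgebra.coe_pow]
      apply Ideal.pow_mem_pow
      rw [mem_maxIdeal, Subalgebra.coe_sub, map_sub, h1, Subalgebra.coe_one, map_one, sub_self]
    · rw [Subalgebra.coe_pow]
      exact Ideal.pow_mem_pow (mem_maxIdeal.2 h0) k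
  · rintro ⟨g, hg, rfl⟩ H
    have h1 : Q.ev Φ (g v) = Q.ev Φ v := by
      ext γ
      have := congrArg (evalAt (g v)) (γ.2 g hg)
      rw [evalAt_act, ← LinearEquiv.mul_apply, inv_mul_cancel] at this
      exact this.symm
    have h2 : Q.ev Φ v ∈ Q.bggSpace Φ Ψ Ω v ⊓ Q.bggSpace Φ Ψ Ω (g v) :=
      ⟨P.ev_mem v, h1 ▸ P.ev_mem (g v)⟩
    rw [H, Submodule.mem_bot] at h2
    exact ev_ne_zero Q Φ v h2

end InnerForm

namespace InnerForm

variable [FiniteDimensional ℂ V] {Q : InnerForm V} {Φ Ψ Ω θ : Finset (Module.Dual ℂ V)}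
  {h : Module.Dual ℂ V →ₗ[ℝ] ℝ} {v : V}

namespace PosSys

/-! ### Minimal coset representatives at a standard point -/

theorem pos_of_vanishing (P : Q.PosSys Ψ Ω h) (Pθ : Q.PosSys (vanishing Ψ v) θ h)
    {σ : V ≃ₗ[ℂ] V} (hσ : σ ∈ Q.weyl Ψ) (hpos : ∀ δ ∈ θ, 0 < h (cact σ δ))
    {β : Module.Dual ℂ V} (hβ : β ∈ vanishing Ψ v) (h0 : 0 < h β) : 0 < h (cact σ β) :=
  lt_of_le_of_ne ((Pθ.cone β hβ h0).map_nonneg (k := shift h σ) fun δ hδ => (hpos δ hδ).le)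
    (P.ne _ (P.root.cact_mem hσ (mem_vanishing.1 hβ).1)).symm

theorem weyl_vanishing_le (Q : InnerForm V) (Ψ : Finset (Module.Dual ℂ V)) (v : V) :
    Q.weyl (vanishing Ψ v) ≤ Q.weyl Ψ := Q.weyl_mono (Finset.filter_subset _ _)

/-- σ preserves the sign of every root vanishing at v, so along a word in θ the two lengths rise and
fall together. -/
theorem len_mul_of_vanishing (P : Q.PosSys Ψ Ω h) (hθ : θ ⊆ Ω)
    (Pθ : Q.PosSys (vanishing Ψ v) θ h) {σ τ : V ≃ₗ[ℂ] V} (hσ : σ ∈ Q.weyl Ψ)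
    (hpos : ∀ δ ∈ θ, 0 < h (cact σ δ)) (hτ : τ ∈ Q.weyl (vanishing Ψ v)) :
    len Ψ h (σ * τ) = len Ψ h σ + len Ψ h τ := by
  obtain ⟨l, hl, rfl⟩ := Pθ.exists_word hτ
  clear hτ
  induction l using List.reverseRecOn with
  | nil => rw [wprod_nil, mul_one, P.len_one, add_zero]
  | append_singleton l a ih =>
    have hl' : ∀ α ∈ l, α ∈ θ := fun α hα => hl α (by simp [hα])
    have ha : a ∈ θ := hl a (by simp)
    have ih := ih hl'
    have hm := Pθ.root.cact_mem (Pθ.wprod_mem_weyl hl') (Pθ.sub ha)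
    rw [wprod_append, wprod_cons, wprod_nil, mul_one, ← mul_assoc]
    rcases Pθ.lt_or_gt (Pθ.wprod_mem_weyl hl') (Pθ.sub ha) with h1 | h1
    · have h2 := P.pos_of_vanishing Pθ hσ hpos (Pθ.root.neg_mem hm) (by rw [map_neg]; linarith)
      rw [map_neg, map_neg] at h2
      have h3 := P.len_mul_s_of_neg (hθ ha) h1
      have h4 := P.len_mul_s_of_neg (g := σ * Q.wprod l) (hθ ha) (by rw [cact_mul]; linarith)
      omega
    · have h2 := P.pos_of_vanishing Pθ hσ hpos hm h1
      have h3 := P.len_mul_s_of_pos (hθ ha) h1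
      have h4 := P.len_mul_s_of_pos (g := σ * Q.wprod l) (hθ ha) (by rwa [cact_mul])
      omega

theorem len_vanishing (P : Q.PosSys Ψ Ω h) (hθ : θ ⊆ Ω) (Pθ : Q.PosSys (vanishing Ψ v) θ h)
    {l : List (Module.Dual ℂ V)} (hl : ∀ α ∈ l, α ∈ θ) :
    len (vanishing Ψ v) h (Q.wprod l) = len Ψ h (Q.wprod l) := by
  induction l using List.reverseRecOn with
  | nil => rw [wprod_nil, P.len_one, Pθ.len_one]
  | append_singleton l a ih =>
    have hl' : ∀ α ∈ l, α ∈ θ := fun α hα => hl α (by simp [hα])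
    have ha : a ∈ θ := hl a (by simp)
    have ih := ih hl'
    rw [wprod_append, wprod_cons, wprod_nil, mul_one]
    rcases Pθ.lt_or_gt (Pθ.wprod_mem_weyl hl') (Pθ.sub ha) with h1 | h1
    · have h3 := P.len_mul_s_of_neg (hθ ha) h1
      have h4 := Pθ.len_mul_s_of_neg ha h1
      omega
    · have h3 := P.len_mul_s_of_pos (hθ ha) h1
      have h4 := Pθ.len_mul_s_of_pos ha h1
      omega

theorem mem_minReps_iff (P : Q.PosSys Ψ Ω h) (hθ : θ ⊆ Ω) (Pθ : Q.PosSys (vanishing Ψ v) θ h)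
    {σ : V ≃ₗ[ℂ] V} :
    σ ∈ Q.minReps Ψ Ω v ↔ σ ∈ Q.weyl Ψ ∧ ∀ δ ∈ θ, 0 < h (cact σ δ) := by
  refine and_congr_right fun hσ => ⟨fun H δ hδ => ?_, fun H τ hτ hτv => ?_⟩
  · rcases P.lt_or_gt hσ (P.sub (hθ hδ)) with h1 | h1
    · have hs := Q.s_mem_weyl (P.sub (hθ hδ))
      have h2 := H (Q.s δ) hs (Q.s_apply_eq_self (mem_vanishing.1 (Pθ.sub hδ)).2)
      rw [P.length_eq hσ, P.length_eq (mul_mem hσ hs)] at h2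
      have h3 := P.len_mul_s_of_neg (hθ hδ) h1
      omega
    · exact h1
  · rw [P.length_eq hσ, P.length_eq (mul_mem hσ hτ),
      P.len_mul_of_vanishing hθ Pθ hσ H (P.mem_weyl_vanishing hτ hτv)]
    omega

theorem one_mem_minReps (P : Q.PosSys Ψ Ω h) (hθ : θ ⊆ Ω) (Pθ : Q.PosSys (vanishing Ψ v) θ h) :
    1 ∈ Q.minReps Ψ Ω v :=
  (P.mem_minReps_iff hθ Pθ).2 ⟨one_mem _, fun δ hδ => by rw [cact_one]; exact Pθ.pos δ hδ⟩

theorem finite_minReps (P : Q.PosSys Ψ Ω h) : (Q.minReps Ψ Ω v).Finite := by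
  have := P.finite
  exact (Set.toFinite (Q.weyl Ψ : Set (V ≃ₗ[ℂ] V))).subset fun σ hσ => hσ.1

/-- Some δ ∈ θ is made negative by σ, so ∂_σ = ∂_{σs_δ} ∇_δ, and ∇_δ kills f. -/
theorem coef_eq_zero_of_notMem_minReps (P : Q.PosSys Ψ Ω h) (hθ : θ ⊆ Ω)
    (Pθ : Q.PosSys (vanishing Ψ v) θ h) {σ : V ≃ₗ[ℂ] V} (hσ : σ ∈ Q.weyl Ψ)
    (hmin : σ ∉ Q.minReps Ψ Ω v) {f : Poly V} (hf : ∀ δ ∈ θ, act (Q.s δ) f = f) :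
    Q.coef Ω σ f = 0 := by
  rw [P.mem_minReps_iff hθ Pθ] at hmin
  push Not at hmin
  obtain ⟨δ, hδ, hle⟩ := hmin hσ
  have hs := mul_mem hσ (Q.s_mem_weyl (P.sub (hθ hδ)))
  have hlt : h (cact σ δ) < 0 := lt_of_le_of_ne hle (P.ne _ (P.root.cact_mem hσ (P.sub (hθ hδ))))
  have h1 := P.ddiff_nablaHom hs (hθ hδ) f
  rw [if_pos, mul_s_mul_s, (Q.nablaHom_eq_zero_iff (P.ne_zero (hθ hδ)) f).2 (hf δ hδ),
    map_zero] at h1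
  · rw [coef_apply, ← h1, map_zero]
  · rw [cact_mul, P.s_self (P.sub (hθ hδ)), map_neg, map_neg]
    linarith

theorem act_s_trans (hΨΦ : Ψ ⊆ Φ) (γ : Q.invariants Φ)
    {α : Module.Dual ℂ V} (hα : α ∈ vanishing Ψ v) :
    act (Q.s α) (trans v γ) = trans v γ := by
  obtain ⟨h1, h2⟩ := mem_vanishing.1 hα
  rw [← trans_act, Q.s_apply_eq_self h2, γ.2 _ (Q.s_mem_weyl (hΨΦ h1))]

theorem bgg_eq_zero (P : Q.PosSys Ψ Ω h) (hΨΦ : Ψ ⊆ Φ) (hθ : θ ⊆ Ω)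
    (Pθ : Q.PosSys (vanishing Ψ v) θ h) {σ : V ≃ₗ[ℂ] V} (hσ : σ ∈ Q.weyl Ψ)
    (hmin : σ ∉ Q.minReps Ψ Ω v) : Q.bgg Φ Ψ Ω v σ = 0 := by
  ext γ
  rw [P.bgg_apply hσ]
  exact P.coef_eq_zero_of_notMem_minReps hθ Pθ hσ hmin fun δ hδ =>
    act_s_trans hΨΦ γ (Pθ.sub hδ)

theorem span_minReps (P : Q.PosSys Ψ Ω h) (hΨΦ : Ψ ⊆ Φ) (hθ : θ ⊆ Ω)
    (Pθ : Q.PosSys (vanishing Ψ v) θ h) :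
    Submodule.span ℂ (Q.bgg Φ Ψ Ω v '' Q.minReps Ψ Ω v) = Q.bggSpace Φ Ψ Ω v := by
  apply le_antisymm
  · exact Submodule.span_mono (Set.image_mono fun σ hσ => hσ.1)
  · rw [bggSpace, Submodule.span_le]
    rintro _ ⟨σ, hσ, rfl⟩
    by_cases hmin : σ ∈ Q.minReps Ψ Ω v
    · exact Submodule.subset_span ⟨σ, hmin, rfl⟩
    · rw [P.bgg_eq_zero hΨΦ hθ Pθ hσ hmin]
      exact zero_mem _

/-! ### Schubert polynomials of minimal coset representatives -/

/-- Minimality of σ makes s_δ σ⁻¹ω₀ shorter than σ⁻¹ω₀, so ∇_δ kills 𝔖_σ. -/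
theorem act_s_schubert (P : Q.PosSys Ψ Ω h) (hθ : θ ⊆ Ω) (Pθ : Q.PosSys (vanishing Ψ v) θ h)
    {σ : V ≃ₗ[ℂ] V} (hσ : σ ∈ Q.minReps Ψ Ω v) {δ : Module.Dual ℂ V} (hδ : δ ∈ θ) :
    act (Q.s δ) (Q.schubert Ψ Ω σ) = Q.schubert Ψ Ω σ := by
  obtain ⟨hσW, hpos⟩ := (P.mem_minReps_iff hθ Pθ).1 hσ
  rw [← nablaHom_eq_zero_iff _ (P.ne_zero (hθ hδ)), P.schubert_eq hσW, map_smul,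
    P.nablaHom_ddiff (mul_mem (inv_mem hσW) P.w0_mem) (hθ hδ), smul_zero]
  rw [mul_inv_rev, inv_inv, inv_eq_of_mul_eq_one_left P.w0_mul_w0, cact_mul]
  exact P.w0_neg _ (P.root.cact_mem hσW (P.sub (hθ hδ))) (hpos δ hδ)

theorem act_s_schubert_of_vanishing (P : Q.PosSys Ψ Ω h) (hθ : θ ⊆ Ω)
    (Pθ : Q.PosSys (vanishing Ψ v) θ h) {σ : V ≃ₗ[ℂ] V} (hσ : σ ∈ Q.minReps Ψ Ω v)
    {α : Module.Dual ℂ V} (hα : α ∈ vanishing Ψ v) :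
    act (Q.s α) (Q.schubert Ψ Ω σ) = Q.schubert Ψ Ω σ := by
  have : Q.weyl θ ≤ fixer (Q.schubert Ψ Ω σ) :=
    Q.weyl_le fun δ hδ => P.act_s_schubert hθ Pθ hσ hδ
  rw [Pθ.weyl_eq] at this
  exact this (Q.s_mem_weyl hα)

/-- Such a reflection fixes every root of Ψ, hence commutes with the divided differences and fixes
the product of the positive roots. -/
theorem act_s_schubert_of_orthogonal (P : Q.PosSys Ψ Ω h) {σ : V ≃ₗ[ℂ] V} (hσ : σ ∈ Q.weyl Ψ)
    {α : Module.Dual ℂ V} (hα : ∀ β ∈ Ψ, Q.dualForm α β = 0) :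
    act (Q.s α) (Q.schubert Ψ Ω σ) = Q.schubert Ψ Ω σ := by
  have hfix : ∀ β ∈ Ψ, cact (Q.s α) β = β := fun β hβ => by
    rw [cact_s, copair, Q.dualForm_comm β α, hα β hβ, mul_zero, zero_smul, sub_zero]
  rw [P.schubert_eq hσ, map_smul]
  congr 1
  obtain ⟨w1, -, -⟩ := P.reducedWord_spec (mul_mem (inv_mem hσ) P.w0_mem)
  rw [ddiff, Q.act_dd (Q.s_mem_orth α) fun β hβ =>
    ⟨P.ne_zero (w1 β hβ), hfix β (P.sub (w1 β hβ))⟩]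
  congr 1
  rw [posProd, map_prod]
  exact Finset.prod_congr rfl fun β hβ => by rw [act_lin, hfix β (P.mem_posRoots.1 hβ).1]

/-- Invariants lifting the Schubert polynomials of minimal coset representatives. -/
theorem exists_schubert_lift (P : Q.PosSys Ψ Ω h) (hΦ : Q.IsRootSystem Φ) (hθ : θ ⊆ Ω)
    (Pθ : Q.PosSys (vanishing Ψ v) θ h)
    (horth : ∀ α ∈ Φ, α v = 0 → α ∈ Ψ ∨ ∀ β ∈ Ψ, Q.dualForm α β = 0) {σ : V ≃ₗ[ℂ] V}
    (hσ : σ ∈ Q.minReps Ψ Ω v) : ∃ γ : Q.invariants Φ, ∀ τ ∈ Q.weyl Ψ, ∀ f,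
      Q.coef Ω τ (f * trans v γ) = Q.coef Ω τ (f * Q.schubert Ψ Ω σ) := by
  -- Condition (*) makes 𝔖_σ invariant under every reflection of Φ fixing v. Agreement modulo the
  -- power ℓ(ω₀) + 1 is invisible to all coefficient functionals.
  obtain ⟨γ, hγ⟩ := hΦ.exists_invariant_lift v (len Ψ h (Q.w0 Ψ Ω) + 1)
    (f := Q.schubert Ψ Ω σ) (fun α hα h0 => by
      rcases horth α hα h0 with h1 | h1
      · exact P.act_s_schubert_of_vanishing hθ Pθ hσ (mem_vanishing.2 ⟨h1, h0⟩)
      · exact P.act_s_schubert_of_orthogonal hσ.1 h1)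
  refine ⟨γ, fun τ hτ f => ?_⟩
  rw [← sub_eq_zero, ← map_sub, ← mul_sub]
  exact P.coef_eq_zero_of_mem hτ (Nat.lt_succ_of_le (P.len_le_w0 hτ)) (Ideal.mul_mem_left _ _ hγ)

/-! ### The longest minimal coset representative and duality -/

theorem longest_minReps_spec (P : Q.PosSys Ψ Ω h) (hθ : θ ⊆ Ω)
    (Pθ : Q.PosSys (vanishing Ψ v) θ h) :
    Q.longest Ω (Q.minReps Ψ Ω v) ∈ Q.minReps Ψ Ω v ∧
      ∀ τ ∈ Q.minReps Ψ Ω v, len Ψ h τ ≤ len Ψ h (Q.longest Ω (Q.minReps Ψ Ω v)) := by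
  obtain ⟨ω, hω, hmax⟩ := Set.exists_max_image (Q.minReps Ψ Ω v) (Q.length Ω) P.finite_minReps
    ⟨1, P.one_mem_minReps hθ Pθ⟩
  have := Classical.epsilon_spec (p := fun ω => ω ∈ Q.minReps Ψ Ω v ∧
    ∀ τ ∈ Q.minReps Ψ Ω v, Q.length Ω τ ≤ Q.length Ω ω) ⟨ω, hω, hmax⟩
  obtain ⟨h1, h2⟩ : Q.longest Ω (Q.minReps Ψ Ω v) ∈ Q.minReps Ψ Ω v ∧ ∀ τ ∈ Q.minReps Ψ Ω v,
    Q.length Ω τ ≤ Q.length Ω (Q.longest Ω (Q.minReps Ψ Ω v)) := this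
  refine ⟨h1, fun τ hτ => ?_⟩
  rw [← P.length_eq hτ.1, ← P.length_eq h1.1]
  exact h2 τ hτ

/-- ω₀ω is a minimal representative, so t is at least as long. Lengths add in tω, which therefore
reaches the length of ω₀. -/
theorem longest_mul_w0 (P : Q.PosSys Ψ Ω h) (hθ : θ ⊆ Ω) (Pθ : Q.PosSys (vanishing Ψ v) θ h) :
    Q.longest Ω (Q.minReps Ψ Ω v) * Q.w0 (vanishing Ψ v) θ = Q.w0 Ψ Ω := by
  obtain ⟨h1, h2⟩ := P.longest_minReps_spec hθ Pθ
  set t := Q.longest Ω (Q.minReps Ψ Ω v)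
  set ω := Q.w0 (vanishing Ψ v) θ with hω
  have hωm : ω ∈ Q.weyl (vanishing Ψ v) := Pθ.w0_mem
  have hωW := weyl_vanishing_le Q Ψ v hωm
  have hinv : ω⁻¹ = ω := inv_eq_of_mul_eq_one_left Pθ.w0_mul_w0
  have ht0 : Q.w0 Ψ Ω * ω ∈ Q.minReps Ψ Ω v := by
    rw [P.mem_minReps_iff hθ Pθ]
    refine ⟨mul_mem P.w0_mem hωW, fun δ hδ => ?_⟩
    have hm := Pθ.root.neg_mem (Pθ.root.cact_mem hωm (Pθ.sub hδ))
    have h3 := P.w0_neg (-cact ω δ) (mem_vanishing.1 hm).1 (by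
      rw [map_neg]
      linarith [Pθ.w0_neg δ (Pθ.sub hδ) (Pθ.pos δ hδ)])
    rw [map_neg, map_neg] at h3
    rw [cact_mul]
    linarith
  have h4 := P.len_mul_of_vanishing hθ Pθ ht0.1 ((P.mem_minReps_iff hθ Pθ).1 ht0).2 hωm
  have h5 := P.len_mul_of_vanishing hθ Pθ h1.1 ((P.mem_minReps_iff hθ Pθ).1 h1).2 hωm
  have h6 := h2 _ ht0
  rw [mul_assoc, Pθ.w0_mul_w0, mul_one] at h4
  exact P.eq_w0 (mul_mem h1.1 hωW) (by omega)

/-- 𝔖_t vanishes to order ℓ(t), the largest length in W^v, so only the constant term of f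
contributes. -/
theorem coef_mul_longest (P : Q.PosSys Ψ Ω h) (hθ : θ ⊆ Ω) (Pθ : Q.PosSys (vanishing Ψ v) θ h)
    {σ : V ≃ₗ[ℂ] V} (hσ : σ ∈ Q.minReps Ψ Ω v) (f : Poly V) :
    Q.coef Ω σ (f * Q.schubert Ψ Ω (Q.longest Ω (Q.minReps Ψ Ω v))) =
      open Classical in
      if σ = Q.longest Ω (Q.minReps Ψ Ω v) then evalAt 0 f else 0 := by
  classical
  obtain ⟨h1, h2⟩ := P.longest_minReps_spec hθ Pθ
  set t := Q.longest Ω (Q.minReps Ψ Ω v)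
  have e : f * Q.schubert Ψ Ω t = evalAt 0 f • Q.schubert Ψ Ω t +
      (f - algebraMap ℂ _ (evalAt 0 f)) * Q.schubert Ψ Ω t := by
    rw [Algebra.smul_def]; ring
  have hm : (f - algebraMap ℂ _ (evalAt 0 f)) * Q.schubert Ψ Ω t ∈
      maxIdeal (0 : V) ^ (len Ψ h t + 1) := by
    rw [pow_succ']
    refine Ideal.mul_mem_mul ?_ (P.schubert_mem_maxIdeal_pow h1.1)
    rw [mem_maxIdeal, map_sub, AlgHom.commutes]
    exact sub_self _
  rw [e, map_add, map_smul, P.coef_schubert hσ.1 h1.1,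
    P.coef_eq_zero_of_mem hσ.1 (Nat.lt_succ_of_le (h2 σ hσ)) hm, add_zero]
  split_ifs <;> simp

/-- Since ∂_{ω₀} ends in ∇_δ, both sides arise from the symmetric expression ∇_δ f · ∇_δ g. -/
theorem coef_w0_nablaHom_mul (P : Q.PosSys Ψ Ω h) {δ : Module.Dual ℂ V} (hδ : δ ∈ Ω)
    (f g : Poly V) : Q.coef Ω (Q.w0 Ψ Ω) (Q.nablaHom δ f * g) =
      Q.coef Ω (Q.w0 Ψ Ω) (f * Q.nablaHom δ g) := by
  have hm := mul_mem P.w0_mem (Q.s_mem_weyl (P.sub hδ))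
  have e : ∀ f, Q.ddiff Ω (Q.w0 Ψ Ω) f =
      Q.ddiff Ω (Q.w0 Ψ Ω * Q.s δ) (Q.nablaHom δ f) := fun f => by
    rw [P.ddiff_nablaHom hm hδ, if_pos, mul_s_mul_s]
    rw [cact_mul, P.s_self (P.sub hδ), map_neg, map_neg]
    linarith [P.w0_neg δ (P.sub hδ) (P.pos δ hδ)]
  rw [coef_apply, coef_apply, e, e (f * _),
    nablaHom_mul_of_invariant _ (P.ne_zero hδ) (Q.act_s_nablaHom (P.nonisotropic hδ) f),
    mul_comm f, nablaHom_mul_of_invariant _ (P.ne_zero hδ)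
      (Q.act_s_nablaHom (P.nonisotropic hδ) g), mul_comm]

/-- Poincaré duality for the coinvariant algebra. -/
theorem mem_coinvIdeal_of_coef_w0 (P : Q.PosSys Ψ Ω h) {f : Poly V}
    (hf : ∀ g, Q.coef Ω (Q.w0 Ψ Ω) (f * g) = 0) : f ∈ Q.coinvIdeal Ψ := by
  have hdd : ∀ l : List (Module.Dual ℂ V), (∀ α ∈ l, α ∈ Ω) →
      ∀ g, Q.coef Ω (Q.w0 Ψ Ω) (Q.dd l f * g) = 0 := by
    intro l hl
    induction l with
    | nil => exact hf
    | cons a l ih =>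
      intro g
      rw [dd_cons, P.coef_w0_nablaHom_mul (hl a (by simp))]
      exact ih (fun α hα => hl α (by simp [hα])) _
  apply P.mem_coinvIdeal_of_coef
  intro σ hσ
  obtain ⟨w1, -, -⟩ := P.reducedWord_spec hσ
  -- Modulo higher order the product of the positive roots sees only the constant term of ∂_σ f, and
  -- ∂_{ω₀} turns it into |W| (∂_σ f)(0).
  have h1 := hdd _ w1 (posProd Ψ Ω)
  change Q.coef Ω (Q.w0 Ψ Ω) (Q.ddiff Ω σ f * posProd Ψ Ω) = 0 at h1
  set g := Q.ddiff Ω σ f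
  have e : g * posProd Ψ Ω = evalAt 0 g • posProd Ψ Ω +
      (g - algebraMap ℂ _ (evalAt 0 g)) * posProd Ψ Ω := by
    rw [Algebra.smul_def]; ring
  have hm : (g - algebraMap ℂ _ (evalAt 0 g)) * posProd Ψ Ω ∈
      maxIdeal (0 : V) ^ (len Ψ h (Q.w0 Ψ Ω) + 1) := by
    rw [pow_succ']
    refine Ideal.mul_mem_mul ?_ P.posProd_mem_maxIdeal_pow
    rw [mem_maxIdeal, map_sub, AlgHom.commutes]
    exact sub_self _
  rw [e, map_add, map_smul, P.coef_w0_posProd, P.coef_eq_zero_of_mem P.w0_mem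
    (Nat.lt_succ_self _) hm, add_zero] at h1
  exact (smul_eq_zero.1 h1).resolve_right P.card_ne_zero

/-- Poincaré duality for the invariants of the stabilizer of a standard point in the coinvariant
algebra. -/
theorem mem_coinvIdeal_of_coef_longest (P : Q.PosSys Ψ Ω h) (hθ : θ ⊆ Ω)
    (Pθ : Q.PosSys (vanishing Ψ v) θ h) {f : Poly V} (hf : ∀ δ ∈ θ, act (Q.s δ) f = f)
    (H : ∀ g, (∀ δ ∈ θ, act (Q.s δ) g = g) →
      Q.coef Ω (Q.longest Ω (Q.minReps Ψ Ω v)) (f * g) = 0) : f ∈ Q.coinvIdeal Ψ := by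
  apply P.mem_coinvIdeal_of_coef_w0
  intro g
  obtain ⟨h1, -⟩ := P.longest_minReps_spec hθ Pθ
  have hmul := P.longest_mul_w0 hθ Pθ
  set t := Q.longest Ω (Q.minReps Ψ Ω v)
  set ω := Q.w0 (vanishing Ψ v) θ with hω
  have hωm : ω ∈ Q.weyl (vanishing Ψ v) := Pθ.w0_mem
  have hωW := weyl_vanishing_le Q Ψ v hωm
  have hlen := P.len_mul_of_vanishing hθ Pθ h1.1 ((P.mem_minReps_iff hθ Pθ).1 h1).2 hωm
  obtain ⟨l, hl, hp, hlenl⟩ := Pθ.exists_reduced hωm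
  have hlΩ : ∀ α ∈ l, α ∈ Ω := fun α hα => hθ (hl α hα)
  have hdd : ∀ g, Q.ddiff Ω ω g = Q.dd l g := fun g => by
    rw [P.dd_eq_ddiff hlΩ, hp]
    rw [← P.len_vanishing hθ Pθ hl, hp, hlenl]
  -- ∂_{ω₀} = ∂_t ∂_ω because lengths add. The factor f passes through ∂_ω, and ∂_ω g is fixed by
  -- the reflections in θ, so `H` applies to it.
  have h2 := P.ddiff_ddiff h1.1 hωW (f * g)
  rw [if_pos hlen, hmul] at h2
  rw [coef_apply, ← h2, hdd, Q.dd_mul_of_invariant (fun α hα => P.ne_zero (hlΩ α hα))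
    (fun α hα => hf α (hl α hα)), ← hdd]
  apply H
  intro δ hδ
  rw [← nablaHom_eq_zero_iff _ (P.ne_zero (hθ hδ))]
  apply P.nablaHom_ddiff hωW (hθ hδ)
  rw [inv_eq_of_mul_eq_one_left Pθ.w0_mul_w0]
  exact Pθ.w0_neg δ (Pθ.sub hδ) (Pθ.pos δ hδ)

/-! ### Cyclic generators and bases of 𝒟(Ω, v). -/

/-- The map `γ ↦ γ · x` from invariants to functionals on invariants. -/
def orbitMap (x : Module.Dual ℂ (Q.invariants Φ)) :
    Q.invariants Φ →ₗ[ℂ] Module.Dual ℂ (Q.invariants Φ) where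
  toFun γ := Q.dualAct γ x
  map_add' γ γ' := by
    ext f
    change x ((γ + γ') * f) = x (γ * f) + x (γ' * f)
    rw [add_mul, map_add]
  map_smul' c γ := by
    ext f
    change x ((c • γ) * f) = c * x (γ * f)
    rw [smul_mul_assoc, map_smul, smul_eq_mul]

theorem orbitMap_apply (x : Module.Dual ℂ (Q.invariants Φ)) (γ f : Q.invariants Φ) :
    orbitMap x γ f = x (γ * f) := rfl

/-- An invariant γ killed by Γ · 𝒟_t has T_v γ ∈ I_W by duality for W_v-invariants, so every 𝒟_σ
kills it. In finite dimension this gives 𝒟(Ω, v) ⊆ Γ · 𝒟_t. -/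
theorem exists_eq_dualAct_longest (P : Q.PosSys Ψ Ω h) (hΦ : Q.IsRootSystem Φ) (hΨΦ : Ψ ⊆ Φ)
    (hθ : θ ⊆ Ω) (Pθ : Q.PosSys (vanishing Ψ v) θ h)
    (horth : ∀ α ∈ Φ, α v = 0 → α ∈ Ψ ∨ ∀ β ∈ Ψ, Q.dualForm α β = 0)
    {x : Module.Dual ℂ (Q.invariants Φ)} (hx : x ∈ Q.bggSpace Φ Ψ Ω v) :
    ∃ γ : Q.invariants Φ,
      x = Q.dualAct γ (Q.bgg Φ Ψ Ω v (Q.longest Ω (Q.minReps Ψ Ω v))) := by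
  have := P.finite
  have := Fintype.ofFinite (Q.weyl Ψ)
  obtain ⟨h1, h2⟩ := P.longest_minReps_spec hθ Pθ
  set t := Q.longest Ω (Q.minReps Ψ Ω v)
  let F := LinearMap.range (orbitMap (Q.bgg Φ Ψ Ω v t))
  have hfin : FiniteDimensional ℂ (Q.bggSpace Φ Ψ Ω v) :=
    FiniteDimensional.span_of_finite ℂ ((Set.toFinite (Q.weyl Ψ : Set (V ≃ₗ[ℂ] V))).image _)
  have hF : F ≤ Q.bggSpace Φ Ψ Ω v := by
    rintro _ ⟨γ, rfl⟩
    exact P.dualAct_mem γ (bgg_mem h1.1)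
  have : FiniteDimensional ℂ F := Submodule.finiteDimensional_of_le hF
  suffices H : Q.bggSpace Φ Ψ Ω v ≤ F by
    obtain ⟨γ, hγ⟩ := H hx
    exact ⟨γ, hγ.symm⟩
  rw [← Subspace.dualCoannihilator_dualAnnihilator_eq (W := F), bggSpace, Submodule.span_le]
  rintro _ ⟨σ, hσ, rfl⟩
  change _ ∈ F.dualCoannihilator.dualAnnihilator
  rw [Submodule.mem_dualAnnihilator]
  intro γ hγ
  rw [Submodule.mem_dualCoannihilator] at hγ
  rw [P.bgg_apply hσ]
  refine P.coef_of_mem_coinvIdeal ?_ hσ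
  apply P.mem_coinvIdeal_of_coef_longest hθ Pθ fun δ hδ => act_s_trans hΨΦ γ (Pθ.sub hδ)
  intro g hg
  have hL := P.eq_sum_coef (Q.coef Ω t ∘ₗ LinearMap.mulLeft ℂ (trans v γ)) (fun f hf =>
    P.coef_of_mem_coinvIdeal (Ideal.mul_mem_left _ _ hf) h1.1) g
  change Q.coef Ω t (trans v γ * g) = _ at hL
  rw [hL]
  -- A W_v-invariant g has nonzero coefficients only at τ ∈ W^v, and for those 𝔖_τ can be replaced
  -- by the translate of an element of Γ, where `hγ` applies.
  refine Finset.sum_eq_zero fun τ _ => ?_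
  by_cases hτ : τ.1 ∈ Q.minReps Ψ Ω v
  · obtain ⟨γτ, hγτ⟩ := P.exists_schubert_lift hΦ hθ Pθ horth hτ
    have h3 := hγ _ ⟨γτ, rfl⟩
    rw [orbitMap_apply, mul_comm, P.bgg_apply h1.1, Subalgebra.coe_mul, map_mul,
      hγτ t h1.1] at h3
    change _ * Q.coef Ω t (trans v γ * Q.schubert Ψ Ω τ) = 0
    rw [h3, mul_zero]
  · rw [P.coef_eq_zero_of_notMem_minReps hθ Pθ τ.2 hτ hg, zero_mul]

theorem exists_dual_lift (P : Q.PosSys Ψ Ω h) (hΦ : Q.IsRootSystem Φ) (hθ : θ ⊆ Ω)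
    (Pθ : Q.PosSys (vanishing Ψ v) θ h)
    (horth : ∀ α ∈ Φ, α v = 0 → α ∈ Ψ ∨ ∀ β ∈ Ψ, Q.dualForm α β = 0) {τ : V ≃ₗ[ℂ] V}
    (hτ : τ ∈ Q.minReps Ψ Ω v) : ∃ γ : Q.invariants Φ, ∀ σ ∈ Q.weyl Ψ,
      Q.bgg Φ Ψ Ω v σ γ = open Classical in if σ = τ then 1 else 0 := by
  obtain ⟨γ, hγ⟩ := P.exists_schubert_lift hΦ hθ Pθ horth hτ
  refine ⟨γ, fun σ hσ => ?_⟩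
  have h1 := hγ σ hσ 1
  rw [one_mul, one_mul, P.coef_schubert hσ hτ.1] at h1
  rw [P.bgg_apply hσ, h1]

theorem linearIndependent_bgg (P : Q.PosSys Ψ Ω h) (hΦ : Q.IsRootSystem Φ) (hθ : θ ⊆ Ω)
    (Pθ : Q.PosSys (vanishing Ψ v) θ h)
    (horth : ∀ α ∈ Φ, α v = 0 → α ∈ Ψ ∨ ∀ β ∈ Ψ, Q.dualForm α β = 0) :
    LinearIndependent ℂ (fun σ : Q.minReps Ψ Ω v => Q.bgg Φ Ψ Ω v σ) := by
  classical
  rw [linearIndependent_iff']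
  intro s a ha τ hτ
  obtain ⟨γ, hγ⟩ := P.exists_dual_lift hΦ hθ Pθ horth τ.2
  have h1 := DFunLike.congr_fun ha γ
  rw [LinearMap.sum_apply, Finset.sum_eq_single τ] at h1
  · rw [LinearMap.smul_apply, hγ _ τ.2.1, if_pos rfl, smul_eq_mul, mul_one] at h1
    exact h1
  · intro σ _ hne
    rw [LinearMap.smul_apply, hγ _ σ.2.1, if_neg fun H => hne (Subtype.ext H), smul_zero]
  · intro H; exact absurd hτ H

theorem finsum_apply_of_dual (P : Q.PosSys Ψ Ω h) {a : (V ≃ₗ[ℂ] V) → ℂ} {τ : V ≃ₗ[ℂ] V}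
    (hτ : τ ∈ Q.minReps Ψ Ω v) {γ : Q.invariants Φ} {c : ℂ}
    (hγ : ∀ σ ∈ Q.minReps Ψ Ω v,
      Q.bgg Φ Ψ Ω v σ γ = open Classical in if σ = τ then c else 0) :
    (∑ᶠ σ ∈ Q.minReps Ψ Ω v, a σ • Q.bgg Φ Ψ Ω v σ) γ = a τ * c := by
  classical
  rw [finsum_mem_eq_finite_toFinset_sum _ P.finite_minReps, LinearMap.sum_apply,
    Finset.sum_eq_single τ]
  · rw [LinearMap.smul_apply, hγ τ hτ, if_pos rfl, smul_eq_mul]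
  · intro σ hσ hne
    rw [LinearMap.smul_apply, hγ σ ((Set.Finite.mem_toFinset _).1 hσ), if_neg hne, smul_zero]
  · intro H; exact absurd ((Set.Finite.mem_toFinset _).2 hτ) H

theorem finsum_mem_bggSpace (P : Q.PosSys Ψ Ω h) (a : (V ≃ₗ[ℂ] V) → ℂ) :
    ∑ᶠ σ ∈ Q.minReps Ψ Ω v, a σ • Q.bgg Φ Ψ Ω v σ ∈ Q.bggSpace Φ Ψ Ω v := by
  rw [finsum_mem_eq_finite_toFinset_sum _ P.finite_minReps]
  exact Submodule.sum_mem _ fun σ hσ =>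
    Submodule.smul_mem _ _ (bgg_mem ((Set.Finite.mem_toFinset _).1 hσ).1)

/-- The invariant γt lifting 𝔖_t reads off the leading coefficient: x(γ γt) = a_t γ(v). If a_t = 0,
no γ · x takes the value 𝒟_t(γt) = 1. If a_t ≠ 0, then x = u · 𝒟_t with u(v) = a_t, and u is
invertible modulo an ideal annihilating 𝒟(Ω, v). -/
theorem range_dualAct_iff (P : Q.PosSys Ψ Ω h) (hΦ : Q.IsRootSystem Φ) (hΨΦ : Ψ ⊆ Φ)
    (hθ : θ ⊆ Ω) (Pθ : Q.PosSys (vanishing Ψ v) θ h)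
    (horth : ∀ α ∈ Φ, α v = 0 → α ∈ Ψ ∨ ∀ β ∈ Ψ, Q.dualForm α β = 0)
    (a : (V ≃ₗ[ℂ] V) → ℂ) (x : Module.Dual ℂ (Q.invariants Φ))
    (hx : x = ∑ᶠ σ ∈ Q.minReps Ψ Ω v, a σ • Q.bgg Φ Ψ Ω v σ) :
    ((Q.bggSpace Φ Ψ Ω v : Set (Module.Dual ℂ (Q.invariants Φ))) =
        Set.range fun γ : Q.invariants Φ => Q.dualAct γ x) ↔
      a (Q.longest Ω (Q.minReps Ψ Ω v)) ≠ 0 := by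
  classical
  have hmul := fun σ hσ => P.coef_mul_longest hθ Pθ (σ := σ) hσ
  have hex := fun y hy => P.exists_eq_dualAct_longest hΦ hΨΦ hθ Pθ horth (x := y) hy
  obtain ⟨h1, h2⟩ := P.longest_minReps_spec hθ Pθ
  set t := Q.longest Ω (Q.minReps Ψ Ω v)
  have hxm : x ∈ Q.bggSpace Φ Ψ Ω v := hx ▸ P.finsum_mem_bggSpace a
  obtain ⟨γt, hγt⟩ := P.exists_schubert_lift hΦ hθ Pθ horth h1
  have hbgg : ∀ γ : Q.invariants Φ, ∀ σ ∈ Q.minReps Ψ Ω v,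
      Q.bgg Φ Ψ Ω v σ (γ * γt) = if σ = t then Q.ev Φ v γ else 0 := by
    intro γ σ hσ
    rw [P.bgg_apply hσ.1, Subalgebra.coe_mul, map_mul, hγt σ hσ.1, hmul σ hσ, evalAt_trans,
      zero_add, ev_apply]
  have hxval : ∀ γ : Q.invariants Φ, x (γ * γt) = a t * Q.ev Φ v γ := fun γ => by
    rw [hx]
    exact P.finsum_apply_of_dual h1 (hbgg γ)
  constructor
  · intro H h0
    have h3 : Q.bgg Φ Ψ Ω v t ∈ (Q.bggSpace Φ Ψ Ω v : Set (Module.Dual ℂ (Q.invariants Φ))) :=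
      bgg_mem h1.1
    rw [H] at h3
    obtain ⟨γ, hγ⟩ := h3
    have h4 := DFunLike.congr_fun hγ γt
    change x (γ * γt) = _ at h4
    have h5 := hbgg 1 t h1
    rw [one_mul, if_pos rfl, ev_apply, Subalgebra.coe_one, map_one] at h5
    rw [hxval, h0, zero_mul, h5] at h4
    exact zero_ne_one h4
  · intro h0
    apply Set.Subset.antisymm
    · obtain ⟨u, hu⟩ := hex x hxm
      have hev : Q.ev Φ v u = a t := by
        have h3 := hxval 1
        rw [one_mul] at h3
        rw [hu] at h3
        change Q.bgg Φ Ψ Ω v t (u * γt) = _ at h3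
        rw [hbgg u t h1, if_pos rfl, ev_apply, ev_apply, Subalgebra.coe_one, map_one,
          mul_one] at h3
        exact h3
      set k := len Ψ h (Q.w0 Ψ Ω) + 1
      let c : Q.invariants Φ := algebraMap ℂ _ (a t)
      -- c - u vanishes at v, so its k-th power acts as zero and q is an inverse of u up to the
      -- scalar a_t^k.
      obtain ⟨q, hq⟩ : u ∣ c ^ k - (c - u) ^ k := by
        have := sub_dvd_pow_sub_pow c (c - u) k
        rwa [sub_sub_cancel] at this
      have hnil : ((c - u : Q.invariants Φ) : Poly V) ∈ maxIdeal v := by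
        rw [mem_maxIdeal, Subalgebra.coe_sub, map_sub]
        have e1 : evalAt v (c : Poly V) = a t := AlgHom.commutes _ _
        rw [e1, ← ev_apply, hev, sub_self]
      have ht : ∀ f, a t ^ k * Q.bgg Φ Ψ Ω v t f = x (q * f) := by
        intro f
        rw [hu]
        change _ = Q.bgg Φ Ψ Ω v t (u * (q * f))
        have hz : Q.bgg Φ Ψ Ω v t ((c - u) ^ k * f) = 0 :=
          P.apply_mul_eq_zero (Nat.lt_succ_self _) (by
            rw [Subalgebra.coe_pow]
            exact Ideal.pow_mem_pow hnil _) (bgg_mem h1.1) f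
        rw [← mul_assoc, ← hq, sub_mul, map_sub, hz, sub_zero]
        have e2 : c ^ k * f = a t ^ k • f := by
          rw [Algebra.smul_def, map_pow]
        rw [e2, map_smul, smul_eq_mul]
      intro y hy
      obtain ⟨γ, rfl⟩ := hex y hy
      refine ⟨(a t ^ k)⁻¹ • (q * γ), ?_⟩
      ext f
      change x (((a t ^ k)⁻¹ • (q * γ)) * f) = Q.bgg Φ Ψ Ω v t (γ * f)
      rw [smul_mul_assoc, map_smul, mul_assoc, ← ht, smul_eq_mul,
        inv_mul_cancel_left₀ (pow_ne_zero _ h0)]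
    · rintro _ ⟨γ, rfl⟩
      exact P.dualAct_mem γ hxm

theorem dualAct_sub_eq_zero_iff_coeff (P : Q.PosSys Ψ Ω h) (hΦ : Q.IsRootSystem Φ)
    (hθ : θ ⊆ Ω) (Pθ : Q.PosSys (vanishing Ψ v) θ h)
    (horth : ∀ α ∈ Φ, α v = 0 → α ∈ Ψ ∨ ∀ β ∈ Ψ, Q.dualForm α β = 0)
    (a : (V ≃ₗ[ℂ] V) → ℂ) (x : Module.Dual ℂ (Q.invariants Φ))
    (hx : x = ∑ᶠ σ ∈ Q.minReps Ψ Ω v, a σ • Q.bgg Φ Ψ Ω v σ) :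
    (∀ γ : Q.invariants Φ, Q.dualAct γ x - Q.ev Φ v γ • x = 0) ↔
      ∀ σ ∈ Q.minReps Ψ Ω v, σ ≠ 1 → a σ = 0 := by
  classical
  rw [dualAct_sub_eq_zero_iff]
  constructor
  · rintro ⟨c, hc⟩ τ hτ hne
    obtain ⟨γ, hγ⟩ := P.exists_dual_lift hΦ hθ Pθ horth hτ
    have h1 := P.finsum_apply_of_dual (a := a) hτ fun σ hσ => hγ σ hσ.1
    rw [← hx, hc, LinearMap.smul_apply, ← P.bgg_one, hγ 1 (one_mem _), if_neg hne.symm,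
      smul_zero, mul_one] at h1
    exact h1.symm
  · intro H
    refine ⟨a 1, ?_⟩
    rw [hx, finsum_mem_eq_finite_toFinset_sum _ P.finite_minReps, Finset.sum_eq_single 1,
      P.bgg_one]
    · intro σ hσ hne
      rw [H σ ((Set.Finite.mem_toFinset _).1 hσ) hne, zero_smul]
    · intro h1
      exact absurd ((Set.Finite.mem_toFinset _).2 (P.one_mem_minReps hθ Pθ)) h1

end PosSys

end InnerForm

end BGG

end

theorem propositionP {V : Type*} [AddCommGroup V] [Module ℂ V] [FiniteDimensional ℂ V]
    (Q : BGG.InnerForm V) (Φ Ψ Ω : Finset (Module.Dual ℂ V))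
    (hΦ : Q.IsRootSystem Φ) (hΨ : Q.IsRootSystem Ψ) (hΨΦ : Ψ ⊆ Φ) (hΩ : BGG.IsBase Ψ Ω)
    (v : V) (hv : Q.IsStandard Ψ Ω v) :
    -- (a)
    (Submodule.span ℂ (Q.bgg Φ Ψ Ω v '' Q.minReps Ψ Ω v) = Q.bggSpace Φ Ψ Ω v ∧
      ∀ σ ∈ Q.weyl Ψ, σ ∉ Q.minReps Ψ Ω v → Q.bgg Φ Ψ Ω v σ = 0) ∧
    -- (a), (b), (c) when the roots vanishing at `v` lie in `Ψ` or are orthogonal to `Ψ`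
    ((∀ α ∈ Φ, α v = 0 → α ∈ Ψ ∨ ∀ β ∈ Ψ, Q.dualForm α β = 0) →
      LinearIndependent ℂ (fun σ : Q.minReps Ψ Ω v => Q.bgg Φ Ψ Ω v σ) ∧
      ∀ (a : (V ≃ₗ[ℂ] V) → ℂ) (x : Module.Dual ℂ (Q.invariants Φ)),
        x = ∑ᶠ σ ∈ Q.minReps Ψ Ω v, a σ • Q.bgg Φ Ψ Ω v σ →
        (((Q.bggSpace Φ Ψ Ω v : Set (Module.Dual ℂ (Q.invariants Φ))) =
            Set.range fun γ : Q.invariants Φ => Q.dualAct γ x) ↔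
          a (Q.longest Ω (Q.minReps Ψ Ω v)) ≠ 0) ∧
        ((∀ γ : Q.invariants Φ, Q.dualAct γ x - Q.ev Φ v γ • x = 0) ↔
          ∀ σ ∈ Q.minReps Ψ Ω v, σ ≠ 1 → a σ = 0)) ∧
    -- (c)
    (Q.ev Φ v ∈ Q.bggSpace Φ Ψ Ω v ∧
      ∀ x ∈ Q.bggSpace Φ Ψ Ω v,
        (∀ γ : Q.invariants Φ, Q.dualAct γ x - Q.ev Φ v γ • x = 0) ↔
          ∃ c : ℂ, x = c • Q.ev Φ v) ∧
    -- (d)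
    (∀ v' : V,
      (Q.bggSpace Φ Ψ Ω v ⊓ Q.bggSpace Φ Ψ Ω v' ≠ ⊥ ↔ ∃ g ∈ Q.weyl Φ, v' = g v) ∧
      ((∃ w ∈ Q.weyl Ψ, v' = w v) → Q.bggSpace Φ Ψ Ω v = Q.bggSpace Φ Ψ Ω v')) := by
  obtain ⟨h, P⟩ := BGG.InnerForm.exists_posSys_of_base hΨ hΩ
  -- The same functional h defines positivity for W and for W_v, so the two length functions are
  -- compatible.
  obtain ⟨θ, hθ, Pθ⟩ := BGG.InnerForm.exists_posSys_vanishing hΩ P hv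
  refine ⟨⟨P.span_minReps hΨΦ hθ Pθ, fun σ hσ hmin => P.bgg_eq_zero hΨΦ hθ Pθ hσ hmin⟩,
    fun horth => ⟨P.linearIndependent_bgg hΦ hθ Pθ horth, fun a x hx =>
      ⟨P.range_dualAct_iff hΦ hΨΦ hθ Pθ horth a x hx,
        P.dualAct_sub_eq_zero_iff_coeff hΦ hθ Pθ horth a x hx⟩⟩,
    ⟨P.ev_mem v, fun x _ => BGG.InnerForm.dualAct_sub_eq_zero_iff⟩, fun v' =>
      ⟨P.bggSpace_inf_ne_bot_iff hΦ, ?_⟩⟩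
  rintro ⟨w, hw, rfl⟩
  exact P.bggSpace_eq_of_mem_weyl hΨΦ hw v
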